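/- **Setting.** Let $d\in\{1,2,3\}$ and let $\Omega\subset\mathbb R^d$ be a bounded Lipschitz domain; $\|\cdot\|$ is the norm of $L^2(\Omega)$, and $\|u\|_{H^1(\Omega)}^2=\|u\|^2+\|\nabla u\|^2$. Let $V$ be a closed subspace of $H^1(\Omega)$ and $a:V\times V\to\mathbb R$ a symmetric bilinear form with $$|a(u,v)|\le C_{\rm cont}\|u\|_{H^1(\Omega)}\|v\|_{H^1(\Omega)},\qquad a(u,u)\ge c_{\rm coer}\|u\|_{H^1(\Omega)}^2\qquad(u,v\in V),\qquad 0<c_{\rm coer}\le C_{\rm cont}.$$ *Mesh.* Let $\mathcal T$ be a conforming mesh of finitely many closed simplices with $\bigcup_{\tau\in\mathcal T}\tau=\overline\Omega$; $h_\tau$ is the diameter of $\tau$, $\rho_\tau$ the diameter of its largest inscribed ball, $h=\max_\tau h_\tau\le h_0$ with a fixed $h_0>0$, and $\gamma=\max_\tau h_\tau/\rho_\tau$. Let $\mathcal T_{\rm c}\ne\emptyset$ be a subset of $\mathcal T$ (the coarse part), $h_{\rm c}:=h$, $C_{\rm qu,c}:=h_{\rm c}/\min_{\tau\in\mathcal T_{\rm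 c}}h_\tau$, and $\Omega_{\rm f}:=\operatorname{int}\bigcup_{\tau\in\mathcal T\setminus\mathcal T_{\rm c}}\tau$. Let $p\ge1$ be an integer with $h_{\rm c}/h_\tau\le C_{\rm qu,c}\,p$ for all $\tau\in\mathcal T$. *Finite elements.* Let $\mathbb P_k$ be the $d$-variate polynomials of total degree at most $k$, and let $P$ be a space of polynomials with $\mathbb P_m\subset P\subset\mathbb P_{m'}$, $m\ge1$. With fixed affine maps $\phi_\tau$ of the reference simplex onto $\tau$, put $S=\{u\in V:\ u\circ\phi_\tau\in P\ \ \forall\tau\in\mathcal T\}$. Let $(b_z)_{z\in\Sigma}$ be a basis of $S$, indexed by a finite set of points $\Sigma\subset\overline\Omega$, with $\operatorname{supp}b_z\subset\bigcup\{\tau\in\mathcal T: z\in\tau\}$. Let $d_z>0$ $(z\in\Sigma)$. For $u=\sum_zu_zb_z$ and $v=\sum_zv_zb_z$ put $(u,v)_{\mathcal T}=\sum_zd_zu_zv_z$ and $\|u\|_{\mathcal T}=(u,u)_{\mathcal T}^{1/2}$, and suppose that $C_{\rm eq}^{-1}\|u\|_{\mathcal T}\le\|u\|\le C_{\rm eq}\|u\|_{\mathcal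 T}$ for all $u\in S$, where $C_{\rm eq}>0$. Let $A^S:S\to S$ be defined by $(A^Su,v)_{\mathcal T}=a(u,v)$ for all $v\in S$, and put $\Pi_{\rm f}\big(\sum_{z\in\Sigma}u_zb_z\big)=\sum_{z\in\Sigma\cap\overline{\Omega_{\rm f}}}u_zb_z$. *Stabilized polynomials.* Let $0\le\nu\le\frac12$, let $T_p$ be the Chebyshev polynomial of the first kind, $\delta=1+\nu/p^2$, $\omega=2T_p'(\delta)/T_p(\delta)$, $$P_{p,\nu}(x)=2\Big(1-\frac{T_p(\delta-x/\omega)}{T_p(\delta)}\Big),\qquad Q(x)=1-\frac{P_{p,\nu}(\Delta t^2x)}{\Delta t^2x},\qquad a^{p,\nu}(u,v)=a\big(u-Q(\Pi_{\rm f}A^S)u,\,v\big).$$ *CFL condition.* Let $C_{\rm inv,loc}$, which depends only on $d$, $\gamma$ and $m'$, be the least constant with $\|\nabla q\|_{L^2(\tau)}\le C_{\rm inv,loc}h_\tau^{-1}\|q\|_{L^2(\tau)}$ for all $q\in\mathbb P_{m'}$ and all simplices $\tau\subset\mathbb R^d$ with $h_\tau/\rho_\tau\le\gamma$, and put $C_{\rm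 inv}=C_{\rm eq}\sqrt{h_0^2+C_{\rm qu,c}^2C_{\rm inv,loc}^2}$. Let $T>0$, let $N\ge1$ be an integer, $\Delta t=T/N$, $t_n=n\Delta t$, and suppose that $$\Big(3+\frac{C_{\rm cont}}{c_{\rm coer}}\Big)C_{\rm cont}C_{\rm inv}^2\Big(\frac{\Delta t}{h_{\rm c}}\Big)^2\le\frac{\nu}{\nu+1}.$$ *Solutions.* Let $u_0,v_0$ be initial data and $r_Su_0,r_Sv_0\in S$ their images under the chosen map $r_S$ into $S$. Let $u_S:[0,T]\to S$ solve $(\ddot u_S,w)_{\mathcal T}+a(u_S,w)=0$ for all $w\in S$, with $u_S(0)=r_Su_0$ and $\dot u_S(0)=r_Sv_0$, and suppose that $u_S\in W^{5,\infty}([0,T];L^2(\Omega))$. Let $u_S^{(0)}=r_Su_0$, $u_S^{(1)}=r_Su_0+\Delta t\,r_Sv_0-\frac{\Delta t^2}{2}A^Sr_Su_0$ and, for $n\ge1$, $$\big(u_S^{(n+1)}-2u_S^{(n)}+u_S^{(n-1)},w\big)_{\mathcal T}=-\Delta t^2\,a^{p,\nu}\big(u_S^{(n)},w\big)\qquad\forall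 w\in S.$$ **Theorem.** There is a constant $C$, which depends only on $d,m,m',\nu,h_0,c_{\rm coer},C_{\rm cont},C_{\rm eq}$ (in particular not on $n$, $\Delta t$, $T$, $h$, $p$ or $u_S$), such that in this setting, for all $n\ge0$ with $t_{n+1}\le T$, $$\big\|u_S(t_{n+1})-u_S^{(n+1)}\big\|\le C\,\Delta t^2(1+T)\max_{2\le\ell\le5}\big\|\partial_t^\ell u_S\big\|_{L^\infty([0,T];L^2(\Omega))}.$$ -/

import Mathlib

open MeasureTheory Set
open scoped ContDiff

noncomputable section

namespace LTS

/-! ## Sobolev spaces on a domain of Euclidean space -/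

/-- The Euclidean space of dimension `d`. -/
abbrev E (d : ℕ) : Type := EuclideanSpace ℝ (Fin d)

/-- The space of square integrable functions on `Ω`. -/
abbrev L2 {d : ℕ} (Ω : Set (E d)) : Type := Lp ℝ 2 (volume.restrict Ω)

/-- The space of square integrable vector fields on `Ω`. -/
abbrev L2vec {d : ℕ} (Ω : Set (E d)) : Type := Lp (E d) 2 (volume.restrict Ω)

/-- Pairs `(u, G)` with the Hilbert norm `(‖u‖² + ‖G‖²)^(1/2)`. -/
abbrev L2pair {d : ℕ} (Ω : Set (E d)) : Type := WithLp 2 (L2 Ω × L2vec Ω)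

/-- A bounded Lipschitz domain: open, connected, bounded and, near each boundary point, the strict
epigraph of a Lipschitz function over the hyperplane orthogonal to some unit vector `e`. -/
def IsLipschitzDomain {d : ℕ} (Ω : Set (E d)) : Prop :=
  IsOpen Ω ∧ IsConnected Ω ∧ Bornology.IsBounded Ω ∧
    ∀ x₀ ∈ frontier Ω, ∃ e : E d, ‖e‖ = 1 ∧ ∃ r : ℝ, 0 < r ∧ ∃ (K : NNReal) (g : E d → ℝ),
      LipschitzWith K g ∧ ∀ x ∈ Metric.ball x₀ r,
        (x ∈ Ω ↔ g (x - inner ℝ e x • e) < inner ℝ e x)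

/-- Test functions on `Ω`. -/
def IsTestFunction {d : ℕ} (Ω : Set (E d)) (φ : E d → ℝ) : Prop :=
  ContDiff ℝ ∞ φ ∧ HasCompactSupport φ ∧ tsupport φ ⊆ Ω

/-- `G` is the weak gradient of `u` on `Ω`. -/
def HasWeakGradient {d : ℕ} (Ω : Set (E d)) (u : L2 Ω) (G : L2vec Ω) : Prop :=
  ∀ φ : E d → ℝ, IsTestFunction Ω φ → ∀ i : Fin d,
    ∫ x in Ω, u x * fderiv ℝ φ x (EuclideanSpace.single i 1) = - ∫ x in Ω, G x i * φ x

theorem IsTestFunction.memLp {d : ℕ} {Ω : Set (E d)} {φ : E d → ℝ} (h : IsTestFunction Ω φ) :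
    MemLp φ 2 (volume.restrict Ω) :=
  (h.1.continuous.memLp_of_hasCompactSupport h.2.1).restrict Ω

theorem IsTestFunction.memLp_fderiv {d : ℕ} {Ω : Set (E d)} {φ : E d → ℝ}
    (h : IsTestFunction Ω φ) (v : E d) :
    MemLp (fun x => fderiv ℝ φ x v) 2 (volume.restrict Ω) := by
  refine (Continuous.memLp_of_hasCompactSupport (μ := volume) (p := 2) ?_ ?_).restrict Ω
  · exact (h.1.continuous_fderiv (by simp)).clm_apply continuous_const
  · exact h.2.1.fderiv_apply (𝕜 := ℝ) v

theorem memLp_coord {d : ℕ} {Ω : Set (E d)} (G : L2vec Ω) (i : Fin d) :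
    MemLp (fun x => G x i) 2 (volume.restrict Ω) :=
  (EuclideanSpace.proj (𝕜 := ℝ) i).comp_memLp' (Lp.memLp G)

/-- The Sobolev space `H¹(Ω)`, realized as the graph of the weak gradient: the elements are the
pairs `(u, ∇u)`, and the norm of the surrounding space is the `H¹`-norm
`(‖u‖² + ‖∇u‖²)^(1/2)`. -/
def H1 {d : ℕ} (Ω : Set (E d)) : Submodule ℝ (L2pair Ω) where
  carrier := {u | HasWeakGradient Ω u.fst u.snd}
  zero_mem' := by
    intro φ _ i
    have h1 : ∫ x in Ω, ((0 : L2 Ω) : E d → ℝ) x * fderiv ℝ φ x (EuclideanSpace.single i 1)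
        = 0 := by
      refine integral_eq_zero_of_ae ?_
      filter_upwards [AEEqFun.coeFn_zero (β := ℝ) (μ := volume.restrict Ω)] with x hx
      have hx' : ((0 : L2 Ω) : E d → ℝ) x = 0 := hx
      rw [hx', zero_mul, Pi.zero_apply]
    have h2 : ∫ x in Ω, ((0 : L2vec Ω) : E d → E d) x i * φ x = 0 := by
      refine integral_eq_zero_of_ae ?_
      filter_upwards [AEEqFun.coeFn_zero (β := E d) (μ := volume.restrict Ω)] with x hx
      have hx' : ((0 : L2vec Ω) : E d → E d) x = 0 := hx
      rw [hx', PiLp.zero_apply, zero_mul, Pi.zero_apply]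
    change ∫ x in Ω, ((0 : L2 Ω) : E d → ℝ) x * fderiv ℝ φ x (EuclideanSpace.single i 1)
      = - ∫ x in Ω, ((0 : L2vec Ω) : E d → E d) x i * φ x
    rw [h1, h2, neg_zero]
  add_mem' := by
    intro u v hu hv φ hφ i
    have hf := hφ.memLp_fderiv (EuclideanSpace.single i (1 : ℝ))
    have h1 : ∫ x in Ω, ((u.fst + v.fst : L2 Ω) x) * fderiv ℝ φ x (EuclideanSpace.single i 1)
        = ∫ x in Ω, (u.fst x * fderiv ℝ φ x (EuclideanSpace.single i 1)
          + v.fst x * fderiv ℝ φ x (EuclideanSpace.single i 1)) := by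
      refine integral_congr_ae ?_
      filter_upwards [Lp.coeFn_add u.fst v.fst] with x hx
      simp only [hx, Pi.add_apply]
      ring
    have h2 : ∫ x in Ω, ((u.snd + v.snd : L2vec Ω) x) i * φ x
        = ∫ x in Ω, (u.snd x i * φ x + v.snd x i * φ x) := by
      refine integral_congr_ae ?_
      filter_upwards [Lp.coeFn_add u.snd v.snd] with x hx
      simp only [hx, Pi.add_apply, PiLp.add_apply]
      ring
    change ∫ x in Ω, ((u.fst + v.fst : L2 Ω) x) * fderiv ℝ φ x (EuclideanSpace.single i 1)
      = - ∫ x in Ω, ((u.snd + v.snd : L2vec Ω) x) i * φ x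
    have i1 : Integrable (fun x => u.fst x * fderiv ℝ φ x (EuclideanSpace.single i 1))
        (volume.restrict Ω) := (Lp.memLp u.fst).integrable_mul hf
    have i2 : Integrable (fun x => v.fst x * fderiv ℝ φ x (EuclideanSpace.single i 1))
        (volume.restrict Ω) := (Lp.memLp v.fst).integrable_mul hf
    have i3 : Integrable (fun x => u.snd x i * φ x) (volume.restrict Ω) :=
      (memLp_coord u.snd i).integrable_mul hφ.memLp
    have i4 : Integrable (fun x => v.snd x i * φ x) (volume.restrict Ω) :=
      (memLp_coord v.snd i).integrable_mul hφ.memLp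
    rw [h1, h2, integral_add i1 i2, integral_add i3 i4, hu φ hφ i, hv φ hφ i]
    ring
  smul_mem' := by
    intro c u hu φ hφ i
    have h1 : ∫ x in Ω, ((c • u.fst : L2 Ω) x) * fderiv ℝ φ x (EuclideanSpace.single i 1)
        = ∫ x in Ω, c * (u.fst x * fderiv ℝ φ x (EuclideanSpace.single i 1)) := by
      refine integral_congr_ae ?_
      filter_upwards [Lp.coeFn_smul c u.fst] with x hx
      simp only [hx, Pi.smul_apply, smul_eq_mul]
      ring
    have h2 : ∫ x in Ω, ((c • u.snd : L2vec Ω) x) i * φ x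
        = ∫ x in Ω, c * (u.snd x i * φ x) := by
      refine integral_congr_ae ?_
      filter_upwards [Lp.coeFn_smul c u.snd] with x hx
      simp only [hx, Pi.smul_apply, PiLp.smul_apply, smul_eq_mul]
      ring
    change ∫ x in Ω, ((c • u.fst : L2 Ω) x) * fderiv ℝ φ x (EuclideanSpace.single i 1)
      = - ∫ x in Ω, ((c • u.snd : L2vec Ω) x) i * φ x
    rw [h1, h2, integral_const_mul, integral_const_mul, hu φ hφ i]
    ring

/-! ## Simplicial meshes -/

/-- The closed simplex with the vertices of `σ`. -/
def body {d : ℕ} (σ : Affine.Simplex ℝ (E d) d) : Set (E d) :=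
  convexHull ℝ (Set.range σ.points)

/-- The diameter `h_τ` of a simplex. -/
def elemDiam {d : ℕ} (σ : Affine.Simplex ℝ (E d) d) : ℝ := Metric.diam (body σ)

/-- The diameter `ρ_τ` of the largest ball inscribed in a simplex. -/
def inDiam {d : ℕ} (σ : Affine.Simplex ℝ (E d) d) : ℝ :=
  sSup {t : ℝ | ∃ (c : E d) (r : ℝ), 0 ≤ r ∧ Metric.closedBall c r ⊆ body σ ∧ t = 2 * r}

/-- The reference simplex. -/
def refSimplex (d : ℕ) : Set (E d) := {y | (∀ i, 0 ≤ y i) ∧ ∑ i, y i ≤ 1}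

/-- The affine pullback `φ_τ`, which maps the reference simplex onto the simplex. -/
def refMap {d : ℕ} (σ : Affine.Simplex ℝ (E d) d) (y : E d) : E d :=
  σ.points 0 + ∑ i : Fin d, y i • (σ.points i.succ - σ.points 0)

/-- A conforming simplicial mesh of `Ω`: finitely many closed simplices, pairwise different, which
cover the closure of `Ω` and any two of which meet in a common face or not at all. -/
structure SimplicialMesh {d : ℕ} (Ω : Set (E d)) where
  /-- the number of elements -/
  N : ℕ
  /-- the elements -/
  simplex : Fin N → Affine.Simplex ℝ (E d) d
  cover : ⋃ i, body (simplex i) = closure Ω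
  distinct : Function.Injective fun i => Set.range (simplex i).points
  conforming : ∀ i j, body (simplex i) ∩ body (simplex j) =
    convexHull ℝ (Set.range (simplex i).points ∩ Set.range (simplex j).points)

namespace SimplicialMesh

variable {d : ℕ} {Ω : Set (E d)}

/-- The mesh size `h`. -/
def h (M : SimplicialMesh Ω) : ℝ := ⨆ i, elemDiam (M.simplex i)

/-- The shape regularity constant `γ`, the maximum of `h_τ / ρ_τ`; it is `1` for `d = 1`, where a
simplex is an interval and is its own inscribed ball. -/
def shape (M : SimplicialMesh Ω) : ℝ := ⨆ i, elemDiam (M.simplex i) / inDiam (M.simplex i)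

/-- The quasi-uniformity constant of the coarse part of the mesh,
`h / min {h_τ : τ coarse}`. -/
def quasiUnif (M : SimplicialMesh Ω) (coarse : Finset (Fin M.N)) : ℝ :=
  M.h / ⨅ i : coarse, elemDiam (M.simplex i)

/-- The locally refined region, the interior of the union of the elements that are not coarse. -/
def fineRegion (M : SimplicialMesh Ω) (coarse : Finset (Fin M.N)) : Set (E d) :=
  interior (⋃ i ∈ coarseᶜ, body (M.simplex i))

end SimplicialMesh

/-- The value of a `d`-variate polynomial at a point. -/
def evalPoly {d : ℕ} (q : MvPolynomial (Fin d) ℝ) (x : E d) : ℝ :=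
  MvPolynomial.eval (fun i => x i) q

/-- The constant of the local inverse inequality: the least `c ≥ 0` such that
`‖∇q‖_{L²(τ)} ≤ c h_τ⁻¹ ‖q‖_{L²(τ)}` (here squared) for all polynomials `q` of total degree at most
`k` and all simplices `τ` with `h_τ / ρ_τ ≤ γ`. It depends on `d`, `γ` and `k` only. -/
def invConst (d : ℕ) (γ : ℝ) (k : ℕ) : ℝ :=
  sInf {c : ℝ | 0 ≤ c ∧ ∀ σ : Affine.Simplex ℝ (E d) d, elemDiam σ / inDiam σ ≤ γ →
    ∀ q ∈ MvPolynomial.restrictTotalDegree (Fin d) ℝ k,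
      ∫ x in body σ, ∑ i : Fin d, evalPoly (MvPolynomial.pderiv i q) x ^ 2
        ≤ (c / elemDiam σ) ^ 2 * ∫ x in body σ, evalPoly q x ^ 2}

/-- The constant of the global inverse inequalities,
`C_inv = C_eq √(h₀² + C_qu² C_invloc²)`. -/
def globalInvConst {d : ℕ} {Ω : Set (E d)} (M : SimplicialMesh Ω) (coarse : Finset (Fin M.N))
    (k : ℕ) (Ceq h₀ : ℝ) : ℝ :=
  Ceq * Real.sqrt (h₀ ^ 2 + M.quasiUnif coarse ^ 2 * invConst d M.shape k ^ 2)

/-! ## The finite element space -/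

/-- The finite element space: the functions in `V` whose pullback to the reference simplex is,
on each element, a polynomial from the given space `P`. -/
def feSpace {d : ℕ} {Ω : Set (E d)} (V : Submodule ℝ (L2pair Ω)) (M : SimplicialMesh Ω)
    (P : Submodule ℝ (MvPolynomial (Fin d) ℝ)) : Submodule ℝ V where
  carrier := {u | ∀ i, ∃ q ∈ P, ∀ᵐ x ∂(volume.restrict Ω),
    ∀ y ∈ refSimplex d, refMap (M.simplex i) y = x → (u : L2pair Ω).fst x = evalPoly q y}
  zero_mem' := by
    intro i
    refine ⟨0, P.zero_mem, ?_⟩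
    filter_upwards [AEEqFun.coeFn_zero (β := ℝ) (μ := volume.restrict Ω)] with x hx y _ _
    have hx' : ((0 : L2 Ω) : E d → ℝ) x = 0 := hx
    change ((0 : L2 Ω) : E d → ℝ) x = _
    rw [hx']
    simp [evalPoly]
  add_mem' := by
    intro u v hu hv i
    obtain ⟨q, hq, hq'⟩ := hu i
    obtain ⟨r, hr, hr'⟩ := hv i
    refine ⟨q + r, P.add_mem hq hr, ?_⟩
    filter_upwards [Lp.coeFn_add (u : L2pair Ω).fst (v : L2pair Ω).fst, hq', hr']
      with x hx h1 h2 y hy hyx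
    change ((u : L2pair Ω).fst + (v : L2pair Ω).fst : L2 Ω) x = _
    rw [hx, Pi.add_apply, h1 y hy hyx, h2 y hy hyx]
    simp [evalPoly]
  smul_mem' := by
    intro c u hu i
    obtain ⟨q, hq, hq'⟩ := hu i
    refine ⟨c • q, P.smul_mem c hq, ?_⟩
    filter_upwards [Lp.coeFn_smul c (u : L2pair Ω).fst, hq'] with x hx h1 y hy hyx
    change (c • (u : L2pair Ω).fst : L2 Ω) x = _
    rw [hx, Pi.smul_apply, h1 y hy hyx]
    simp [evalPoly]

/-- An element of the finite element space as a function in `L²(Ω)`. -/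
def toL2 {d : ℕ} {Ω : Set (E d)} {V : Submodule ℝ (L2pair Ω)} (S : Submodule ℝ V) :
    S →ₗ[ℝ] L2 Ω where
  toFun u := ((u : V) : L2pair Ω).fst
  map_add' _ _ := rfl
  map_smul' _ _ := rfl

/-! ## Mass-lumping and the operators on the discrete space -/

section Discrete

variable {ι S : Type*} [Fintype ι] [AddCommGroup S] [Module ℝ S]

/-- The mass-lumped scalar product `(u, v)_𝒯 = ∑ d_z u_z v_z`. -/
def lumped (b : Module.Basis ι ℝ S) (D : ι → ℝ) (u v : S) : ℝ :=
  ∑ z, D z * b.repr u z * b.repr v z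

/-- The norm of the mass-lumped scalar product. -/
def lumpedNorm (b : Module.Basis ι ℝ S) (D : ι → ℝ) (u : S) : ℝ :=
  Real.sqrt (lumped b D u u)

/-- The operator `A^S`, which represents the bilinear form `a` with respect to the mass-lumped
scalar product; see `lumped_discreteOp`. -/
def discreteOp (b : Module.Basis ι ℝ S) (D : ι → ℝ) (a : LinearMap.BilinForm ℝ S) :
    Module.End ℝ S :=
  ∑ z, (D z)⁻¹ • (a.flip (b z)).smulRight (b z)

theorem lumped_discreteOp (b : Module.Basis ι ℝ S) (D : ι → ℝ) (hD : ∀ z, 0 < D z)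
    (a : LinearMap.BilinForm ℝ S) (u v : S) :
    lumped b D (discreteOp b D a u) v = a u v := by
  classical
  have h : ∀ z, b.repr (discreteOp b D a u) z = (D z)⁻¹ * a u (b z) := by
    intro z
    simp [discreteOp, Finsupp.single_apply, Finset.sum_apply']
  have hv : a u v = ∑ z, b.repr v z * a u (b z) := by
    conv_lhs => rw [← b.sum_repr v]
    rw [map_sum]
    exact Finset.sum_congr rfl fun z _ => by rw [map_smul, smul_eq_mul]
  rw [hv]
  refine Finset.sum_congr rfl fun z _ => ?_
  rw [h z]
  have := (hD z).ne'
  field_simp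

/-- The projection of `S` onto the span of the basis functions with index in `F`, along the span of
the others. -/
def nodeProj (b : Module.Basis ι ℝ S) (F : Set ι) : Module.End ℝ S :=
  b.constr ℝ (F.indicator b)

end Discrete

/-! ## Stabilized Chebyshev polynomials -/

/-- `δ_{p,ν} = 1 + ν / p²`. -/
def chebDelta (p : ℕ) (ν : ℝ) : ℝ := 1 + ν / (p : ℝ) ^ 2

/-- `ω_{p,ν} = 2 T_p'(δ_{p,ν}) / T_p(δ_{p,ν})`. -/
def chebOmega (p : ℕ) (ν : ℝ) : ℝ :=
  2 * ((Polynomial.Chebyshev.T ℝ p).derivative.eval (chebDelta p ν) /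
    (Polynomial.Chebyshev.T ℝ p).eval (chebDelta p ν))

/-- `P_{p,ν}(x) = 2 (1 - T_p(δ_{p,ν} - x / ω_{p,ν}) / T_p(δ_{p,ν}))`. -/
def stabCheb (p : ℕ) (ν : ℝ) : Polynomial ℝ :=
  2 * (1 - Polynomial.C ((Polynomial.Chebyshev.T ℝ p).eval (chebDelta p ν))⁻¹ *
    (Polynomial.Chebyshev.T ℝ p).comp
      (Polynomial.C (chebDelta p ν) - Polynomial.C (chebOmega p ν)⁻¹ * Polynomial.X))

/-- The polynomial `P_{p,ν}(Δt² x) / (Δt² x)`; see `eval_stabChebRed`. -/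
def stabChebRed (p : ℕ) (ν Δt : ℝ) : Polynomial ℝ :=
  (stabCheb p ν).divX.comp (Polynomial.C (Δt ^ 2) * Polynomial.X)

/-- The polynomial `Q = 1 - P_{p,ν}(Δt² x) / (Δt² x)`. -/
def stabChebQ (p : ℕ) (ν Δt : ℝ) : Polynomial ℝ := 1 - stabChebRed p ν Δt

theorem eval_stabChebRed (p : ℕ) (ν : ℝ) (hν : 0 ≤ ν) (Δt x : ℝ) (hx : Δt ^ 2 * x ≠ 0) :
    (stabChebRed p ν Δt).eval x = (stabCheb p ν).eval (Δt ^ 2 * x) / (Δt ^ 2 * x) := by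
  have hT : (Polynomial.Chebyshev.T ℝ p).eval (chebDelta p ν) ≠ 0 := by
    have h1 : 1 ≤ chebDelta p ν := by
      have : 0 ≤ ν / (p : ℝ) ^ 2 := by positivity
      unfold chebDelta
      linarith
    rw [← Real.cosh_arcosh h1, Polynomial.Chebyshev.T_real_cosh]
    exact (Real.cosh_pos _).ne'
  have h0 : (stabCheb p ν).coeff 0 = 0 := by
    rw [Polynomial.coeff_zero_eq_eval_zero]
    simp [stabCheb, hT]
  have h := congrArg (Polynomial.eval (Δt ^ 2 * x)) (Polynomial.divX_mul_X_add (stabCheb p ν))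
  rw [h0] at h
  rw [eq_div_iff hx, ← h]
  simp [stabChebRed]

/-! ## The stabilized local time-stepping method -/

section Scheme

variable {ι S : Type*} [Fintype ι] [AddCommGroup S] [Module ℝ S]

/-- The stabilized bilinear form `a^{p,ν}(u, v) = a(u - Q(Π_f A^S) u, v)`, where `F` is the set of
the indices of the fine part. -/
def stabForm (b : Module.Basis ι ℝ S) (D : ι → ℝ) (F : Set ι) (a : LinearMap.BilinForm ℝ S)
    (p : ℕ) (ν Δt : ℝ) (u v : S) : ℝ :=
  a (u - Polynomial.aeval (nodeProj b F * discreteOp b D a) (stabChebQ p ν Δt) u) v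

/-- The sequence `U` is produced by the stabilized leapfrog based local time-stepping method with
time step `Δt` from the discrete initial data `u₀`, `v₀`. -/
structure IsLTSSolution (b : Module.Basis ι ℝ S) (D : ι → ℝ) (F : Set ι)
    (a : LinearMap.BilinForm ℝ S) (p : ℕ) (ν Δt : ℝ) (u₀ v₀ : S) (U : ℕ → S) : Prop where
  init_zero : U 0 = u₀
  init_one : U 1 = u₀ + Δt • v₀ - (Δt ^ 2 / 2) • discreteOp b D a u₀
  step : ∀ n, 1 ≤ n → ∀ w, lumped b D (U (n + 1) - (2 : ℝ) • U n + U (n - 1)) w =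
    -Δt ^ 2 * stabForm b D F a p ν Δt (U n) w

end Scheme

/-- The function `u : [0,T] → S` solves the semi-discrete wave equation with mass-lumping,
`(ü, w)_𝒯 + a(u, w) = 0` for all `w ∈ S` and all times inside `(0,T)`, with the initial values
`u(0) = u₀`, `u̇(0) = v₀`. Here `v = u̇`, and the derivatives are taken in the norm which `S`
inherits from `X` under the embedding `J`. The values of `u` outside `[0,T]` are irrelevant. -/
def IsSemidiscreteSolution {ι S X : Type*} [Fintype ι] [AddCommGroup S] [Module ℝ S]
    [NormedAddCommGroup X] [NormedSpace ℝ X] (J : S →ₗ[ℝ] X)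
    (b : Module.Basis ι ℝ S) (D : ι → ℝ) (a : LinearMap.BilinForm ℝ S) (T : ℝ) (u₀ v₀ : S)
    (u : ℝ → S) : Prop :=
  ∃ v : ℝ → S,
    (∀ t ∈ Icc 0 T, HasDerivWithinAt (fun s => J (u s)) (J (v t)) (Icc 0 T) t) ∧
    ContinuousOn (fun t => J (v t)) (Icc 0 T) ∧
    (∀ t ∈ Ioo 0 T, ∃ z : S, HasDerivAt (fun s => J (v s)) (J z) t ∧
      ∀ w, lumped b D z w + a (u t) w = 0) ∧
    u 0 = u₀ ∧ v 0 = v₀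

/-! ## Sobolev regularity in time -/

section Time

variable {X : Type*} [NormedAddCommGroup X] [NormedSpace ℝ X]

/-- `g` is the weak derivative of order `k` of `f` on `(0,T)`. -/
def HasWeakTimeDeriv (T : ℝ) (k : ℕ) (f g : ℝ → X) : Prop :=
  ∀ φ : ℝ → ℝ, ContDiff ℝ ∞ φ → HasCompactSupport φ → tsupport φ ⊆ Ioo 0 T →
    ∫ t in Ioo 0 T, iteratedDeriv k φ t • f t = (-1 : ℝ) ^ k • ∫ t in Ioo 0 T, φ t • g t

/-- `f` has a weak derivative of order `k` in `L^∞([0,T]; X)`. -/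
def HasBoundedTimeDeriv (T : ℝ) (k : ℕ) (f : ℝ → X) : Prop :=
  ∃ g : ℝ → X, MemLp g ⊤ (volume.restrict (Ioo 0 T)) ∧ HasWeakTimeDeriv T k f g

/-- `f` lies in `W^{k,∞}([0,T]; X)`. -/
def MemTimeSobolev (T : ℝ) (k : ℕ) (f : ℝ → X) : Prop :=
  MemLp f ⊤ (volume.restrict (Ioo 0 T)) ∧ ∀ l ≤ k, HasBoundedTimeDeriv T l f

open Classical in
/-- The weak derivative of order `k` (unique almost everywhere, and `0` if there is none in
`L^∞`). -/
def weakTimeDeriv (T : ℝ) (k : ℕ) (f : ℝ → X) : ℝ → X :=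
  if hf : HasBoundedTimeDeriv T k f then hf.choose else 0

/-- The norm of `∂_t^k f` in `L^∞([0,T]; X)`. -/
def timeDerivNorm (T : ℝ) (k : ℕ) (f : ℝ → X) : ℝ :=
  (eLpNorm (weakTimeDeriv T k f) ⊤ (volume.restrict (Ioo 0 T))).toReal

end Time

end LTS

end

noncomputable section

namespace LTS

/-! ## Estimates for stabilized Chebyshev polynomials -/

section Chebyshev

open Polynomial Polynomial.Chebyshev

/-! Write A for `discreteOp`, Φ for `nodeProj`, τ for the time step and R(x) = P(τ²x)/(τ²x). The
scheme is the leapfrog recursion U_{n+1} - 2U_n + U_{n-1} = -τ² A R(ΦA) U_n, and the proof works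
with the inverse W of the operator A R(ΦA). This inverse is A⁻¹ + Z, where Z is diagonal in an
eigenbasis of the compression ΦAΦ, with entry (1/R(μ) - 1)/μ for an eigenvalue μ ≠ 0 and entry 0 for
μ = 0 (`exists_inverse_operator`). With y = τ²μ the nonzero entries are τ²(1/P(y) - 1/y), and
`stabCheb_bounds` places them between 0 and (16 + 1/ν)τ², uniformly in p. Hence Z = O(τ²).

Stability: W turns the recursion into W(U_{n+1} - 2U_n + U_{n-1}) + τ²U_n = 0, which conserves
⟨W(U_{n+1} - U_n), U_{n+1} - U_n⟩ + τ²⟨U_{n+1}, U_n⟩. This energy is definite once W ≥ κτ² with κ >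
1/4, and it then controls U itself, without derivatives in space (`leapfrog_stability`). Here κ =
1/4 + ν/20: on fine modes the margin comes from P staying below 4, on coarse ones from the CFL
condition.

Accuracy: let x_n be the values of the semi-discrete solution. The quantity to estimate is x_n +
ZAx_n - U_n, which differs from the error by O(τ²). Since WA = 1 + ZA, its residual consists of the
Taylor remainder of the second difference and of ZA applied to that difference (`hilbert_error_le`).
Both are O(τ⁴), because ẍ = -Ax trades each A for two time derivatives and never for a power of h.

Finite elements: the operator bounds needed are A ≤ Λp² on all of S and A ≤ Λ on the kernel of Φ,
where Λ = C_cont C_inv²/h². The second holds because a function without fine degrees of freedom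
vanishes on the fine elements (`vanish_of_repr_eq_zero`), so that the elementwise inverse inequality
only sees coarse diameters (`norm_snd_le_mul_norm_fst`, `form_le_lumped`). -/

theorem eval_iterate_derivative_T_nonneg (p k : ℕ) {x : ℝ} (hx : 1 ≤ x) :
    0 ≤ (derivative^[k] (T ℝ p)).eval x := by
  -- Derivatives of T_p are combinations of Chebyshev polynomials with natural coefficients, and
  -- each of these is at least 1 on [1, ∞).
  have h := T_iterate_derivative_mem_span_T (R := ℝ) p k
  refine Submodule.span_induction (p := fun q _ => 0 ≤ q.eval x) ?_ (by simp) ?_ ?_ h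
  · rintro _ ⟨m, _, rfl⟩
    exact zero_le_one.trans (one_le_eval_T_real _ hx)
  · intro q r _ _ hq hr
    rw [eval_add]
    exact add_nonneg hq hr
  · intro c q _ hq
    rw [nsmul_eq_mul, eval_mul, eval_natCast]
    positivity

theorem exists_eval_sub_eq (q : ℝ[X]) {x y : ℝ} (hxy : x < y) :
    ∃ ξ ∈ Ioo x y, q.eval y - q.eval x = (y - x) * (derivative q).eval ξ := by
  obtain ⟨ξ, hξ, h⟩ := exists_hasDerivAt_eq_slope (fun t => q.eval t)
    (fun t => (derivative q).eval t) hxy q.continuous.continuousOn fun t _ => q.hasDerivAt t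
  refine ⟨ξ, hξ, ?_⟩
  rw [h]
  have : y - x ≠ 0 := sub_ne_zero.2 hxy.ne'
  field_simp

theorem derivative_T_le_derivative_T (p : ℕ) {x y : ℝ} (hx : 1 ≤ x) (hxy : x ≤ y) :
    (derivative (T ℝ p)).eval x ≤ (derivative (T ℝ p)).eval y := by
  rcases hxy.eq_or_lt with rfl | h
  · exact le_rfl
  obtain ⟨ξ, hξ, he⟩ := exists_eval_sub_eq (derivative (T ℝ p)) h
  have := eval_iterate_derivative_T_nonneg p 2 (hx.trans hξ.1.le)
  simp only [Function.iterate_succ, Function.iterate_zero, Function.comp, id] at this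
  nlinarith [sub_pos.2 h]

theorem derivative2_T_le_derivative2_T (p : ℕ) {x y : ℝ} (hx : 1 ≤ x) (hxy : x ≤ y) :
    (derivative (derivative (T ℝ p))).eval x ≤ (derivative (derivative (T ℝ p))).eval y := by
  rcases hxy.eq_or_lt with rfl | h
  · exact le_rfl
  obtain ⟨ξ, hξ, he⟩ := exists_eval_sub_eq (derivative (derivative (T ℝ p))) h
  have := eval_iterate_derivative_T_nonneg p 3 (hx.trans hξ.1.le)
  simp only [Function.iterate_succ, Function.iterate_zero, Function.comp, id] at this
  nlinarith [sub_pos.2 h]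

theorem eval_derivative_T_one (p : ℕ) : (derivative (T ℝ p)).eval 1 = (p : ℝ) ^ 2 := by
  simp [derivative_T_eval_one]

theorem sq_le_derivative_T (p : ℕ) {x : ℝ} (hx : 1 ≤ x) :
    (p : ℝ) ^ 2 ≤ (derivative (T ℝ p)).eval x := by
  rw [← eval_derivative_T_one]
  exact derivative_T_le_derivative_T p le_rfl hx

theorem abs_derivative_T_le (p : ℕ) {x : ℝ} (hx : |x| ≤ 1) :
    |(derivative (T ℝ p)).eval x| ≤ (p : ℝ) ^ 2 := by
  rw [← eval_derivative_T_one]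
  exact abs_iterate_derivative_T_real_le p 1 hx

/-- The graph of `T_p` over `[-1, δ]` lies above the tangent line at a point `δ ≥ 1`. -/
theorem T_sub_T_le (p : ℕ) {x δ : ℝ} (hδ : 1 ≤ δ) (hx : -1 ≤ x) (hxδ : x ≤ δ) :
    (T ℝ p).eval δ - (T ℝ p).eval x ≤ (δ - x) * (derivative (T ℝ p)).eval δ := by
  rcases hxδ.eq_or_lt with rfl | h
  · simp
  obtain ⟨ξ, hξ, he⟩ := exists_eval_sub_eq (T ℝ p) h
  rw [he]
  refine mul_le_mul_of_nonneg_left ?_ (sub_pos.2 h).le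
  rcases le_total ξ 1 with h1 | h1
  · exact (le_abs_self _).trans ((abs_derivative_T_le p (abs_le.2 ⟨hx.trans hξ.1.le, h1⟩)).trans
      (sq_le_derivative_T p hδ))
  · exact derivative_T_le_derivative_T p h1 hξ.2.le

theorem le_T_sub_T (p : ℕ) {x δ : ℝ} (hx : 1 ≤ x) (hxδ : x ≤ δ) :
    (δ - x) * (p : ℝ) ^ 2 ≤ (T ℝ p).eval δ - (T ℝ p).eval x := by
  rcases hxδ.eq_or_lt with rfl | h
  · simp
  obtain ⟨ξ, hξ, he⟩ := exists_eval_sub_eq (T ℝ p) h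
  rw [he]
  exact mul_le_mul_of_nonneg_left (sq_le_derivative_T p (hx.trans hξ.1.le)) (sub_pos.2 h).le

/-- Two applications of the mean value theorem, with T_p'' increasing on [1, ∞). The factor 1/2 of
the Taylor formula is given away. -/
theorem T_taylor_le (p : ℕ) {x δ : ℝ} (hx : 1 ≤ x) (hxδ : x ≤ δ) :
    (δ - x) * (derivative (T ℝ p)).eval δ - ((T ℝ p).eval δ - (T ℝ p).eval x) ≤
      (δ - x) ^ 2 * (derivative (derivative (T ℝ p))).eval δ := by
  rcases hxδ.eq_or_lt with rfl | h
  · simp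
  obtain ⟨ξ, hξ, he⟩ := exists_eval_sub_eq (T ℝ p) h
  obtain ⟨ζ, hζ, he'⟩ := exists_eval_sub_eq (derivative (T ℝ p)) hξ.2
  have h1 := derivative2_T_le_derivative2_T p (hx.trans (hξ.1.le.trans hζ.1.le)) hζ.2.le
  have h2 := eval_iterate_derivative_T_nonneg p 2 (hx.trans hxδ)
  simp only [Function.iterate_succ, Function.iterate_zero, Function.comp, id] at h2
  have h0 := sub_pos.2 h
  have h3 : (derivative (T ℝ p)).eval δ - (derivative (T ℝ p)).eval ξ ≤
      (δ - x) * (derivative (derivative (T ℝ p))).eval δ := by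
    rw [he']
    exact mul_le_mul (by linarith [hξ.1]) h1
      (by simpa using eval_iterate_derivative_T_nonneg p 2 (hx.trans (hξ.1.le.trans hζ.1.le)))
      h0.le
  rw [he, ← mul_sub, sq, mul_assoc]
  exact mul_le_mul_of_nonneg_left h3 h0.le

/-- With cosh θ = 1 + c/p² the value is cosh(pθ) ≤ exp(p²θ²/2), and θ²/2 ≤ cosh θ - 1 = c/p². This
makes all bounds near δ independent of p. -/
theorem T_one_add_div_le (p : ℕ) (hp : 1 ≤ p) {c : ℝ} (hc : 0 ≤ c) :
    (T ℝ p).eval (1 + c / (p : ℝ) ^ 2) ≤ Real.exp c := by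
  have hp' : (0 : ℝ) < p := by exact_mod_cast hp
  have h1 : 1 ≤ 1 + c / (p : ℝ) ^ 2 := by
    have : 0 ≤ c / (p : ℝ) ^ 2 := by positivity
    linarith
  set θ := Real.arcosh (1 + c / (p : ℝ) ^ 2) with hθ
  have hc' : Real.cosh θ = 1 + c / (p : ℝ) ^ 2 := Real.cosh_arcosh h1
  have h2 : θ ^ 2 / 2 ≤ c / (p : ℝ) ^ 2 := by
    have h4 := Real.cosh_two_mul (θ / 2)
    have h5 := Real.cosh_sq (θ / 2)
    rw [mul_div_cancel₀ θ (two_ne_zero' ℝ)] at h4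
    have h3 : (θ / 2) ^ 2 ≤ Real.sinh (θ / 2) ^ 2 := by
      have hθ0 : 0 ≤ θ / 2 := by
        have := Real.arcosh_nonneg h1
        positivity
      exact pow_le_pow_left₀ hθ0 (Real.self_le_sinh_iff.2 hθ0) 2
    nlinarith
  rw [← hc', T_real_cosh]
  refine (Real.cosh_le_exp_half_sq _).trans (Real.exp_le_exp.2 ?_)
  rw [le_div_iff₀ (by positivity)] at h2
  push_cast
  nlinarith

variable {p : ℕ} {ν : ℝ}

theorem one_le_chebDelta (hν0 : 0 ≤ ν) : 1 ≤ chebDelta p ν := by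
  have : 0 ≤ ν / (p : ℝ) ^ 2 := by positivity
  unfold chebDelta
  linarith

theorem one_add_le_T_chebDelta (hp : 1 ≤ p) (hν0 : 0 ≤ ν) :
    1 + ν ≤ (T ℝ p).eval (chebDelta p ν) := by
  have h := le_T_sub_T p le_rfl (one_le_chebDelta (p := p) hν0)
  rw [T_eval_one] at h
  have hp' : (0 : ℝ) < p := by exact_mod_cast hp
  have : (chebDelta p ν - 1) * (p : ℝ) ^ 2 = ν := by
    unfold chebDelta
    field_simp
    ring
  linarith

theorem T_chebDelta_le (hp : 1 ≤ p) (hν0 : 0 ≤ ν) (hν : ν ≤ 1 / 2) :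
    (T ℝ p).eval (chebDelta p ν) ≤ 2 := by
  refine (T_one_add_div_le p hp hν0).trans ?_
  have h1 : Real.exp ν ≤ Real.exp (1 / 2) := Real.exp_le_exp.2 hν
  have h2 : Real.exp (1 / 2) * Real.exp (1 / 2) = Real.exp 1 := by
    rw [← Real.exp_add]
    norm_num
  nlinarith [Real.exp_one_lt_d9, Real.exp_pos (1 / 2)]

/-- Two mean value steps of width h = 1/p² to the right of δ give h² T_p''(δ) ≤ T_p(δ + 2h), because
T_p' and T_p'' increase there. The right-hand side is at most exp(ν + 2) ≤ 16. -/
theorem derivative2_T_chebDelta_le (hp : 1 ≤ p) (hν0 : 0 ≤ ν) (hν : ν ≤ 1 / 2) :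
    (derivative (derivative (T ℝ p))).eval (chebDelta p ν) ≤ 16 * (p : ℝ) ^ 4 := by
  have hp' : (0 : ℝ) < p := by exact_mod_cast hp
  set δ := chebDelta p ν
  have hδ : 1 ≤ δ := one_le_chebDelta hν0
  set h := 1 / (p : ℝ) ^ 2 with hh
  have h0 : 0 < h := by positivity
  have hT : (T ℝ p).eval (δ + h + h) ≤ 16 := by
    have : δ + h + h = 1 + (ν + 2) / (p : ℝ) ^ 2 := by
      simp only [δ, chebDelta, hh]
      ring
    rw [this]
    refine (T_one_add_div_le p hp (by linarith)).trans ?_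
    have h1 : Real.exp (ν + 2) ≤ Real.exp (5 / 2) := Real.exp_le_exp.2 (by linarith)
    have h2 : Real.exp (5 / 2) ^ 2 = Real.exp 1 ^ 5 := by
      rw [← Real.exp_nat_mul, ← Real.exp_nat_mul]
      norm_num
    have h3 : Real.exp 1 ^ 5 ≤ 16 ^ 2 := by
      calc Real.exp 1 ^ 5 ≤ 3 ^ 5 := by
            gcongr
            linarith [Real.exp_one_lt_d9]
        _ ≤ 16 ^ 2 := by norm_num
    have h4 : Real.exp (5 / 2) ≤ 16 := by
      refine le_of_sq_le_sq ?_ (by norm_num)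
      rw [h2]; exact h3
    linarith
  obtain ⟨ξ, hξ, he⟩ := exists_eval_sub_eq (derivative (T ℝ p)) (show δ < δ + h by linarith)
  obtain ⟨ζ, hζ, hf⟩ := exists_eval_sub_eq (T ℝ p) (show δ + h < δ + h + h by linarith)
  have h1 := derivative2_T_le_derivative2_T p hδ hξ.1.le
  have h2 := derivative_T_le_derivative_T p (hδ.trans (by linarith)) hζ.1.le
  have h3 := sq_le_derivative_T p hδ
  have h4 := one_le_eval_T_real p (show 1 ≤ δ + h by linarith)
  have h5 : h * (h * (derivative (derivative (T ℝ p))).eval δ) ≤ 16 := by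
    have e1 : δ + h - δ = h := by ring
    have e2 : δ + h + h - (δ + h) = h := by ring
    rw [e1] at he
    rw [e2] at hf
    have : h * (derivative (derivative (T ℝ p))).eval δ ≤ (derivative (T ℝ p)).eval ζ := by
      nlinarith [sq_nonneg (p : ℝ)]
    nlinarith
  have e : h * (h * (derivative (derivative (T ℝ p))).eval δ) =
      (derivative (derivative (T ℝ p))).eval δ / (p : ℝ) ^ 4 := by
    rw [hh]
    field_simp
  rw [e, div_le_iff₀ (by positivity)] at h5
  exact h5

theorem sq_le_chebOmega (hp : 1 ≤ p) (hν0 : 0 ≤ ν) (hν : ν ≤ 1 / 2) :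
    (p : ℝ) ^ 2 ≤ chebOmega p ν := by
  have h1 := one_add_le_T_chebDelta hp hν0
  have h2 := T_chebDelta_le hp hν0 hν
  have h3 := sq_le_derivative_T p (one_le_chebDelta (p := p) hν0)
  have h0 : 0 < (T ℝ p).eval (chebDelta p ν) := by linarith
  unfold chebOmega
  rw [mul_div_assoc', le_div_iff₀ h0]
  nlinarith [sq_nonneg (p : ℝ)]

theorem eval_stabCheb (p : ℕ) (ν y : ℝ) :
    (stabCheb p ν).eval y = 2 * (1 - (T ℝ p).eval (chebDelta p ν - y / chebOmega p ν) /
      (T ℝ p).eval (chebDelta p ν)) := by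
  simp only [stabCheb, eval_mul, eval_sub, eval_one, eval_ofNat, eval_C, eval_comp, eval_X]
  rw [div_eq_inv_mul, div_eq_inv_mul]

theorem eval_zero_stabChebRed (hp : 1 ≤ p) (hν0 : 0 ≤ ν) (τ : ℝ) :
    (stabChebRed p ν τ).eval 0 = 1 := by
  have hp' : (0 : ℝ) < p := by exact_mod_cast hp
  have h1 := one_add_le_T_chebDelta hp hν0
  have h0 : (T ℝ p).eval (chebDelta p ν) ≠ 0 := by linarith
  have h3 := sq_le_derivative_T p (one_le_chebDelta (p := p) hν0)
  have h4 : (derivative (T ℝ p)).eval (chebDelta p ν) ≠ 0 := by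
    have : (0 : ℝ) < (p : ℝ) ^ 2 := by positivity
    linarith
  -- P vanishes at 0, so the value of P(y)/y at 0 is P'(0); the scaling ω is chosen to make this 1.
  have h5 : (stabChebRed p ν τ).eval 0 = (derivative (stabCheb p ν)).eval 0 := by
    rw [← coeff_zero_eq_eval_zero (derivative _), coeff_derivative]
    simp only [stabChebRed, eval_comp, eval_mul, eval_C, eval_X, mul_zero]
    rw [← coeff_zero_eq_eval_zero, coeff_divX]
    simp
  rw [h5]
  have : derivative (stabCheb p ν) = 2 * (C ((T ℝ p).eval (chebDelta p ν))⁻¹ *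
      (C (chebOmega p ν)⁻¹ * (derivative (T ℝ p)).comp
        (C (chebDelta p ν) - C (chebOmega p ν)⁻¹ * X))) := by
    simp only [stabCheb, derivative_mul, derivative_sub, derivative_one, derivative_comp,
      derivative_C, derivative_X, derivative_ofNat]
    ring
  rw [this]
  simp only [eval_mul, eval_ofNat, eval_C, eval_comp, eval_sub, eval_X, mul_zero, sub_zero,
    chebOmega]
  field_simp

/-- The two-sided bounds on `P_{p,ν}` which govern accuracy and stability of the method. -/
theorem stabCheb_bounds (hp : 1 ≤ p) (hν0 : 0 < ν) (hν : ν ≤ 1 / 2) {y : ℝ} (hy0 : 0 < y)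
    (hy : y ≤ (p : ℝ) ^ 2 * (ν / (4 * (1 + ν)))) :
    0 < (stabCheb p ν).eval y ∧ (stabCheb p ν).eval y ≤ y ∧
      1 / (stabCheb p ν).eval y - 1 / y ≤ 16 + 1 / ν ∧
      1 / 4 + ν / 20 ≤ 1 / (stabCheb p ν).eval y - ν / (8 * (1 + ν)) / y := by
  have hp' : (0 : ℝ) < (p : ℝ) ^ 2 := by
    have : (0 : ℝ) < p := by exact_mod_cast hp
    positivity
  have hδ := one_le_chebDelta (p := p) hν0.le
  have hT1 := one_add_le_T_chebDelta hp hν0.le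
  have hT2 := T_chebDelta_le hp hν0.le hν
  have hω := sq_le_chebOmega hp hν0.le hν
  have hT' := sq_le_derivative_T p hδ
  have hT'' := derivative2_T_chebDelta_le hp hν0.le hν
  have hνq : ν / (4 * (1 + ν)) ≤ 1 / 12 := by
    rw [div_le_div_iff₀ (by linarith) (by norm_num)]
    linarith
  set t := y / chebOmega p ν with ht
  have hω0 : 0 < chebOmega p ν := hp'.trans_le hω
  have ht0 : 0 < t := by positivity
  have ht1 : t ≤ 1 := by
    rw [ht, div_le_one hω0]
    nlinarith
  -- By the definition of ω, y is the linearization at δ of the expression for P(y). Thus y - P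
  -- measures the gap between T_p and its tangent at δ.
  have hyt : y = 2 / (T ℝ p).eval (chebDelta p ν) *
      (t * (derivative (T ℝ p)).eval (chebDelta p ν)) := by
    have : y = t * chebOmega p ν := by rw [ht]; field_simp
    rw [this, chebOmega]
    ring
  have hP : (stabCheb p ν).eval y = 2 / (T ℝ p).eval (chebDelta p ν) *
      ((T ℝ p).eval (chebDelta p ν) - (T ℝ p).eval (chebDelta p ν - t)) := by
    have : (T ℝ p).eval (chebDelta p ν) ≠ 0 := by linarith
    rw [eval_stabCheb, ← ht]
    field_simp
  set δ := chebDelta p ν with hδdef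
  set Tδ := (T ℝ p).eval δ with hTδ
  set T1 := (derivative (T ℝ p)).eval δ with hT1'
  set T2 := (derivative (derivative (T ℝ p))).eval δ
  set Tx := (T ℝ p).eval (δ - t) with hTx
  set P := (stabCheb p ν).eval y
  have hTδ0 : 0 < Tδ := by linarith
  have hc : 0 < 2 / Tδ := by positivity
  have hPy : P ≤ y := by
    rw [hP, hyt]
    refine mul_le_mul_of_nonneg_left ?_ hc.le
    have := T_sub_T_le p hδ (show -1 ≤ δ - t by linarith) (by linarith)
    simpa using this
  have hlow : -1 ≤ Tx := by
    rcases le_total (δ - t) 1 with h | h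
    · exact (abs_le.1 (abs_eval_T_real_le_one p (abs_le.2 ⟨by linarith, h⟩))).1
    · linarith [one_le_eval_T_real p h]
  have hup : P ≤ 2 * (2 + ν) / (1 + ν) := by
    have h1 : P ≤ 2 / Tδ * (Tδ + 1) := by
      rw [hP]
      exact mul_le_mul_of_nonneg_left (by linarith) hc.le
    have h2 : 2 / Tδ * (Tδ + 1) = 2 + 2 / Tδ := by field_simp
    have h3 : 2 / Tδ ≤ 2 / (1 + ν) := div_le_div_of_nonneg_left (by norm_num) (by linarith) hT1
    have h4 : 2 * (2 + ν) / (1 + ν) = 2 + 2 / (1 + ν) := by field_simp; ring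
    linarith
  have hmain : 0 < P ∧ 1 / P - 1 / y ≤ 16 + 1 / ν := by
    -- If the argument δ - t has entered [-1, 1], then P ≥ ν, which bounds 1/P. Otherwise T_p is
    -- convex between δ - t and δ, and Taylor's formula gives y - P ≤ 16 P y.
    rcases le_total (δ - t) 1 with h | h
    · have h1 : Tx ≤ 1 := (abs_le.1 (abs_eval_T_real_le_one p (abs_le.2 ⟨by linarith, h⟩))).2
      have h2 : ν ≤ P := by
        have : 2 / Tδ * ν ≤ P := by
          rw [hP]
          exact mul_le_mul_of_nonneg_left (by linarith) hc.le
        have : 1 ≤ 2 / Tδ := by rw [le_div_iff₀ hTδ0]; linarith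
        nlinarith
      refine ⟨hν0.trans_le h2, ?_⟩
      have h3 : 1 / P ≤ 1 / ν := one_div_le_one_div_of_le hν0 h2
      have : 0 < 1 / y := by positivity
      linarith
    · have h1 := le_T_sub_T p h (show δ - t ≤ δ by linarith)
      have h2 := T_taylor_le p h (show δ - t ≤ δ by linarith)
      rw [show δ - (δ - t) = t by ring] at h1 h2
      have hPl : 2 / Tδ * (t * (p : ℝ) ^ 2) ≤ P := by
        rw [hP]
        exact mul_le_mul_of_nonneg_left h1 hc.le
      have hyl : 2 / Tδ * (t * (p : ℝ) ^ 2) ≤ y := by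
        rw [hyt]
        exact mul_le_mul_of_nonneg_left (mul_le_mul_of_nonneg_left hT' ht0.le) hc.le
      have hb : 0 < 2 / Tδ * (t * (p : ℝ) ^ 2) := by positivity
      have hP0 : 0 < P := hb.trans_le hPl
      refine ⟨hP0, ?_⟩
      have h3 : y - P ≤ 2 / Tδ * (t ^ 2 * (16 * (p : ℝ) ^ 4)) := by
        rw [hP]
        nth_rewrite 1 [hyt]
        rw [← mul_sub]
        refine mul_le_mul_of_nonneg_left (h2.trans ?_) hc.le
        exact mul_le_mul_of_nonneg_left hT'' (sq_nonneg _)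
      have h4 : 2 / Tδ * (t ^ 2 * (16 * (p : ℝ) ^ 4)) ≤ 16 * (P * y) := by
        have h5 : (2 / Tδ * (t * (p : ℝ) ^ 2)) * (2 / Tδ * (t * (p : ℝ) ^ 2)) ≤ P * y :=
          mul_le_mul hPl hyl hb.le hP0.le
        have h6 : 1 ≤ 2 / Tδ := by rw [le_div_iff₀ hTδ0]; linarith
        have h7 : 0 ≤ 2 / Tδ * (t ^ 2 * (p : ℝ) ^ 4) := by positivity
        nlinarith
      have h5 : 1 / P - 1 / y ≤ 16 := by
        rw [div_sub_div _ _ hP0.ne' hy0.ne', div_le_iff₀ (by positivity)]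
        linarith
      have : 0 < 1 / ν := by positivity
      linarith
  obtain ⟨hP0, hs⟩ := hmain
  refine ⟨hP0, hPy, hs, ?_⟩
  have hη : ν / (8 * (1 + ν)) ≤ 1 / 24 := by
    rw [div_le_div_iff₀ (by linarith) (by norm_num)]
    linarith
  have hη' : ν / (8 * (1 + ν)) ≤ ν / 8 :=
    div_le_div_of_nonneg_left hν0.le (by norm_num) (by linarith)
  have hη0 : 0 ≤ ν / (8 * (1 + ν)) := by positivity
  -- For y ≤ 3 the bound P ≤ y is enough; for y ≥ 3 the uniform bound P ≤ 2(2 + ν)/(1 + ν) keeps 1/P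
  -- at least ν/10 above 1/4, of which the subtracted term takes at most ν/24.
  rcases le_total y 3 with h | h
  · have h1 : 1 / y ≤ 1 / P := one_div_le_one_div_of_le hP0 hPy
    have h2 : (1 - ν / (8 * (1 + ν))) / 3 ≤ (1 - ν / (8 * (1 + ν))) / y :=
      div_le_div_of_nonneg_left (by linarith) hy0 h
    have h3 : (1 - ν / (8 * (1 + ν))) / y = 1 / y - ν / (8 * (1 + ν)) / y := by ring
    linarith
  · have h1 : ν / (8 * (1 + ν)) / y ≤ ν / (8 * (1 + ν)) / 3 :=
      div_le_div_of_nonneg_left hη0 (by norm_num) h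
    have h2 : 1 / (2 * (2 + ν) / (1 + ν)) ≤ 1 / P := one_div_le_one_div_of_le hP0 hup
    have h3 : 1 / 4 + ν / 10 ≤ 1 / (2 * (2 + ν) / (1 + ν)) := by
      rw [one_div_div, le_div_iff₀ (by linarith)]
      nlinarith
    linarith

end Chebyshev

/-! ## The inverse of the stabilized operator -/

section Operator

variable {H : Type*} [NormedAddCommGroup H] [InnerProductSpace ℝ H]

local notation "⟪" x "," y "⟫" => inner ℝ x y

/-! ### Operators that are diagonal in an orthonormal basis. -/

section Diagonal

variable {ι : Type*} [Fintype ι] (e : OrthonormalBasis ι ℝ H)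

/-- The operator which is diagonal in the orthonormal basis `e`, with diagonal entries `c`. -/
def diagOp (c : ι → ℝ) : Module.End ℝ H :=
  ∑ k, c k • ((innerₛₗ ℝ (e k)).smulRight (e k))

theorem diagOp_apply (c : ι → ℝ) (x : H) : diagOp e c x = ∑ k, (c k * ⟪e k, x⟫) • e k := by
  simp [diagOp, smul_smul]

theorem inner_diagOp (c : ι → ℝ) (x : H) (k : ι) : ⟪e k, diagOp e c x⟫ = c k * ⟪e k, x⟫ := by
  classical
  rw [diagOp_apply, inner_sum]
  simp [inner_smul_right, orthonormal_iff_ite.1 e.orthonormal]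

theorem diagOp_basis (c : ι → ℝ) (k : ι) : diagOp e c (e k) = c k • e k := by
  classical
  rw [diagOp_apply]
  simp [orthonormal_iff_ite.1 e.orthonormal]

theorem inner_eq_sum_basis (x y : H) : ⟪x, y⟫ = ∑ k, ⟪e k, x⟫ * ⟪e k, y⟫ := by
  rw [← e.sum_inner_mul_inner x y]
  exact Finset.sum_congr rfl fun k _ => by rw [real_inner_comm]

theorem inner_diagOp_left (c : ι → ℝ) (x y : H) :
    ⟪diagOp e c x, y⟫ = ∑ k, c k * (⟪e k, x⟫ * ⟪e k, y⟫) := by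
  rw [inner_eq_sum_basis e]
  simp only [inner_diagOp, mul_assoc]

theorem diagOp_isSymmetric (c : ι → ℝ) : (diagOp e c).IsSymmetric := by
  intro x y
  rw [inner_diagOp_left, ← real_inner_comm, inner_diagOp_left]
  exact Finset.sum_congr rfl fun k _ => by ring

theorem norm_sq_eq_sum_basis (x : H) : ‖x‖ ^ 2 = ∑ k, ⟪e k, x⟫ ^ 2 := by
  rw [← real_inner_self_eq_norm_sq, inner_eq_sum_basis e]
  simp only [sq]

theorem eq_of_inner_basis_eq {x y : H} (h : ∀ k, ⟪e k, x⟫ = ⟪e k, y⟫) : x = y := by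
  rw [← sub_eq_zero, ← norm_eq_zero, ← sq_eq_zero_iff, norm_sq_eq_sum_basis e]
  simp [inner_sub_right, h]

theorem norm_diagOp_le {c : ι → ℝ} {s : ℝ} (hs : 0 ≤ s) (hc : ∀ k, |c k| ≤ s) (x : H) :
    ‖diagOp e c x‖ ≤ s * ‖x‖ := by
  refine le_of_sq_le_sq ?_ (by positivity)
  rw [mul_pow, norm_sq_eq_sum_basis e, norm_sq_eq_sum_basis e x, Finset.mul_sum]
  refine Finset.sum_le_sum fun k _ => ?_
  rw [inner_diagOp, mul_pow]
  exact mul_le_mul_of_nonneg_right (sq_le_sq' (by linarith [abs_le.1 (hc k)]) (abs_le.1 (hc k)).2)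
    (sq_nonneg _)

end Diagonal

theorem aeval_apply_of_apply_eq_smul {N : Module.End ℝ H} {x : H} {μ : ℝ} (h : N x = μ • x)
    (q : Polynomial ℝ) : Polynomial.aeval N q x = q.eval μ • x := by
  induction q using Polynomial.induction_on' with
  | add q r hq hr => simp [hq, hr, add_smul]
  | monomial n c =>
    have hn : ∀ n : ℕ, (N ^ n) x = μ ^ n • x := by
      intro n
      induction n with
      | zero => simp
      | succ n ih => rw [pow_succ', Module.End.mul_apply, ih, map_smul, h, smul_smul, pow_succ]
    simp [Polynomial.aeval_monomial, hn, smul_smul, mul_comm]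

variable [FiniteDimensional ℝ H]

/-- The inverse `W` of the stabilized operator `A R(Φ A)` is `A⁻¹ + Z`, where the operator `Z` is
small, and it is bounded from above and below. -/
theorem exists_inverse_operator (A Φ : Module.End ℝ H) (hA : A.IsSymmetric) (hΦ : Φ.IsSymmetric)
    (hΦ2 : ∀ x, Φ (Φ x) = Φ x) (R : Polynomial ℝ) (hR0 : R.eval 0 = 1) {α s η κ Λc Λf : ℝ}
    (hα : 0 < α) (hs : 0 ≤ s) (hη0 : 0 < η) (hη1 : η < 1) (hΛc : 0 < Λc) (hΛf : 0 ≤ Λf)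
    (hcoer : ∀ u, α * ‖u‖ ^ 2 ≤ ⟪A u, u⟫)
    (hc : ∀ u, Φ u = 0 → ⟪A u, u⟫ ≤ Λc * ‖u‖ ^ 2) (hf : ∀ u, ⟪A u, u⟫ ≤ Λf * ‖u‖ ^ 2)
    (hR : ∀ μ, 0 < μ → μ ≤ Λf → 0 < R.eval μ ∧ 0 ≤ (1 / R.eval μ - 1) / μ ∧
      (1 / R.eval μ - 1) / μ ≤ s ∧ κ ≤ (1 / R.eval μ - η) / μ)
    (hκ : κ ≤ η / Λc) :
    ∃ Z W : Module.End ℝ H, W.IsSymmetric ∧ (∀ u, ‖Z u‖ ≤ s * ‖u‖) ∧ W * A = 1 + Z * A ∧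
      W * A * Polynomial.aeval (Φ * A) R = 1 ∧
      ∀ x, κ * ‖x‖ ^ 2 ≤ ⟪W x, x⟫ ∧ ⟪W x, x⟫ ≤ (1 / α + s) * ‖x‖ ^ 2 := by
  have hApos : ∀ u, 0 ≤ ⟪A u, u⟫ := fun u => le_trans (by positivity) (hcoer u)
  -- The compression ΦAΦ is symmetric although ΦA is not. Its eigenvectors also diagonalize Φ:
  -- coercivity puts those with μ = 0 into the kernel of Φ, and those with μ ≠ 0 lie in its range.
  have hB : (Φ * A * Φ).IsSymmetric := by
    intro x y
    simp only [Module.End.mul_apply]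
    rw [hΦ, hA, hΦ]
  set e := hB.eigenvectorBasis rfl with he
  set μ : Fin (Module.finrank ℝ H) → ℝ := hB.eigenvalues rfl with hμ
  have hBe : ∀ k, Φ (A (Φ (e k))) = μ k • e k := fun k => hB.apply_eigenvectorBasis rfl k
  have hinner : ∀ k, ⟪A (Φ (e k)), Φ (e k)⟫ = μ k := by
    intro k
    rw [← hΦ, hBe, inner_smul_left, real_inner_self_eq_norm_sq, e.orthonormal.1 k]
    simp
  have hΦle : ∀ x, ‖Φ x‖ ≤ ‖x‖ := by
    intro x
    have h1 : ‖Φ x‖ ^ 2 ≤ ‖Φ x‖ * ‖x‖ := by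
      rw [← real_inner_self_eq_norm_sq, hΦ, hΦ2, real_inner_comm]
      exact real_inner_le_norm _ _
    rcases (norm_nonneg (Φ x)).eq_or_lt with h | h
    · rw [← h]; exact norm_nonneg _
    · nlinarith
  have hμ0 : ∀ k, 0 ≤ μ k := fun k => hinner k ▸ hApos _
  have hμf : ∀ k, μ k ≤ Λf := by
    intro k
    rw [← hinner k]
    refine (hf _).trans ?_
    have h1 := hΦle (e k)
    rw [e.orthonormal.1 k] at h1
    have : ‖Φ (e k)‖ ^ 2 ≤ 1 := pow_le_one₀ (norm_nonneg _) h1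
    nlinarith
  have hcoarse : ∀ k, μ k = 0 → Φ (e k) = 0 := by
    intro k hk
    have h1 := hcoer (Φ (e k))
    rw [hinner, hk] at h1
    have : ‖Φ (e k)‖ ^ 2 ≤ 0 := by nlinarith [sq_nonneg ‖Φ (e k)‖]
    exact norm_eq_zero.1 (pow_eq_zero_iff (two_ne_zero) |>.1 (le_antisymm this (sq_nonneg _)))
  have hfine : ∀ k, μ k ≠ 0 → Φ (e k) = e k := by
    intro k hk
    have h1 := congrArg Φ (hBe k)
    rw [hΦ2, hBe, map_smul] at h1
    exact (smul_right_injective H hk h1).symm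
  -- The diagonals of Φ, of Z and of the pseudoinverse of ΦAΦ, in this order.
  set π : Fin (Module.finrank ℝ H) → ℝ := fun k => if μ k = 0 then 0 else 1 with hπ
  set σ : Fin (Module.finrank ℝ H) → ℝ :=
    fun k => if μ k = 0 then 0 else (1 / R.eval (μ k) - 1) / μ k with hσ
  set ρ : Fin (Module.finrank ℝ H) → ℝ := fun k => if μ k = 0 then 0 else 1 / μ k with hρ
  have hΦd : Φ = diagOp e π := by
    refine e.toBasis.ext fun k => ?_
    rw [e.coe_toBasis, diagOp_basis]
    by_cases hk : μ k = 0
    · simp [hπ, hk, hcoarse k hk]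
    · simp [hπ, hk, hfine k hk]
  have hσ0 : ∀ k, 0 ≤ σ k := by
    intro k
    by_cases hk : μ k = 0
    · simp [hσ, hk]
    · simp only [hσ, hk, if_false]
      exact (hR _ ((hμ0 k).lt_of_ne' hk) (hμf k)).2.1
  have hσs : ∀ k, σ k ≤ s := by
    intro k
    by_cases hk : μ k = 0
    · simpa [hσ, hk] using hs
    · simp only [hσ, hk, if_false]
      exact (hR _ ((hμ0 k).lt_of_ne' hk) (hμf k)).2.2.1
  have hinj : Function.Injective A := by
    rw [← LinearMap.ker_eq_bot, LinearMap.ker_eq_bot']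
    intro x hx
    have h1 := hcoer x
    rw [hx, inner_zero_left] at h1
    have : ‖x‖ ^ 2 ≤ 0 := by nlinarith [sq_nonneg ‖x‖]
    exact norm_eq_zero.1 (pow_eq_zero_iff (two_ne_zero) |>.1 (le_antisymm this (sq_nonneg _)))
  set Ae := LinearEquiv.ofInjectiveEndo A hinj with hAe
  set Ai : Module.End ℝ H := Ae.symm.toLinearMap with hAi
  have hAi1 : ∀ x, Ai (A x) = x := fun x => Ae.symm_apply_apply x
  have hAi2 : ∀ x, A (Ai x) = x := fun x => Ae.apply_symm_apply x
  have hAisymm : Ai.IsSymmetric := by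
    intro x y
    conv_lhs => rw [← hAi2 y]
    rw [← hA, hAi2]
  set Z := diagOp e σ with hZ
  have hWA : (Ai + Z) * A = 1 + Z * A := by
    ext x
    simp [hAi1]
  refine ⟨Z, Ai + Z, hAisymm.add (diagOp_isSymmetric e σ),
    norm_diagOp_le e hs fun k => abs_le.2 ⟨by linarith [hσ0 k], hσs k⟩, hWA, ?_, ?_⟩
  -- In finite dimension one-sided inverses are two-sided, so the product may be taken in the order
  -- R(ΦA)(1 + ZA). There R(ΦA) stands to the left of Z and acts on fine eigenvectors as a scalar.
  · rw [hWA, mul_eq_one_comm]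
    set N := Φ * A with hN
    have hRq : R = 1 + R.divX * Polynomial.X := by
      conv_lhs => rw [← Polynomial.divX_mul_X_add R, Polynomial.coeff_zero_eq_eval_zero, hR0]
      simp [add_comm]
    have hNe : ∀ k, μ k ≠ 0 → N (e k) = μ k • e k := by
      intro k hk
      have := hBe k
      rwa [hfine k hk] at this
    have key : Polynomial.aeval N R.divX * Φ + Polynomial.aeval N R * Z = 0 := by
      refine e.toBasis.ext fun k => ?_
      rw [e.coe_toBasis, LinearMap.add_apply, Module.End.mul_apply, Module.End.mul_apply,
        hZ, diagOp_basis]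
      by_cases hk : μ k = 0
      · simp [hσ, hk, hcoarse k hk]
      · rw [hfine k hk, map_smul, aeval_apply_of_apply_eq_smul (hNe k hk),
          aeval_apply_of_apply_eq_smul (hNe k hk), smul_smul, ← add_smul]
        have hpos := (hR _ ((hμ0 k).lt_of_ne' hk) (hμf k)).1
        have hev : R.eval (μ k) = 1 + R.divX.eval (μ k) * μ k := by
          conv_lhs => rw [hRq]
          simp
        have : R.divX.eval (μ k) + σ k * R.eval (μ k) = 0 := by
          simp only [hσ, hk, if_false]
          field_simp
          rw [hev]
          ring
        rw [this, zero_smul, LinearMap.zero_apply]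
    have hΦN : Φ * N = N := by
      ext x
      simp [hN, hΦ2]
    -- Z lives on the range of Φ, hence Z = ZΦ.
    have hZA : Z * A = Z * N := by
      refine LinearMap.ext fun x => ?_
      simp only [hN, Module.End.mul_apply]
      refine eq_of_inner_basis_eq e fun k => ?_
      rw [hZ, inner_diagOp, inner_diagOp, hΦd, inner_diagOp]
      by_cases hk : μ k = 0
      · simp [hσ, hk]
      · simp [hπ, hk]
    have hR1 : Polynomial.aeval N R = 1 + Polynomial.aeval N R.divX * N := by
      conv_lhs => rw [hRq]
      simp
    calc Polynomial.aeval N R * (1 + Z * A)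
        = Polynomial.aeval N R + Polynomial.aeval N R * Z * N := by
          rw [hZA, mul_add, mul_one, mul_assoc]
      _ = 1 + (Polynomial.aeval N R.divX * (Φ * N) + Polynomial.aeval N R * Z * N) := by
          nth_rewrite 1 [hR1]
          rw [hΦN, add_assoc]
      _ = 1 + (Polynomial.aeval N R.divX * Φ + Polynomial.aeval N R * Z) * N := by
          rw [add_mul, mul_assoc _ Φ N]
      _ = 1 := by rw [key, zero_mul, add_zero]
  · intro x
    have hZx : ⟪Z x, x⟫ = ∑ k, σ k * ⟪e k, x⟫ ^ 2 := by
      rw [hZ, inner_diagOp_left]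
      simp only [sq]
    have hadd : ⟪(Ai + Z) x, x⟫ = ⟪Ai x, x⟫ + ⟪Z x, x⟫ := by
      rw [LinearMap.add_apply, inner_add_left]
    constructor
    -- Trial vectors for the lower bound: f is optimal on the range of Φ, and g is a multiple of the
    -- coarse part of x with the scaling suited to A ≤ Λc there.
    · set f := diagOp e ρ x with hf'
      set g := (1 / Λc) • (x - Φ x) with hg
      -- Dual variational principle: ⟨A⁻¹x, x⟩ is the maximum of 2⟨x, v⟩ - ⟨Av, v⟩ over v.
      have hquad : ∀ v, 2 * ⟪x, v⟫ - ⟪A v, v⟫ ≤ ⟪Ai x, x⟫ := by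
        intro v
        have h1 := hApos (Ai x - v)
        rw [map_sub, inner_sub_left, inner_sub_right, inner_sub_right, hAi2] at h1
        have h2 : ⟪A v, Ai x⟫ = ⟪x, v⟫ := by rw [hA, hAi2, real_inner_comm]
        rw [h2, real_inner_comm (Ai x) x] at h1
        linarith
      -- Convexity of the quadratic form decouples f from g, so no bound for the coupling of the
      -- coarse and fine parts through A is needed; the price is the weights 1 - η and η.
      have hconv : ⟪A ((1 - η) • f + η • g), (1 - η) • f + η • g⟫ ≤
          (1 - η) * ⟪A f, f⟫ + η * ⟪A g, g⟫ := by
        have h1 := hApos (f - g)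
        have h2 : ⟪A g, f⟫ = ⟪A f, g⟫ := by rw [hA, real_inner_comm]
        have h4 : 0 < η * (1 - η) := mul_pos hη0 (sub_pos.2 hη1)
        simp only [map_sub, map_add, map_smul, inner_sub_left, inner_sub_right, inner_add_left,
          inner_add_right, real_inner_smul_left, real_inner_smul_right, h2] at h1 ⊢
        nlinarith
      have hAf : ⟪A f, f⟫ = ∑ k, ρ k * ⟪e k, x⟫ ^ 2 := by
        have h1 : Φ f = f := by
          refine eq_of_inner_basis_eq e fun k => ?_
          rw [hΦd, inner_diagOp, hf', inner_diagOp]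
          by_cases hk : μ k = 0
          · simp [hρ, hk]
          · simp [hπ, hk]
        have h2 : ⟪A f, f⟫ = ⟪(Φ * A * Φ) f, f⟫ := by
          simp only [Module.End.mul_apply]
          rw [hΦ, h1]
        have h3 : Φ * A * Φ = diagOp e μ := by
          refine e.toBasis.ext fun k => ?_
          rw [e.coe_toBasis, diagOp_basis]
          exact hBe k
        rw [h2, h3, inner_diagOp_left]
        refine Finset.sum_congr rfl fun k _ => ?_
        rw [hf', inner_diagOp]
        by_cases hk : μ k = 0
        · simp [hρ, hk]
        · simp only [hρ, hk, if_false]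
          field_simp
      have hxf : ⟪x, f⟫ = ∑ k, ρ k * ⟪e k, x⟫ ^ 2 := by
        rw [hf', real_inner_comm, inner_diagOp_left]
        simp only [sq]
      have hΦc : Φ (x - Φ x) = 0 := by rw [map_sub, hΦ2, sub_self]
      have hxc : ⟪x, x - Φ x⟫ = ∑ k, (1 - π k) * ⟪e k, x⟫ ^ 2 := by
        rw [inner_sub_right, real_inner_self_eq_norm_sq, norm_sq_eq_sum_basis e,
          real_inner_comm, hΦd, inner_diagOp_left, ← Finset.sum_sub_distrib]
        exact Finset.sum_congr rfl fun k _ => by ring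
      have hnc : ‖x - Φ x‖ ^ 2 = ⟪x, x - Φ x⟫ := by
        rw [← real_inner_self_eq_norm_sq]
        conv_lhs => rw [inner_sub_left, hΦ, hΦc, inner_zero_right, sub_zero]
      have hAg : ⟪A g, g⟫ ≤ 1 / Λc * ⟪x, x - Φ x⟫ := by
        refine (hc g ?_).trans ?_
        · rw [hg, map_smul, hΦc, smul_zero]
        · rw [hg, norm_smul, mul_pow, hnc, Real.norm_eq_abs, sq_abs]
          refine le_of_eq ?_
          field_simp
      have hxg : ⟪x, g⟫ = 1 / Λc * ⟪x, x - Φ x⟫ := by rw [hg, real_inner_smul_right]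
      have hmain := hquad ((1 - η) • f + η • g)
      rw [inner_add_right, real_inner_smul_right, real_inner_smul_right, hxf, hxg] at hmain
      rw [hAf] at hconv
      have hlow : (1 - η) * ∑ k, ρ k * ⟪e k, x⟫ ^ 2 + η * (1 / Λc * ⟪x, x - Φ x⟫) ≤ ⟪Ai x, x⟫ := by
        have := mul_le_mul_of_nonneg_left hAg hη0.le
        linarith
      rw [hxc] at hlow
      rw [hadd, hZx]
      refine le_trans ?_ (add_le_add hlow le_rfl)
      rw [norm_sq_eq_sum_basis e, Finset.mul_sum, Finset.mul_sum, Finset.mul_sum, Finset.mul_sum,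
        ← Finset.sum_add_distrib, ← Finset.sum_add_distrib]
      refine Finset.sum_le_sum fun k _ => ?_
      -- Mode by mode: a coarse mode receives η/Λc, a fine one (1 - η)/μ + (1/R(μ) - 1)/μ = (1/R(μ)
      -- - η)/μ.
      have hk' : κ ≤ (1 - η) * ρ k + η * (1 / Λc * (1 - π k)) + σ k := by
        by_cases hk : μ k = 0
        · simp only [hρ, hπ, hσ, hk, if_true]
          rw [div_eq_mul_one_div] at hκ
          simpa using hκ
        · have h1 := (hR _ ((hμ0 k).lt_of_ne' hk) (hμf k)).2.2.2
          simp only [hρ, hπ, hσ, hk, if_false]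
          refine h1.trans (le_of_eq ?_)
          ring
      have := mul_le_mul_of_nonneg_right hk' (sq_nonneg ⟪e k, x⟫)
      refine this.trans (le_of_eq ?_)
      ring
    · have h1 : ⟪Ai x, x⟫ ≤ 1 / α * ‖x‖ ^ 2 := by
        have h2 := hcoer (Ai x)
        rw [hAi2] at h2
        have h3 := real_inner_le_norm x (Ai x)
        have h4 : α * ‖Ai x‖ ≤ ‖x‖ := by
          rcases (norm_nonneg (Ai x)).eq_or_lt with h | h
          · rw [← h, mul_zero]; exact norm_nonneg _
          · nlinarith
        rw [real_inner_comm]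
        refine h3.trans ?_
        have h5 : ‖Ai x‖ ≤ 1 / α * ‖x‖ := by
          rw [one_div_mul_eq_div, le_div_iff₀ hα]
          linarith
        nlinarith [norm_nonneg x]
      have h2 : ⟪Z x, x⟫ ≤ s * ‖x‖ ^ 2 := by
        rw [hZx, norm_sq_eq_sum_basis e, Finset.mul_sum]
        exact Finset.sum_le_sum fun k _ => mul_le_mul_of_nonneg_right (hσs k) (sq_nonneg _)
      rw [hadd, add_mul]
      exact add_le_add h1 h2

end Operator

/-! ## Stability of the leapfrog recursion in a weak norm -/

section Stability

variable {H : Type*} [NormedAddCommGroup H] [InnerProductSpace ℝ H]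

local notation "⟪" x "," y "⟫" => inner ℝ x y

theorem inner_le_sqrt_mul_sqrt {W : Module.End ℝ H} (hW : W.IsSymmetric)
    (hpos : ∀ x, 0 ≤ ⟪W x, x⟫) (x y : H) :
    ⟪W x, y⟫ ≤ Real.sqrt ⟪W x, x⟫ * Real.sqrt ⟪W y, y⟫ := by
  rw [← Real.sqrt_mul (hpos x)]
  refine Real.le_sqrt_of_sq_le ?_
  have hyx : ⟪W y, x⟫ = ⟪W x, y⟫ := by rw [hW, real_inner_comm]
  have h : ∀ t : ℝ, 0 ≤ ⟪W y, y⟫ * (t * t) + 2 * ⟪W x, y⟫ * t + ⟪W x, x⟫ := by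
    intro t
    have h1 := hpos (x + t • y)
    simp only [map_add, map_smul, inner_add_left, inner_add_right, real_inner_smul_left,
      real_inner_smul_right, hyx] at h1
    linarith
  have := discrim_le_zero h
  rw [discrim] at this
  linarith

/-- Testing the recursion with e(n+2) - e(n) telescopes into the change of the energy G. Since W ≥
κτ² with κ > 1/4, G dominates both the increment and the midpoint of two consecutive iterates, and
these determine e(n+1). -/
theorem leapfrog_stability {W : Module.End ℝ H} (hW : W.IsSymmetric) {κ w τ : ℝ} (hκ : 1 / 4 < κ)
    (hw : 0 ≤ w) (hτ : 0 < τ) (hlow : ∀ x, κ * τ ^ 2 * ‖x‖ ^ 2 ≤ ⟪W x, x⟫)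
    (hup : ∀ x, ⟪W x, x⟫ ≤ w * ‖x‖ ^ 2) {e r : ℕ → H} {N : ℕ}
    (hrec : ∀ n, n + 2 ≤ N →
      W (e (n + 2) - (2 : ℝ) • e (n + 1) + e n) + τ ^ 2 • e (n + 1) = τ ^ 2 • W (r (n + 1)))
    {ρ ε₀ ε₁ : ℝ} (hr : ∀ n, n + 2 ≤ N → ‖r (n + 1)‖ ≤ ρ) (h0 : ‖e 0‖ ≤ ε₀)
    (h1 : ‖e 1 - e 0‖ ≤ τ * ε₁) (n : ℕ) (hn : n + 1 ≤ N) :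
    ‖e (n + 1)‖ ≤ (1 + 1 / (2 * Real.sqrt (κ - 1 / 4))) *
      (Real.sqrt w * ε₁ + ε₀ + τ * ε₁ / 2 +
        n * τ * (Real.sqrt (w * κ / (κ - 1 / 4)) * ρ)) := by
  have hκ0 : 0 < κ := by linarith
  have hκ4 : 0 < κ - 1 / 4 := by linarith
  have hpos : ∀ x, 0 ≤ ⟪W x, x⟫ := fun x => le_trans (by positivity) (hlow x)
  set G : ℕ → ℝ := fun n => ⟪W (e (n + 1) - e n), e (n + 1) - e n⟫ + τ ^ 2 * ⟪e (n + 1), e n⟫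
    with hG
  -- Polarization isolates the only negative part of G, namely -τ²/4 times the squared increment;
  -- the lower bound on W absorbs it.
  have hid : ∀ n, ⟪e (n + 1), e n⟫ = ‖(1 / 2 : ℝ) • (e (n + 1) + e n)‖ ^ 2 -
      1 / 4 * ‖e (n + 1) - e n‖ ^ 2 := by
    intro n
    rw [norm_smul, mul_pow, norm_add_sq_real, norm_sub_sq_real]
    norm_num
    ring
  have hGlow : ∀ n, (κ - 1 / 4) / κ * ⟪W (e (n + 1) - e n), e (n + 1) - e n⟫ +
      τ ^ 2 * ‖(1 / 2 : ℝ) • (e (n + 1) + e n)‖ ^ 2 ≤ G n := by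
    intro n
    have h := hlow (e (n + 1) - e n)
    have h2 : τ ^ 2 * ‖e (n + 1) - e n‖ ^ 2 ≤ ⟪W (e (n + 1) - e n), e (n + 1) - e n⟫ / κ := by
      rw [le_div_iff₀ hκ0]
      linarith
    have h3 : (κ - 1 / 4) / κ * ⟪W (e (n + 1) - e n), e (n + 1) - e n⟫ =
      ⟪W (e (n + 1) - e n), e (n + 1) - e n⟫ -
        1 / 4 * (⟪W (e (n + 1) - e n), e (n + 1) - e n⟫ / κ) := by
      field_simp
    simp only [hG]
    rw [hid, h3]
    linarith
  have hG0 : ∀ n, 0 ≤ G n := by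
    intro n
    refine le_trans ?_ (hGlow n)
    have := hpos (e (n + 1) - e n)
    have : 0 ≤ (κ - 1 / 4) / κ := by positivity
    positivity
  have hGW : ∀ n, Real.sqrt ⟪W (e (n + 1) - e n), e (n + 1) - e n⟫ ≤
      Real.sqrt (κ / (κ - 1 / 4)) * Real.sqrt (G n) := by
    intro n
    rw [← Real.sqrt_mul (by positivity)]
    refine Real.sqrt_le_sqrt ?_
    have h := hGlow n
    have h2 : (κ - 1 / 4) / κ * ⟪W (e (n + 1) - e n), e (n + 1) - e n⟫ ≤ G n := by
      have : 0 ≤ τ ^ 2 * ‖(1 / 2 : ℝ) • (e (n + 1) + e n)‖ ^ 2 := by positivity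
      linarith
    calc ⟪W (e (n + 1) - e n), e (n + 1) - e n⟫
        = κ / (κ - 1 / 4) * ((κ - 1 / 4) / κ * ⟪W (e (n + 1) - e n), e (n + 1) - e n⟫) := by
          rw [← mul_assoc, div_mul_div_cancel₀ hκ4.ne', div_self hκ0.ne', one_mul]
      _ ≤ _ := mul_le_mul_of_nonneg_left h2 (by positivity)
  set c := Real.sqrt (w * κ / (κ - 1 / 4)) * ρ with hc
  have hstep : ∀ n, n + 2 ≤ N → Real.sqrt (G (n + 1)) ≤ Real.sqrt (G n) + τ ^ 2 * c := by
    intro n hn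
    have hinc : G (n + 1) - G n =
        τ ^ 2 * (⟪W (r (n + 1)), e (n + 2) - e (n + 1)⟫ + ⟪W (r (n + 1)), e (n + 1) - e n⟫) := by
      have h := congrArg (fun z => ⟪z, e (n + 2) - e n⟫) (hrec n hn)
      simp only [inner_add_left, real_inner_smul_left] at h
      have e1 : e (n + 2) - e n = (e (n + 2) - e (n + 1)) + (e (n + 1) - e n) := by abel
      have e2 : e (n + 2) - (2 : ℝ) • e (n + 1) + e n =
        (e (n + 2) - e (n + 1)) - (e (n + 1) - e n) := by rw [two_smul]; abel
      have e3 : ⟪W (e (n + 1) - e n), e (n + 2) - e (n + 1)⟫ =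
        ⟪W (e (n + 2) - e (n + 1)), e (n + 1) - e n⟫ := by rw [hW, real_inner_comm]
      have e4 : ⟪e (n + 1), e (n + 2) - e n⟫ = ⟪e (n + 2), e (n + 1)⟫ - ⟪e (n + 1), e n⟫ := by
        rw [inner_sub_right, real_inner_comm]
      rw [e4, e2] at h
      rw [e1] at h
      rw [map_sub, inner_sub_left, inner_add_right, inner_add_right, inner_add_right, e3] at h
      simp only [hG]
      linarith
    have hcs : ∀ y, ⟪W (r (n + 1)), y⟫ ≤ Real.sqrt w * ρ * Real.sqrt ⟪W y, y⟫ := by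
      intro y
      refine (inner_le_sqrt_mul_sqrt hW hpos _ _).trans ?_
      refine mul_le_mul_of_nonneg_right ?_ (Real.sqrt_nonneg _)
      refine (Real.sqrt_le_sqrt (hup _)).trans ?_
      rw [Real.sqrt_mul hw, Real.sqrt_sq (norm_nonneg _)]
      exact mul_le_mul_of_nonneg_left (hr n hn) (Real.sqrt_nonneg _)
    have hρ : 0 ≤ ρ := (norm_nonneg _).trans (hr n hn)
    have hcs' : ∀ k, ⟪W (r (n + 1)), e (k + 1) - e k⟫ ≤ c * Real.sqrt (G k) := by
      intro k
      refine (hcs _).trans ((mul_le_mul_of_nonneg_left (hGW k) (by positivity)).trans ?_)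
      rw [hc, mul_div_assoc, Real.sqrt_mul hw]
      refine le_of_eq ?_
      ring
    have a1 := hcs' (n + 1)
    have a2 := hcs' n
    have hτ2 : 0 < τ ^ 2 := by positivity
    -- The left-hand side is a difference of squares of √G, and cancelling the sum of the roots
    -- makes √G grow by at most τ²c per step. The argument by contradiction covers the case where
    -- that sum is zero.
    have hmain : G (n + 1) - G n ≤ τ ^ 2 * c * (Real.sqrt (G (n + 1)) + Real.sqrt (G n)) := by
      rw [hinc]
      nlinarith
    have s1 := Real.sq_sqrt (hG0 (n + 1))
    have s2 := Real.sq_sqrt (hG0 n)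
    have p1 := Real.sqrt_nonneg (G (n + 1))
    have p2 := Real.sqrt_nonneg (G n)
    have hc0 : 0 ≤ c := by positivity
    by_contra! hlt
    have hsum : 0 < Real.sqrt (G (n + 1)) + Real.sqrt (G n) := by nlinarith
    nlinarith [mul_pos (sub_pos.2 hlt) hsum]
  have hsum : ∀ n, n + 1 ≤ N → Real.sqrt (G n) ≤ Real.sqrt (G 0) + n * (τ ^ 2 * c) := by
    intro n
    induction n with
    | zero => intro _; simp
    | succ n ih =>
      intro hn
      have := hstep n hn
      have := ih (by omega)
      push_cast
      linarith
  have hε₁ : 0 ≤ ε₁ := by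
    have := (norm_nonneg _).trans h1
    exact nonneg_of_mul_nonneg_right this hτ
  have hε₀ : 0 ≤ ε₀ := (norm_nonneg _).trans h0
  have hG00 : Real.sqrt (G 0) ≤ τ * (Real.sqrt w * ε₁ + ε₀ + τ * ε₁ / 2) := by
    refine Real.sqrt_le_iff.2 ⟨by positivity, ?_⟩
    have hm : ‖(1 / 2 : ℝ) • (e 1 + e 0)‖ ≤ ε₀ + τ * ε₁ / 2 := by
      have : (1 / 2 : ℝ) • (e 1 + e 0) = e 0 + (1 / 2 : ℝ) • (e 1 - e 0) := by module
      rw [this]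
      refine (norm_add_le _ _).trans ?_
      rw [norm_smul]
      norm_num
      linarith
    have hWd : ⟪W (e 1 - e 0), e 1 - e 0⟫ ≤ w * (τ * ε₁) ^ 2 :=
      (hup _).trans (mul_le_mul_of_nonneg_left (pow_le_pow_left₀ (norm_nonneg _) h1 2) hw)
    have hm2 : ‖(1 / 2 : ℝ) • (e 1 + e 0)‖ ^ 2 ≤ (ε₀ + τ * ε₁ / 2) ^ 2 :=
      pow_le_pow_left₀ (norm_nonneg _) hm 2
    have hw2 := Real.sq_sqrt hw
    have : G 0 ≤ w * (τ * ε₁) ^ 2 + τ ^ 2 * (ε₀ + τ * ε₁ / 2) ^ 2 := by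
      have h3 := mul_le_mul_of_nonneg_left hm2 (sq_nonneg τ)
      have h4 : 0 ≤ 1 / 4 * ‖e (0 + 1) - e 0‖ ^ 2 := by positivity
      have h5 := mul_nonneg (sq_nonneg τ) h4
      simp only [hG]
      rw [hid, zero_add]
      rw [zero_add] at h5
      linarith
    refine this.trans ?_
    have hcross : 0 ≤ 2 * τ ^ 2 * (Real.sqrt w * ε₁) * (ε₀ + τ * ε₁ / 2) := by positivity
    calc w * (τ * ε₁) ^ 2 + τ ^ 2 * (ε₀ + τ * ε₁ / 2) ^ 2
        = τ ^ 2 * ((Real.sqrt w) ^ 2 * ε₁ ^ 2 + (ε₀ + τ * ε₁ / 2) ^ 2) := by rw [hw2]; ring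
      _ ≤ (τ * (Real.sqrt w * ε₁ + ε₀ + τ * ε₁ / 2)) ^ 2 := by linarith
  have hfin := hsum n hn
  have hm : τ * ‖(1 / 2 : ℝ) • (e (n + 1) + e n)‖ ≤ Real.sqrt (G n) := by
    refine Real.le_sqrt_of_sq_le ?_
    refine le_trans ?_ (hGlow n)
    rw [mul_pow]
    have := hpos (e (n + 1) - e n)
    have : 0 ≤ (κ - 1 / 4) / κ := by positivity
    have : 0 ≤ (κ - 1 / 4) / κ * ⟪W (e (n + 1) - e n), e (n + 1) - e n⟫ := by positivity
    linarith
  have hd : τ * (Real.sqrt (κ - 1 / 4) * ‖e (n + 1) - e n‖) ≤ Real.sqrt (G n) := by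
    refine Real.le_sqrt_of_sq_le ?_
    refine le_trans ?_ (hGlow n)
    rw [mul_pow, mul_pow, Real.sq_sqrt hκ4.le]
    have h2 := mul_le_mul_of_nonneg_left (hlow (e (n + 1) - e n))
      (show 0 ≤ (κ - 1 / 4) / κ by positivity)
    have h3 : (κ - 1 / 4) / κ * (κ * τ ^ 2 * ‖e (n + 1) - e n‖ ^ 2) =
        τ ^ 2 * ((κ - 1 / 4) * ‖e (n + 1) - e n‖ ^ 2) := by field_simp
    have : 0 ≤ τ ^ 2 * ‖(1 / 2 : ℝ) • (e (n + 1) + e n)‖ ^ 2 := by positivity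
    linarith
  have hq : 0 < Real.sqrt (κ - 1 / 4) := Real.sqrt_pos.2 hκ4
  have hX : Real.sqrt (G n) ≤ τ * (Real.sqrt w * ε₁ + ε₀ + τ * ε₁ / 2 + n * τ * c) := by
    refine hfin.trans ?_
    linarith
  set X := Real.sqrt w * ε₁ + ε₀ + τ * ε₁ / 2 + n * τ * c
  have hm' : ‖(1 / 2 : ℝ) • (e (n + 1) + e n)‖ ≤ X := le_of_mul_le_mul_left (hm.trans hX) hτ
  have hd' : Real.sqrt (κ - 1 / 4) * ‖e (n + 1) - e n‖ ≤ X :=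
    le_of_mul_le_mul_left (hd.trans hX) hτ
  -- The iterate is the midpoint plus half the increment; both carry a factor τ in the energy, which
  -- cancels against the τ in the bound for √G.
  have hsplit : e (n + 1) =
      (1 / 2 : ℝ) • (e (n + 1) + e n) + (1 / 2 : ℝ) • (e (n + 1) - e n) := by module
  rw [hsplit]
  refine (norm_add_le _ _).trans ?_
  have hd'' : ‖(1 / 2 : ℝ) • (e (n + 1) - e n)‖ ≤ 1 / (2 * Real.sqrt (κ - 1 / 4)) * X := by
    rw [norm_smul, one_div_mul_eq_div, le_div_iff₀ (by positivity)]
    norm_num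
    linarith
  linarith

end Stability

/-! ## Taylor remainders and regularity in time -/

section Taylor

variable {X : Type*} [NormedAddCommGroup X] [NormedSpace ℝ X]

/-- One step of a Taylor estimate by the mean value inequality, iterated below. The factor 1/(k + 1)
that integration would give is dropped, which affects constants only. -/
theorem norm_le_mul_pow_of_hasDerivWithinAt {σ M : ℝ} {k : ℕ} {g g' : ℝ → X} (hM : 0 ≤ M)
    (hg : ∀ s ∈ Icc 0 σ, HasDerivWithinAt g (g' s) (Icc 0 σ) s) (h0 : g 0 = 0)
    (hb : ∀ s ∈ Icc 0 σ, ‖g' s‖ ≤ M * s ^ k) : ∀ s ∈ Icc 0 σ, ‖g s‖ ≤ M * s ^ (k + 1) := by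
  intro s hs
  have hsub : Icc 0 s ⊆ Icc 0 σ := Icc_subset_Icc_right hs.2
  have h := Convex.norm_image_sub_le_of_norm_hasDerivWithin_le (C := M * s ^ k)
    (fun x hx => (hg x (hsub hx)).mono hsub)
    (fun x hx => (hb x (hsub hx)).trans
      (mul_le_mul_of_nonneg_left (pow_le_pow_left₀ hx.1 hx.2 k) hM))
    (convex_Icc 0 s) (left_mem_Icc.2 hs.1) (right_mem_Icc.2 hs.1)
  rw [h0, sub_zero, sub_zero, Real.norm_of_nonneg hs.1, mul_assoc, ← pow_succ] at h
  exact h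

/-- The functions `f k` are the successive derivatives of `f 0` on the closed interval `[0,T]`. -/
def IsDerivChain (T : ℝ) (f : ℕ → ℝ → X) : Prop :=
  ∀ k, ∀ t ∈ Icc 0 T, HasDerivWithinAt (f k) (f (k + 1) t) (Icc 0 T) t

namespace IsDerivChain

variable {T : ℝ} {f : ℕ → ℝ → X}

theorem shift (hf : IsDerivChain T f) (j : ℕ) : IsDerivChain T fun k => f (k + j) := by
  intro k t ht
  have := hf (k + j) t ht
  rwa [add_right_comm] at this

theorem continuousOn (hf : IsDerivChain T f) (k : ℕ) : ContinuousOn (f k) (Icc 0 T) :=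
  fun t ht => (hf k t ht).continuousWithinAt

theorem hasDerivWithinAt_add (hf : IsDerivChain T f) (k : ℕ) {t σ s : ℝ} (ht : 0 ≤ t)
    (htσ : t + σ ≤ T) (hs : s ∈ Icc 0 σ) :
    HasDerivWithinAt (fun r => f k (t + r)) (f (k + 1) (t + s)) (Icc 0 σ) s := by
  have h := (hf k (t + s) ⟨by linarith [hs.1], by linarith [hs.2]⟩).scomp s
    ((hasDerivWithinAt_id s (Icc 0 σ)).const_add t)
    (fun r hr => ⟨by simpa using add_nonneg ht hr.1, by simpa using (by linarith [hr.2])⟩)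
  simpa [Function.comp_def] using h

theorem hasDerivWithinAt_sub (hf : IsDerivChain T f) (k : ℕ) {t σ s : ℝ} (ht : σ ≤ t)
    (htT : t ≤ T) (hs : s ∈ Icc 0 σ) :
    HasDerivWithinAt (fun r => f k (t - r)) (-f (k + 1) (t - s)) (Icc 0 σ) s := by
  have h := (hf k (t - s) ⟨by linarith [hs.2], by linarith [hs.1]⟩).scomp s
    ((hasDerivWithinAt_id s (Icc 0 σ)).const_sub t)
    (fun r hr => ⟨by simpa using (by linarith [hr.2]), by simpa using (by linarith [hr.1])⟩)
  simpa [Function.comp_def] using h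

theorem norm_sub_le (hf : IsDerivChain T f) {M σ : ℝ} (hσ0 : 0 ≤ σ) (hσ : σ ≤ T)
    (hM : ∀ t ∈ Icc 0 T, ‖f 1 t‖ ≤ M) : ‖f 0 σ - f 0 0‖ ≤ M * σ := by
  have h := Convex.norm_image_sub_le_of_norm_hasDerivWithin_le (hf 0) hM (convex_Icc 0 T)
    (left_mem_Icc.2 (hσ0.trans hσ)) (show σ ∈ Icc 0 T from ⟨hσ0, hσ⟩)
  rwa [sub_zero, Real.norm_of_nonneg hσ0] at h

theorem norm_taylor_le (hf : IsDerivChain T f) {M σ : ℝ} (hσ0 : 0 ≤ σ) (hσ : σ ≤ T)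
    (hM : ∀ t ∈ Icc 0 T, ‖f 3 t‖ ≤ M) :
    ‖f 0 σ - f 0 0 - σ • f 1 0 - (σ ^ 2 / 2) • f 2 0‖ ≤ M * σ ^ 3 := by
  have hM0 : 0 ≤ M := (norm_nonneg _).trans (hM 0 (left_mem_Icc.2 (hσ0.trans hσ)))
  have hd : ∀ k, ∀ s ∈ Icc 0 σ, HasDerivWithinAt (f k) (f (k + 1) s) (Icc 0 σ) s := fun k s hs =>
    (hf k s ⟨hs.1, hs.2.trans hσ⟩).mono (Icc_subset_Icc_right hσ)
  have h2 : ∀ s ∈ Icc 0 σ, ‖f 2 s - f 2 0‖ ≤ M * s ^ (0 + 1) :=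
    norm_le_mul_pow_of_hasDerivWithinAt hM0 (fun s hs => (hd 2 s hs).sub_const _) (sub_self _)
      fun s hs => by simpa using hM s ⟨hs.1, hs.2.trans hσ⟩
  have h1 : ∀ s ∈ Icc 0 σ, ‖f 1 s - f 1 0 - s • f 2 0‖ ≤ M * s ^ (0 + 1 + 1) := by
    refine norm_le_mul_pow_of_hasDerivWithinAt hM0 (fun s hs => ?_) (by simp) h2
    have := ((hd 1 s hs).sub_const (f 1 0)).sub ((hasDerivWithinAt_id s _).smul_const (f 2 0))
    rw [one_smul] at this
    exact this
  have h0 : ∀ s ∈ Icc 0 σ, ‖f 0 s - f 0 0 - s • f 1 0 - (s ^ 2 / 2) • f 2 0‖ ≤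
      M * s ^ (0 + 1 + 1 + 1) := by
    refine norm_le_mul_pow_of_hasDerivWithinAt hM0 (fun s hs => ?_) (by simp) h1
    have e : HasDerivWithinAt (fun r : ℝ => r ^ 2 / 2) s (Icc 0 σ) s := by
      have := ((hasDerivAt_pow 2 s).div_const 2).hasDerivWithinAt (s := Icc 0 σ)
      simpa using this
    have := (((hd 0 s hs).sub_const (f 0 0)).sub
      ((hasDerivWithinAt_id s _).smul_const (f 1 0))).sub (e.smul_const (f 2 0))
    rw [one_smul] at this
    exact this
  exact h0 σ (right_mem_Icc.2 hσ0)

theorem norm_second_difference_le (hf : IsDerivChain T f) {M t σ : ℝ} (hσ0 : 0 ≤ σ) (ht : σ ≤ t)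
    (htσ : t + σ ≤ T) (hM : ∀ t ∈ Icc 0 T, ‖f 2 t‖ ≤ M) :
    ‖f 0 (t + σ) - (2 : ℝ) • f 0 t + f 0 (t - σ)‖ ≤ 2 * M * σ ^ 2 := by
  have hM0 : 0 ≤ M := (norm_nonneg _).trans (hM t ⟨hσ0.trans ht, by linarith⟩)
  have ht0 : 0 ≤ t := hσ0.trans ht
  have htT : t ≤ T := by linarith
  have h1 : ∀ s ∈ Icc 0 σ, ‖f 1 (t + s) - f 1 (t - s)‖ ≤ 2 * M * s ^ (0 + 1) := by
    refine norm_le_mul_pow_of_hasDerivWithinAt (by positivity) (fun s hs =>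
      (hf.hasDerivWithinAt_add 1 ht0 htσ hs).sub (hf.hasDerivWithinAt_sub 1 ht htT hs)) (by simp)
      fun s hs => ?_
    have a1 := hM (t + s) ⟨by linarith [hs.1], by linarith [hs.2]⟩
    have a2 := hM (t - s) ⟨by linarith [hs.2], by linarith [hs.1]⟩
    rw [sub_neg_eq_add, pow_zero, mul_one]
    exact (norm_add_le _ _).trans (by simp only [Nat.reduceAdd]; linarith)
  have h0 : ∀ s ∈ Icc 0 σ, ‖f 0 (t + s) - (2 : ℝ) • f 0 t + f 0 (t - s)‖ ≤
      2 * M * s ^ (0 + 1 + 1) := by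
    refine norm_le_mul_pow_of_hasDerivWithinAt (by positivity) (fun s hs => ?_)
      (by rw [add_zero, sub_zero, two_smul]; abel) h1
    have := ((hf.hasDerivWithinAt_add 0 ht0 htσ hs).sub_const ((2 : ℝ) • f 0 t)).add
      (hf.hasDerivWithinAt_sub 0 ht htT hs)
    rwa [← sub_eq_add_neg] at this
  exact h0 σ (right_mem_Icc.2 hσ0)

/-- Differentiating twice in the step size leaves the second difference of the second derivative, to
which the previous estimate applies; two integrations then restore the power of the step. -/
theorem norm_second_difference_sub_le (hf : IsDerivChain T f) {M t σ : ℝ} (hσ0 : 0 ≤ σ)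
    (ht : σ ≤ t) (htσ : t + σ ≤ T) (hM : ∀ t ∈ Icc 0 T, ‖f 4 t‖ ≤ M) :
    ‖f 0 (t + σ) - (2 : ℝ) • f 0 t + f 0 (t - σ) - σ ^ 2 • f 2 t‖ ≤ 2 * M * σ ^ 4 := by
  have hM0 : 0 ≤ M := (norm_nonneg _).trans (hM t ⟨hσ0.trans ht, by linarith⟩)
  have ht0 : 0 ≤ t := hσ0.trans ht
  have htT : t ≤ T := by linarith
  have h2 : ∀ s ∈ Icc 0 σ, ‖f 2 (t + s) + f 2 (t - s) - (2 : ℝ) • f 2 t‖ ≤ 2 * M * s ^ 2 := by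
    intro s hs
    have := (hf.shift 2).norm_second_difference_le hs.1 (hs.2.trans ht)
      (by linarith [hs.2]) hM
    refine le_of_eq_of_le ?_ this
    congr 1
    simp only [zero_add]
    abel
  have h1 : ∀ s ∈ Icc 0 σ, ‖f 1 (t + s) - f 1 (t - s) - (2 * s) • f 2 t‖ ≤ 2 * M * s ^ (2 + 1) := by
    refine norm_le_mul_pow_of_hasDerivWithinAt (by positivity) (fun s hs => ?_) (by simp) h2
    have e : HasDerivWithinAt (fun r : ℝ => 2 * r) 2 (Icc 0 σ) s := by
      simpa using (hasDerivWithinAt_id s (Icc 0 σ)).const_mul 2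
    have := ((hf.hasDerivWithinAt_add 1 ht0 htσ hs).sub
      (hf.hasDerivWithinAt_sub 1 ht htT hs)).sub (e.smul_const (f 2 t))
    rwa [sub_neg_eq_add] at this
  have h0 : ∀ s ∈ Icc 0 σ, ‖f 0 (t + s) - (2 : ℝ) • f 0 t + f 0 (t - s) - s ^ 2 • f 2 t‖ ≤
      2 * M * s ^ (2 + 1 + 1) := by
    refine norm_le_mul_pow_of_hasDerivWithinAt (by positivity) (fun s hs => ?_)
      (by rw [add_zero, sub_zero, two_smul]; simp) h1
    have e : HasDerivWithinAt (fun r : ℝ => r ^ 2) (2 * s) (Icc 0 σ) s := by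
      have := (hasDerivAt_pow 2 s).hasDerivWithinAt (s := Icc 0 σ)
      simpa using this
    have := (((hf.hasDerivWithinAt_add 0 ht0 htσ hs).sub_const ((2 : ℝ) • f 0 t)).add
      (hf.hasDerivWithinAt_sub 0 ht htT hs)).sub (e.smul_const (f 2 t))
    rwa [← sub_eq_add_neg] at this
  exact h0 σ (right_mem_Icc.2 hσ0)

/-- Integration by parts against a test function supported inside (0,T), one derivative at a time.
-/
theorem hasWeakTimeDeriv [CompleteSpace X] (hf : IsDerivChain T f) (hT : 0 ≤ T) (k : ℕ) :
    ∀ j, HasWeakTimeDeriv T k (f j) (f (j + k)) := by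
  induction k with
  | zero =>
    intro j φ _ _ _
    simp
  | succ k ih =>
    intro j φ hφ hc hs
    have hφ' : ContDiff ℝ ∞ (deriv φ) := (contDiff_infty_iff_deriv.1 hφ).2
    have hs' : tsupport (deriv φ) ⊆ Ioo 0 T := (tsupport_deriv_subset (𝕜 := ℝ)).trans hs
    rw [iteratedDeriv_succ', ih j (deriv φ) hφ' hc.deriv hs', pow_succ, mul_smul]
    congr 1
    rw [neg_one_smul, eq_neg_iff_add_eq_zero]
    have hcont : ContinuousOn (fun t => φ t • f (j + k) t) (Icc 0 T) :=
      hφ.continuous.continuousOn.smul (hf.continuousOn _)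
    have c1 : ContinuousOn (fun t => deriv φ t • f (j + k) t) (Icc 0 T) :=
      hφ'.continuous.continuousOn.smul (hf.continuousOn _)
    have c2 : ContinuousOn (fun t => φ t • f (j + k + 1) t) (Icc 0 T) :=
      hφ.continuous.continuousOn.smul (hf.continuousOn _)
    have i1 := c1.integrableOn_Icc.mono_set Ioo_subset_Icc_self (μ := volume)
    have i2 := c2.integrableOn_Icc.mono_set Ioo_subset_Icc_self (μ := volume)
    have hout : ∀ t, t ∉ Ioo 0 T → φ t = 0 := fun t ht =>
      image_eq_zero_of_notMem_tsupport fun h => ht (hs h)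
    have := intervalIntegral.integral_eq_sub_of_hasDerivAt_of_le hT hcont
      (f' := fun t => φ t • f (j + k + 1) t + deriv φ t • f (j + k) t)
      (fun t ht => by
        have d1 : HasDerivAt φ (deriv φ t) t :=
          ((hφ.differentiable (by simp)) t).hasDerivAt
        exact d1.smul ((hf (j + k) t (Ioo_subset_Icc_self ht)).hasDerivAt
          (Icc_mem_nhds ht.1 ht.2)))
      ((intervalIntegrable_iff_integrableOn_Icc_of_le hT).2 (c2.add c1).integrableOn_Icc)
    rw [intervalIntegral.integral_of_le hT, integral_Ioc_eq_integral_Ioo,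
      hout 0 (by simp), hout T (by simp), zero_smul, zero_smul, sub_zero] at this
    rw [add_comm]
    exact (integral_add i2 i1).symm.trans this

/-- The `L^∞`-norm of the weak derivative bounds the classical derivative. -/
theorem norm_le_timeDerivNorm [CompleteSpace X] (hf : IsDerivChain T f) (hT : 0 < T) (k : ℕ)
    {t : ℝ} (ht : t ∈ Icc 0 T) : ‖f k t‖ ≤ timeDerivNorm T k (f 0) := by
  have hw : HasWeakTimeDeriv T k (f 0) (f k) := by simpa using hf.hasWeakTimeDeriv hT.le k 0
  have hmem : MemLp (f k) ⊤ (volume.restrict (Ioo 0 T)) := by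
    obtain ⟨C, hC⟩ := isCompact_Icc.exists_bound_of_continuousOn (hf.continuousOn k)
    refine memLp_top_of_bound
      (((hf.continuousOn k).mono Ioo_subset_Icc_self).aestronglyMeasurable measurableSet_Ioo) C ?_
    exact ae_restrict_of_forall_mem measurableSet_Ioo fun s hs => hC s (Ioo_subset_Icc_self hs)
  have hb : HasBoundedTimeDeriv T k (f 0) := ⟨f k, hmem, hw⟩
  have hdef : weakTimeDeriv T k (f 0) = hb.choose := by
    unfold weakTimeDeriv
    rw [dif_pos hb]
  obtain ⟨hg1, hg2⟩ := hb.choose_spec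
  set g := hb.choose
  have hfin : IsFiniteMeasure (volume.restrict (Ioo (0 : ℝ) T)) := inferInstance
  have if1 : IntegrableOn (f k) (Ioo 0 T) volume := hmem.integrable le_top
  have ig1 : IntegrableOn g (Ioo 0 T) volume := hg1.integrable le_top
  -- `weakTimeDeriv` is an arbitrary choice, so the fundamental lemma of the calculus of variations
  -- is needed to identify it with the classical derivative.
  have hae : f k =ᵐ[volume.restrict (Ioo 0 T)] g := by
    have h := isOpen_Ioo.ae_eq_zero_of_integral_contDiff_smul_eq_zero (μ := volume)
      (if1.sub ig1).locallyIntegrableOn (fun φ hφ hc hs => by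
        have h1 := hw φ hφ hc hs
        have h2 := hg2 φ hφ hc hs
        have h3 : ∫ t in Ioo 0 T, φ t • f k t = ∫ t in Ioo 0 T, φ t • g t :=
          smul_right_injective X (pow_ne_zero k (by norm_num : (-1 : ℝ) ≠ 0)) (h1.symm.trans h2)
        have hbd : ∃ C, ∀ t, ‖φ t‖ ≤ C := hc.exists_bound_of_continuous hφ.continuous
        obtain ⟨C, hC⟩ := hbd
        have j1 : Integrable (fun t => φ t • f k t) (volume.restrict (Ioo 0 T)) :=
          if1.bdd_smul C hφ.continuous.aestronglyMeasurable (ae_of_all _ hC)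
        have j2 : Integrable (fun t => φ t • g t) (volume.restrict (Ioo 0 T)) :=
          ig1.bdd_smul C hφ.continuous.aestronglyMeasurable (ae_of_all _ hC)
        rw [← setIntegral_eq_integral_of_forall_compl_eq_zero (s := Ioo 0 T)]
        · simp only [Pi.sub_apply, smul_sub]
          rw [integral_sub j1 j2, h3, sub_self]
        · intro t ht
          rw [image_eq_zero_of_notMem_tsupport fun h => ht (hs h), zero_smul])
    refine (ae_restrict_iff' measurableSet_Ioo).2 ?_
    filter_upwards [h] with s hs hs'
    exact sub_eq_zero.1 (hs hs')
  have hbound : ∀ᵐ s ∂(volume.restrict (Ioo 0 T)), ‖f k s‖ ≤ timeDerivNorm T k (f 0) := by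
    rw [timeDerivNorm, hdef]
    rw [eLpNorm_exponent_top]
    filter_upwards [hae, enorm_ae_le_eLpNormEssSup g (volume.restrict (Ioo 0 T))] with s h1 h2
    rw [h1, ← toReal_enorm]
    refine ENNReal.toReal_mono ?_ h2
    rw [← eLpNorm_exponent_top]
    exact hg1.2.ne
  have hbound' : ∀ᵐ s ∂(volume.restrict (Icc 0 T)), ‖f k s‖ ≤ timeDerivNorm T k (f 0) := by
    rwa [← Measure.restrict_congr_set Ioo_ae_eq_Icc]
  -- Continuity turns the bound almost everywhere into one at every point, endpoints included: two
  -- continuous functions that agree almost everywhere on the interval agree on it.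
  have heq : EqOn (fun s => min ‖f k s‖ (timeDerivNorm T k (f 0))) (fun s => ‖f k s‖) (Icc 0 T) :=
    Measure.eqOn_Icc_of_ae_eq volume hT.ne
      (by filter_upwards [hbound'] with s hs using min_eq_left hs)
      (ContinuousOn.inf (hf.continuousOn k).norm continuousOn_const) (hf.continuousOn k).norm
  have := heq ht
  exact min_eq_left_iff.1 this

end IsDerivChain

end Taylor

/-! ## Convergence of the scheme in a finite dimensional Hilbert space -/

section HilbertConvergence

variable {H : Type*} [NormedAddCommGroup H] [InnerProductSpace ℝ H] [FiniteDimensional ℝ H]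

local notation "⟪" x "," y "⟫" => inner ℝ x y

/-- The constant of the bound `1/P(y) - 1/y ≤ c`. -/
def accuracyConst (ν : ℝ) : ℝ := 16 + 1 / ν

/-- The constant of the error estimate in the mass-lumped norm; `β` bounds the inverse of the
stabilized operator and `τm` the time step. -/
def hilbertErrorConst (ν β τm : ℝ) : ℝ :=
  (1 + 1 / (2 * Real.sqrt (ν / 20))) *
    (Real.sqrt β * (1 + accuracyConst ν) + accuracyConst ν + τm * (1 + accuracyConst ν) / 2 +
      Real.sqrt (β * (1 / 4 + ν / 20) / (ν / 20)) * (2 * (1 + accuracyConst ν))) + accuracyConst ν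

/-- The abstract error estimate: the corrected error x + ZAx - U satisfies the W-form of the
leapfrog recursion with a residual of size τ², and the correction ZAx is itself O(τ²). -/
theorem hilbert_error_le (A Φ : Module.End ℝ H) (hA : A.IsSymmetric) (hΦ : Φ.IsSymmetric)
    (hΦ2 : ∀ x, Φ (Φ x) = Φ x) {p : ℕ} (hp : 1 ≤ p) {ν τ τm α Λ M T : ℝ} (hν0 : 0 < ν)
    (hν : ν ≤ 1 / 2) (hτ : 0 < τ) (hτm : τ ≤ τm) (hα : 0 < α) (hΛ : 0 < Λ)
    (hcoer : ∀ u, α * ‖u‖ ^ 2 ≤ ⟪A u, u⟫)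
    (hc : ∀ u, Φ u = 0 → ⟪A u, u⟫ ≤ Λ * ‖u‖ ^ 2)
    (hf : ∀ u, ⟪A u, u⟫ ≤ Λ * (p : ℝ) ^ 2 * ‖u‖ ^ 2)
    (hcfl : 4 * Λ * τ ^ 2 ≤ ν / (1 + ν))
    {x U : ℕ → H} {N : ℕ} (hN : N * τ ≤ T) (hM : 0 ≤ M)
    (hx : ∀ n, n + 2 ≤ N →
      ‖x (n + 2) - (2 : ℝ) • x (n + 1) + x n + τ ^ 2 • A (x (n + 1))‖ ≤ 2 * M * τ ^ 4)
    (hAx : ∀ n, n + 2 ≤ N →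
      ‖A (x (n + 2) - (2 : ℝ) • x (n + 1) + x n)‖ ≤ 2 * M * τ ^ 2)
    (hAx0 : ∀ n, n ≤ N → ‖A (x n)‖ ≤ M) (hAx1 : ‖A (x 1 - x 0)‖ ≤ M * τ)
    (h0 : x 0 = U 0) (h1 : ‖x 1 - U 1‖ ≤ M * τ ^ 3)
    (hU : ∀ n, n + 2 ≤ N → U (n + 2) - (2 : ℝ) • U (n + 1) + U n =
      -τ ^ 2 • A (Polynomial.aeval (Φ * A) (stabChebRed p ν τ) (U (n + 1))))
    (n : ℕ) (hn : n + 1 ≤ N) :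
    ‖x (n + 1) - U (n + 1)‖ ≤
      hilbertErrorConst ν (1 / α + accuracyConst ν * τm ^ 2) τm * (τ ^ 2 * (1 + T) * M) := by
  have hp' : (0 : ℝ) < p := by exact_mod_cast hp
  have hcν : 0 < accuracyConst ν := by unfold accuracyConst; positivity
  set c := accuracyConst ν with hc'
  set κ : ℝ := 1 / 4 + ν / 20 with hκ
  have hτ2 : 0 < τ ^ 2 := by positivity
  have hη0 : 0 < ν / (8 * (1 + ν)) := by positivity
  have hη1 : ν / (8 * (1 + ν)) < 1 := by
    rw [div_lt_one (by positivity)]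
    linarith
  have hΛτ : Λ * τ ^ 2 ≤ ν / (4 * (1 + ν)) := by
    have : ν / (4 * (1 + ν)) = ν / (1 + ν) / 4 := by
      field_simp
    linarith
  -- The weight η = ν/(8(1 + ν)) is half of the CFL bound on Λτ². As κ ≤ 1/2, this is what the
  -- coarse modes require, and it is small enough for the fine ones by `stabCheb_bounds`.
  obtain ⟨Z, W, hWs, hZ, hWA, hWR, hWb⟩ := exists_inverse_operator A Φ hA hΦ hΦ2
    (stabChebRed p ν τ) (eval_zero_stabChebRed hp hν0.le τ) (α := α) (s := c * τ ^ 2)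
    (η := ν / (8 * (1 + ν))) (κ := κ * τ ^ 2) (Λc := Λ) (Λf := Λ * (p : ℝ) ^ 2) hα (by positivity)
    hη0 hη1 hΛ (by positivity) hcoer hc hf
    (by
      intro μ hμ0 hμ
      have hy0 : 0 < τ ^ 2 * μ := by positivity
      have hy : τ ^ 2 * μ ≤ (p : ℝ) ^ 2 * (ν / (4 * (1 + ν))) := by
        have := mul_le_mul_of_nonneg_left hμ hτ2.le
        have := mul_le_mul_of_nonneg_left hΛτ (sq_nonneg (p : ℝ))
        linarith
      obtain ⟨b1, b2, b3, b4⟩ := stabCheb_bounds hp hν0 hν hy0 hy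
      rw [eval_stabChebRed p ν hν0.le τ μ hy0.ne']
      set y := τ ^ 2 * μ with hy'
      set P := (stabCheb p ν).eval y
      have e1 : (1 / (P / y) - 1) / μ = τ ^ 2 * (1 / P - 1 / y) := by
        rw [hy']
        field_simp
      have e2 : (1 / (P / y) - ν / (8 * (1 + ν))) / μ =
          τ ^ 2 * (1 / P - ν / (8 * (1 + ν)) / y) := by
        rw [hy']
        field_simp
      rw [e1, e2]
      refine ⟨by positivity, ?_, ?_, ?_⟩
      · exact mul_nonneg hτ2.le (sub_nonneg.2 (one_div_le_one_div_of_le b1 b2))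
      · rw [mul_comm c]
        exact mul_le_mul_of_nonneg_left b3 hτ2.le
      · rw [mul_comm κ]
        exact mul_le_mul_of_nonneg_left b4 hτ2.le)
    (by
      rw [le_div_iff₀ hΛ]
      have h2 : κ ≤ 1 / 2 := by rw [hκ]; linarith
      have h3 : κ * (Λ * τ ^ 2) ≤ 1 / 2 * (ν / (4 * (1 + ν))) :=
        mul_le_mul h2 hΛτ (by positivity) (by norm_num)
      have h4 : 1 / 2 * (ν / (4 * (1 + ν))) = ν / (8 * (1 + ν)) := by field_simp; norm_num
      linarith)
  set β := 1 / α + c * τm ^ 2 with hβ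
  have hβ0 : 0 ≤ β := by positivity
  have hττ : c * τ ^ 2 ≤ c * τm ^ 2 :=
    mul_le_mul_of_nonneg_left (pow_le_pow_left₀ hτ.le hτm 2) hcν.le
  have hWA' : ∀ v, W (A v) = v + Z (A v) := fun v => by
    simpa using LinearMap.congr_fun hWA v
  have hWR' : ∀ v, W (A (Polynomial.aeval (Φ * A) (stabChebRed p ν τ) v)) = v := fun v => by
    simpa using LinearMap.congr_fun hWR v
  -- The correction ZAx makes τ²(x + ZAx) equal to τ²WAx, so that W factors out of the whole
  -- residual and `leapfrog_stability` sees W r with r = O(τ²).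
  set e : ℕ → H := fun n => x n + Z (A (x n)) - U n with he
  set r : ℕ → H := fun n => (τ ^ 2)⁻¹ •
    ((x (n + 1) - (2 : ℝ) • x n + x (n - 1) + τ ^ 2 • A (x n)) +
      Z (A (x (n + 1) - (2 : ℝ) • x n + x (n - 1)))) with hr
  have hrec : ∀ n, n + 2 ≤ N →
      W (e (n + 2) - (2 : ℝ) • e (n + 1) + e n) + τ ^ 2 • e (n + 1) = τ ^ 2 • W (r (n + 1)) := by
    intro n hn
    have e1 : e (n + 2) - (2 : ℝ) • e (n + 1) + e n =
        (x (n + 2) - (2 : ℝ) • x (n + 1) + x n) + Z (A (x (n + 2) - (2 : ℝ) • x (n + 1) + x n)) -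
          (U (n + 2) - (2 : ℝ) • U (n + 1) + U n) := by
      simp only [he, map_sub, map_add, map_smul]
      module
    have e2 : τ ^ 2 • W (r (n + 1)) =
        W ((x (n + 2) - (2 : ℝ) • x (n + 1) + x n + τ ^ 2 • A (x (n + 1))) +
          Z (A (x (n + 2) - (2 : ℝ) • x (n + 1) + x n))) := by
      simp only [hr, add_tsub_cancel_right]
      rw [map_smul, smul_smul, mul_inv_cancel₀ hτ2.ne', one_smul]
    rw [e1, e2, hU n hn, map_sub, map_smul, hWR', map_add W _ (Z _), map_add W _ (Z _),
      map_add W _ (τ ^ 2 • _), map_smul W (τ ^ 2) _, hWA']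
    simp only [he]
    module
  have hr' : ∀ n, n + 2 ≤ N → ‖r (n + 1)‖ ≤ 2 * (1 + c) * τ ^ 2 * M := by
    intro n hn
    simp only [hr, add_tsub_cancel_right]
    rw [norm_smul, norm_inv, Real.norm_of_nonneg hτ2.le, inv_mul_le_iff₀ hτ2]
    refine (norm_add_le _ _).trans ?_
    have a1 := hx n hn
    have a2 := (hZ _).trans (mul_le_mul_of_nonneg_left (hAx n hn)
      (by positivity : 0 ≤ c * τ ^ 2))
    refine (add_le_add a1 a2).trans (le_of_eq ?_)
    ring
  have he0 : ‖e 0‖ ≤ c * τ ^ 2 * M := by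
    have : e 0 = Z (A (x 0)) := by
      simp only [he, h0]
      abel
    rw [this]
    exact (hZ _).trans (mul_le_mul_of_nonneg_left (hAx0 0 (by omega)) (by positivity))
  have he1 : ‖e 1 - e 0‖ ≤ τ * ((1 + c) * τ ^ 2 * M) := by
    have : e 1 - e 0 = (x 1 - U 1) + Z (A (x 1 - x 0)) := by
      simp only [he, h0, map_sub]
      abel
    rw [this]
    refine (norm_add_le _ _).trans ((add_le_add h1 ((hZ _).trans
      (mul_le_mul_of_nonneg_left hAx1 (by positivity : 0 ≤ c * τ ^ 2)))).trans (le_of_eq ?_))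
    ring
  have hmain := leapfrog_stability hWs (κ := κ) (w := β) (τ := τ)
    (by rw [hκ]; linarith) hβ0 hτ (fun v => (hWb v).1)
    (fun v => (hWb v).2.trans (mul_le_mul_of_nonneg_right (by rw [hβ]; linarith) (sq_nonneg _)))
    hrec hr' he0 he1 n hn
  have hκν : κ - 1 / 4 = ν / 20 := by rw [hκ]; ring
  rw [hκν] at hmain
  have hsplit : x (n + 1) - U (n + 1) = e (n + 1) - Z (A (x (n + 1))) := by
    simp only [he]
    abel
  rw [hsplit]
  refine (norm_sub_le _ _).trans ?_
  have hZn : ‖Z (A (x (n + 1)))‖ ≤ c * τ ^ 2 * M :=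
    (hZ _).trans (mul_le_mul_of_nonneg_left (hAx0 _ hn) (by positivity))
  have hT : n * τ ≤ T := by
    refine le_trans ?_ hN
    have : (n : ℝ) ≤ N := by exact_mod_cast (by omega : n ≤ N)
    exact mul_le_mul_of_nonneg_right this hτ.le
  have hT0 : 0 ≤ T := le_trans (by positivity) hT
  refine (add_le_add hmain hZn).trans ?_
  unfold hilbertErrorConst
  rw [← hc', ← hκ]
  set K := 1 + 1 / (2 * Real.sqrt (ν / 20)) with hK
  have hK0 : 0 ≤ K := by positivity
  set B := Real.sqrt β
  have hB : 0 ≤ B := Real.sqrt_nonneg _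
  set B' := Real.sqrt (β * κ / (ν / 20))
  have hB' : 0 ≤ B' := Real.sqrt_nonneg _
  have hτm0 : 0 ≤ τm := hτ.le.trans hτm
  have q1 : 0 ≤ τ ^ 2 * M := by positivity
  have t1 : B * ((1 + c) * τ ^ 2 * M) ≤ B * (1 + c) * (τ ^ 2 * (1 + T) * M) := by
    have : 0 ≤ B * (1 + c) * (τ ^ 2 * M) * T := by positivity
    linarith
  have t2 : c * τ ^ 2 * M ≤ c * (τ ^ 2 * (1 + T) * M) := by
    have : 0 ≤ c * (τ ^ 2 * M) * T := by positivity
    linarith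
  have t3 : τ * ((1 + c) * τ ^ 2 * M) / 2 ≤ τm * (1 + c) / 2 * (τ ^ 2 * (1 + T) * M) := by
    have h2 : 0 ≤ (1 + c) * (τ ^ 2 * M) := by positivity
    have h3 := mul_le_mul_of_nonneg_right hτm h2
    have h4 : 0 ≤ τm * (1 + c) * (τ ^ 2 * M) * T := by positivity
    linarith
  have t4 : n * τ * (B' * (2 * (1 + c) * τ ^ 2 * M)) ≤
      B' * (2 * (1 + c)) * (τ ^ 2 * (1 + T) * M) := by
    have h2 : 0 ≤ B' * (2 * (1 + c)) * (τ ^ 2 * M) := by positivity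
    have h3 := mul_le_mul_of_nonneg_right (show n * τ ≤ 1 + T by linarith) h2
    linarith
  have h5 := mul_le_mul_of_nonneg_left (add_le_add (add_le_add (add_le_add t1 t2) t3) t4) hK0
  refine (add_le_add h5 t2).trans (le_of_eq ?_)
  ring

end HilbertConvergence

/-! ## The semi-discrete solution -/

section Semidiscrete

variable {ι S X : Type*} [Fintype ι] [AddCommGroup S] [Module ℝ S]
  [NormedAddCommGroup X] [NormedSpace ℝ X]

/-- S carries no topology here; time derivatives are taken in X. Transporting A to a bounded
operator on X lets it commute with them. -/
theorem exists_continuousLinearMap_comp_eq [FiniteDimensional ℝ S] {J : S →ₗ[ℝ] X}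
    (hJ : Function.Injective J) (A : Module.End ℝ S) : ∃ L : X →L[ℝ] X, ∀ u, L (J u) = J (A u) := by
  let e := LinearEquiv.ofInjective J hJ
  have : FiniteDimensional ℝ (LinearMap.range J) := e.finiteDimensional
  obtain ⟨g, hg⟩ := ContinuousLinearMap.exist_extension_of_finiteDimensional_range
    (LinearMap.toContinuousLinearMap (J ∘ₗ A ∘ₗ e.symm.toLinearMap))
  refine ⟨g, fun u => ?_⟩
  have := DFunLike.congr_fun hg (e u)
  simpa [e] using this.symm

/-- The successive time derivatives of a solution of the semi-discrete equation with `u̇ = v`. -/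
def derivSeq (A : Module.End ℝ S) (u v : ℝ → S) : ℕ → ℝ → S
  | 0 => u
  | 1 => v
  | k + 2 => fun t => -A (derivSeq A u v k t)

theorem lumped_ext {b : Module.Basis ι ℝ S} {D : ι → ℝ} (hD : ∀ z, 0 < D z) {u v : S}
    (h : ∀ w, lumped b D u w = lumped b D v w) : u = v := by
  classical
  refine b.ext_elem fun z => ?_
  have := h (b z)
  simp only [lumped, Module.Basis.repr_self, Finsupp.single_apply, mul_ite, mul_one, mul_zero,
    Finset.sum_ite_eq, Finset.mem_univ, if_true] at this
  exact mul_left_cancel₀ (hD z).ne' this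

theorem lumped_add_left (b : Module.Basis ι ℝ S) (D : ι → ℝ) (u v w : S) :
    lumped b D (u + v) w = lumped b D u w + lumped b D v w := by
  simp only [lumped, map_add, Finsupp.add_apply, ← Finset.sum_add_distrib]
  exact Finset.sum_congr rfl fun _ _ => by ring

theorem lumped_smul_left (b : Module.Basis ι ℝ S) (D : ι → ℝ) (c : ℝ) (u w : S) :
    lumped b D (c • u) w = c * lumped b D u w := by
  simp only [lumped, map_smul, Finsupp.smul_apply, smul_eq_mul, Finset.mul_sum]
  exact Finset.sum_congr rfl fun _ _ => by ring

theorem lumped_comm (b : Module.Basis ι ℝ S) (D : ι → ℝ) (u v : S) :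
    lumped b D u v = lumped b D v u :=
  Finset.sum_congr rfl fun _ _ => by ring

theorem lumped_self_nonneg (b : Module.Basis ι ℝ S) {D : ι → ℝ} (hD : ∀ z, 0 < D z) (u : S) :
    0 ≤ lumped b D u u :=
  Finset.sum_nonneg fun z _ => by
    rw [mul_assoc]
    exact mul_nonneg (hD z).le (mul_self_nonneg _)

theorem eq_zero_of_lumped_self_eq_zero (b : Module.Basis ι ℝ S) {D : ι → ℝ} (hD : ∀ z, 0 < D z)
    {u : S} (h : lumped b D u u = 0) : u = 0 := by
  refine b.ext_elem fun z => ?_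
  have h1 := (Finset.sum_eq_zero_iff_of_nonneg (fun z _ => by
    rw [mul_assoc]
    exact mul_nonneg (hD z).le (mul_self_nonneg _))).1 h z (Finset.mem_univ z)
  rw [mul_assoc, mul_eq_zero, mul_self_eq_zero] at h1
  simpa using h1.resolve_left (hD z).ne'

/-- The equation is a linear ODE ü = -Au in finite dimension, so every further pair of derivatives
costs one more factor -A and the solution is smooth up to the endpoints of [0,T]. -/
theorem IsSemidiscreteSolution.exists_isDerivChain {J : S →ₗ[ℝ] X} (hJ : Function.Injective J)
    {b : Module.Basis ι ℝ S} {D : ι → ℝ} (hD : ∀ z, 0 < D z) {a : LinearMap.BilinForm ℝ S}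
    {T : ℝ} (hT : 0 < T) {u₀ v₀ : S} {u : ℝ → S}
    (h : IsSemidiscreteSolution J b D a T u₀ v₀ u) :
    ∃ v : ℝ → S, v 0 = v₀ ∧
      IsDerivChain T fun k t => J (derivSeq (discreteOp b D a) u v k t) := by
  have : FiniteDimensional ℝ S := Module.Finite.of_basis b
  obtain ⟨v, hv, hvc, hz, -, hv0⟩ := h
  set A := discreteOp b D a
  obtain ⟨L, hL⟩ := exists_continuousLinearMap_comp_eq hJ A
  refine ⟨v, hv0, ?_⟩
  have hderiv : ∀ t ∈ Ioo 0 T, HasDerivAt (fun s => J (v s)) (J (-A (u t))) t := by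
    intro t ht
    obtain ⟨z, hz1, hz2⟩ := hz t ht
    have : z = -A (u t) := by
      refine lumped_ext (b := b) hD fun w => ?_
      have h1 := hz2 w
      rw [← lumped_discreteOp b D hD a] at h1
      rw [← neg_one_smul ℝ, lumped_smul_left]
      linarith
    rwa [← this]
  have hcont : ContinuousOn (fun t => J (-A (u t))) (Icc 0 T) := by
    have h1 : ContinuousOn (fun t => -L (J (u t))) (Icc 0 T) :=
      (L.continuous.comp_continuousOn fun t ht => (hv t ht).continuousWithinAt).neg
    refine h1.congr fun t _ => ?_
    simp only [map_neg, hL]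
  have hdiff : DifferentiableOn ℝ (fun s => J (v s)) (Ioo 0 T) := fun t ht =>
    (hderiv t ht).differentiableAt.differentiableWithinAt
  intro k
  induction k using Nat.twoStepInduction with
  | zero => exact hv
  | one =>
    intro t ht
    change HasDerivWithinAt (fun s => J (v s)) (J (-A (u t))) (Icc 0 T) t
    -- The equation is assumed only inside (0,T); at an endpoint the one-sided derivative exists
    -- because v is continuous there and its derivative has a limit.
    rcases ht.1.eq_or_lt with h0 | h0
    · subst h0
      refine (hasDerivWithinAt_Ici_of_tendsto_deriv hdiff
        ((hvc 0 ht).mono Ioo_subset_Icc_self) (Ioo_mem_nhdsGT hT) ?_).mono Icc_subset_Ici_self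
      have h1 := ((hcont 0 ht).mono Ioo_subset_Icc_self).tendsto
      rw [nhdsWithin_Ioo_eq_nhdsGT hT] at h1
      refine h1.congr' ?_
      filter_upwards [Ioo_mem_nhdsGT hT] with s hs using (hderiv s hs).deriv.symm
    · rcases ht.2.eq_or_lt with hT' | hT'
      · subst hT'
        refine (hasDerivWithinAt_Iic_of_tendsto_deriv hdiff
          ((hvc t ht).mono Ioo_subset_Icc_self) (Ioo_mem_nhdsLT hT) ?_).mono Icc_subset_Iic_self
        have h1 := ((hcont t ht).mono Ioo_subset_Icc_self).tendsto
        rw [nhdsWithin_Ioo_eq_nhdsLT hT] at h1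
        refine h1.congr' ?_
        filter_upwards [Ioo_mem_nhdsLT hT] with s hs using (hderiv s hs).deriv.symm
      · exact (hderiv t ⟨h0, hT'⟩).hasDerivWithinAt
  | more k ih _ =>
    intro t ht
    have h1 := (L.hasFDerivAt.comp_hasDerivWithinAt t (ih t ht)).neg
    have h2 : ∀ j s, J (derivSeq A u v (j + 2) s) = -L (J (derivSeq A u v j s)) := by
      intro j s
      rw [hL, ← map_neg]
      rfl
    simp only [add_right_comm k 2 1, h2]
    exact h1

end Semidiscrete

/-! ## Convergence in the mass-lumped setting -/

section Convergence

variable {ι S X : Type*} [Fintype ι] [AddCommGroup S] [Module ℝ S]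
  [NormedAddCommGroup X] [NormedSpace ℝ X]

/-- The mass-lumped scalar product as an inner product. -/
abbrev lumpedCore (b : Module.Basis ι ℝ S) {D : ι → ℝ} (hD : ∀ z, 0 < D z) :
    InnerProductSpace.Core ℝ S where
  inner u v := lumped b D u v
  conj_inner_symm u v := by simpa using lumped_comm b D v u
  re_inner_nonneg u := by simpa using lumped_self_nonneg b hD u
  add_left := lumped_add_left b D
  smul_left u v c := by simpa using lumped_smul_left b D c u v
  definite u := eq_zero_of_lumped_self_eq_zero b hD

open Classical in
theorem repr_nodeProj (b : Module.Basis ι ℝ S) (F : Set ι) (u : S) (z : ι) :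
    b.repr (nodeProj b F u) z = if z ∈ F then b.repr u z else 0 := by
  have : (Finsupp.lapply z) ∘ₗ b.repr.toLinearMap ∘ₗ nodeProj b F =
      if z ∈ F then (Finsupp.lapply z) ∘ₗ b.repr.toLinearMap else 0 := by
    refine b.ext fun y => ?_
    by_cases hz : z ∈ F <;> by_cases hy : y ∈ F <;> by_cases hyz : y = z <;>
      simp_all [nodeProj]
  have h := LinearMap.congr_fun this u
  by_cases hz : z ∈ F <;> simpa [hz] using h

/-- The constant of the error estimate, where `α` is the coercivity constant with respect to the
mass-lumped norm and `τm` a bound on the time step. -/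
def errorConst (ν α τm Ceq : ℝ) : ℝ :=
  Ceq * (hilbertErrorConst ν (1 / α + accuracyConst ν * τm ^ 2) τm * Ceq)

/-- S with the mass-lumped product is a Hilbert space in which A and the nodal projection are
symmetric. Norm equivalence enters twice: for the time derivatives of the solution and for the final
error. -/
theorem lts_error_le [CompleteSpace X] {J : S →ₗ[ℝ] X} {b : Module.Basis ι ℝ S} {D : ι → ℝ}
    (hD : ∀ z, 0 < D z) {F : Set ι} {a : LinearMap.BilinForm ℝ S} (ha : ∀ u v, a u v = a v u)
    {Ceq : ℝ} (hCeq : 0 < Ceq)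
    (heq : ∀ u, Ceq⁻¹ * lumpedNorm b D u ≤ ‖J u‖ ∧ ‖J u‖ ≤ Ceq * lumpedNorm b D u)
    {p : ℕ} (hp : 1 ≤ p) {ν τ τm α Λ M T : ℝ} (hν0 : 0 < ν)
    (hν : ν ≤ 1 / 2) (hτ : 0 < τ) (hτm : τ ≤ τm) (hα : 0 < α) (hΛ : 0 < Λ)
    (hcoer : ∀ u, α * lumped b D u u ≤ a u u)
    (hc : ∀ u, (∀ z ∈ F, b.repr u z = 0) → a u u ≤ Λ * lumped b D u u)
    (hf : ∀ u, a u u ≤ Λ * (p : ℝ) ^ 2 * lumped b D u u)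
    (hcfl : 4 * Λ * τ ^ 2 ≤ ν / (1 + ν))
    {N : ℕ} (hT : 0 < T) (hN : N * τ = T) {u₀ v₀ : S} {u : ℝ → S}
    (hu : IsSemidiscreteSolution J b D a T u₀ v₀ u)
    (hM : ∀ l ∈ Finset.Icc 2 5, timeDerivNorm T l (fun t => J (u t)) ≤ M)
    {U : ℕ → S} (hU : IsLTSSolution b D F a p ν τ u₀ v₀ U) (n : ℕ) (hn : n + 1 ≤ N) :
    ‖J (u ((n + 1 : ℕ) * τ) - U (n + 1))‖ ≤ errorConst ν α τm Ceq * τ ^ 2 * (1 + T) * M := by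
  let core := lumpedCore b hD
  let : NormedAddCommGroup S := core.toNormedAddCommGroup
  let : InnerProductSpace ℝ S := InnerProductSpace.ofCore core.toCore
  have : FiniteDimensional ℝ S := Module.Finite.of_basis b
  have hinner : ∀ u v : S, inner ℝ u v = lumped b D u v := fun _ _ => rfl
  have hnsq : ∀ u : S, ‖u‖ ^ 2 = lumped b D u u := fun u => by
    rw [← real_inner_self_eq_norm_sq, hinner]
  have hnorm : ∀ u : S, lumpedNorm b D u = ‖u‖ := fun u => by
    rw [lumpedNorm, ← hnsq, Real.sqrt_sq (norm_nonneg _)]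
  have hJle : ∀ u : S, ‖J u‖ ≤ Ceq * ‖u‖ := fun u => hnorm u ▸ (heq u).2
  have hleJ : ∀ u : S, ‖u‖ ≤ Ceq * ‖J u‖ := fun u => by
    have := (heq u).1
    rwa [hnorm, inv_mul_le_iff₀ hCeq] at this
  have hJ : Function.Injective J := by
    rw [← LinearMap.ker_eq_bot, LinearMap.ker_eq_bot']
    intro x hx
    have := hleJ x
    rw [hx, norm_zero, mul_zero] at this
    exact norm_le_zero_iff.1 this
  set A := discreteOp b D a with hAdef
  have hAin : ∀ u v : S, inner ℝ (A u) v = a u v := fun u v => by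
    rw [hinner, lumped_discreteOp b D hD]
  have hu0 : u 0 = u₀ := by
    obtain ⟨_, _, _, _, h, _⟩ := hu
    exact h
  obtain ⟨v, hv0, hchain⟩ := hu.exists_isDerivChain hJ hD hT
  set w := derivSeq A u v with hw
  have hw2 : ∀ t, w 2 t = -A (u t) := fun t => rfl
  have hbound : ∀ l ∈ Finset.Icc 2 5, ∀ t ∈ Icc 0 T, ‖J (w l t)‖ ≤ M := fun l hl t ht =>
    (hchain.norm_le_timeDerivNorm hT l ht).trans (hM l hl)
  have hM0 : 0 ≤ M := (norm_nonneg _).trans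
    (hbound 2 (by decide) 0 (left_mem_Icc.2 hT.le))
  have htime : ∀ k : ℕ, k ≤ N → (k : ℝ) * τ ∈ Icc 0 T := by
    intro k hk
    refine ⟨by positivity, ?_⟩
    rw [← hN]
    exact mul_le_mul_of_nonneg_right (by exact_mod_cast hk) hτ.le
  have e1 : ∀ k : ℕ, ((k + 2 : ℕ) : ℝ) * τ = ((k + 1 : ℕ) : ℝ) * τ + τ := fun k => by
    push_cast; ring
  have e0 : ∀ k : ℕ, (k : ℝ) * τ = ((k + 1 : ℕ) : ℝ) * τ - τ := fun k => by
    push_cast; ring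
  have hk1 : ∀ k : ℕ, τ ≤ ((k + 1 : ℕ) : ℝ) * τ := fun k => by
    have : (0 : ℝ) ≤ k * τ := by positivity
    push_cast
    linarith
  have hk2 : ∀ k : ℕ, k + 2 ≤ N → ((k + 1 : ℕ) : ℝ) * τ + τ ≤ T := fun k hk => by
    rw [← e1]
    exact (htime _ hk).2
  -- Every occurrence of A on the solution below becomes a second time derivative through this
  -- identity.
  have hAw : ∀ t, A (u t) = -w 2 t := fun t => by rw [hw2, neg_neg]
  have hτT : τ ≤ T := by simpa using (htime 1 (by omega)).2
  have hmain := hilbert_error_le A (nodeProj b F)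
    (fun x y => by rw [hAin, ha, ← hAin, real_inner_comm])
    (fun x y => by
      rw [hinner, hinner]
      refine Finset.sum_congr rfl fun z _ => ?_
      rw [repr_nodeProj, repr_nodeProj]
      split_ifs <;> ring)
    (fun x => b.ext_elem fun z => by
      rw [repr_nodeProj, repr_nodeProj]
      split_ifs <;> rfl)
    hp hν0 hν hτ hτm hα hΛ
    (fun x => by rw [hnsq, hAin]; exact hcoer x)
    (fun x hx => by
      rw [hnsq, hAin]
      refine hc x fun z hz => ?_
      have := repr_nodeProj b F x z
      rw [hx, if_pos hz] at this
      simpa using this.symm)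
    (fun x => by rw [hnsq, hAin]; exact hf x)
    hcfl (x := fun k => u (k * τ)) (U := U) (M := Ceq * M) hN.le (by positivity)
    (fun k hk => by
      refine (hleJ _).trans ?_
      have h1 := hchain.norm_second_difference_sub_le hτ.le (hk1 k) (hk2 k hk)
        (hbound 4 (by decide))
      rw [← e1, ← e0] at h1
      have h2 := mul_le_mul_of_nonneg_left h1 hCeq.le
      have h3 : J (u ((k + 2 : ℕ) * τ) - (2 : ℝ) • u ((k + 1 : ℕ) * τ) + u (k * τ) +
          τ ^ 2 • A (u ((k + 1 : ℕ) * τ))) =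
          J (w 0 ((k + 2 : ℕ) * τ)) - (2 : ℝ) • J (w 0 ((k + 1 : ℕ) * τ)) + J (w 0 (k * τ)) -
            τ ^ 2 • J (w 2 ((k + 1 : ℕ) * τ)) := by
        rw [hAw]
        simp only [map_add, map_sub, map_smul, smul_neg, ← sub_eq_add_neg]
        rfl
      rw [h3]
      refine h2.trans (le_of_eq ?_)
      ring)
    (fun k hk => by
      refine (hleJ _).trans ?_
      have h1 := (hchain.shift 2).norm_second_difference_le hτ.le (hk1 k) (hk2 k hk)
        (hbound 4 (by decide))
      rw [← e1, ← e0] at h1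
      have h2 := mul_le_mul_of_nonneg_left h1 hCeq.le
      have h3 : J (A (u ((k + 2 : ℕ) * τ) - (2 : ℝ) • u ((k + 1 : ℕ) * τ) + u (k * τ))) =
          -(J (w 2 ((k + 2 : ℕ) * τ)) - (2 : ℝ) • J (w 2 ((k + 1 : ℕ) * τ)) +
            J (w 2 (k * τ))) := by
        simp only [map_add, map_sub, map_smul, hAw, map_neg]
        module
      rw [h3, norm_neg]
      refine h2.trans (le_of_eq ?_)
      ring)
    (fun k hk => by
      refine (hleJ _).trans (mul_le_mul_of_nonneg_left ?_ hCeq.le)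
      rw [hAw, map_neg, norm_neg]
      exact hbound 2 (by decide) _ (htime k hk))
    (by
      refine (hleJ _).trans ?_
      have h1 := (hchain.shift 2).norm_sub_le hτ.le hτT (hbound 3 (by decide))
      have h3 : J (A (u ((1 : ℕ) * τ) - u ((0 : ℕ) * τ))) = -(J (w 2 τ) - J (w 2 0)) := by
        rw [Nat.cast_one, Nat.cast_zero, one_mul, zero_mul, map_sub, hAw, hAw]
        simp only [map_sub, map_neg]
        abel
      rw [h3, norm_neg, mul_assoc]
      exact mul_le_mul_of_nonneg_left h1 hCeq.le)
    (by rw [Nat.cast_zero, zero_mul, hU.init_zero, hu0])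
    (by
      refine (hleJ _).trans ?_
      have h1 := hchain.norm_taylor_le hτ.le hτT (hbound 3 (by decide))
      have h3 : J (u ((1 : ℕ) * τ) - U 1) = J (w 0 τ) - J (w 0 0) - τ • J (w 1 0) -
          (τ ^ 2 / 2) • J (w 2 0) := by
        rw [Nat.cast_one, one_mul, hU.init_one, hw2]
        change J (u τ - _) = J (u τ) - J (u 0) - τ • J (v 0) - (τ ^ 2 / 2) • J (-A (u 0))
        rw [hu0, hv0]
        simp only [map_add, map_sub, map_smul, map_neg]
        module
      rw [h3, mul_assoc]
      exact mul_le_mul_of_nonneg_left h1 hCeq.le)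
    (fun k hk => by
      refine lumped_ext (b := b) hD fun y => ?_
      have h1 := hU.step (k + 1) (by omega) y
      rw [add_tsub_cancel_right] at h1
      have h2 : U (k + 1) - Polynomial.aeval (nodeProj b F * A) (stabChebQ p ν τ) (U (k + 1)) =
          Polynomial.aeval (nodeProj b F * A) (stabChebRed p ν τ) (U (k + 1)) := by
        simp [stabChebQ]
      rw [h1, lumped_smul_left, lumped_discreteOp b D hD, stabForm, h2])
    n hn
  refine (hJle _).trans ((mul_le_mul_of_nonneg_left hmain hCeq.le).trans (le_of_eq ?_))
  unfold errorConst
  ring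

end Convergence

/-! ## Polynomials as functions on Euclidean space -/

section Polynomials

open MvPolynomial

variable {d : ℕ}

theorem evalPoly_add (q r : MvPolynomial (Fin d) ℝ) (x : E d) :
    evalPoly (q + r) x = evalPoly q x + evalPoly r x := map_add _ _ _

theorem evalPoly_smul (c : ℝ) (q : MvPolynomial (Fin d) ℝ) (x : E d) :
    evalPoly (c • q) x = c * evalPoly q x := by simp [evalPoly]

theorem evalPoly_mul (q r : MvPolynomial (Fin d) ℝ) (x : E d) :
    evalPoly (q * r) x = evalPoly q x * evalPoly r x := map_mul _ _ _

theorem evalPoly_C (c : ℝ) (x : E d) : evalPoly (C c : MvPolynomial (Fin d) ℝ) x = c :=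
  eval_C c

theorem evalPoly_X (j : Fin d) (x : E d) : evalPoly (X j : MvPolynomial (Fin d) ℝ) x = x j :=
  eval_X j

theorem evalPoly_zero (x : E d) : evalPoly (0 : MvPolynomial (Fin d) ℝ) x = 0 := map_zero _

theorem evalPoly_one (x : E d) : evalPoly (1 : MvPolynomial (Fin d) ℝ) x = 1 := map_one _

attribute [local irreducible] evalPoly in
theorem hasFDerivAt_evalPoly (q : MvPolynomial (Fin d) ℝ) (x : E d) :
    HasFDerivAt (evalPoly q)
      (∑ i, evalPoly (pderiv i q) x • (EuclideanSpace.proj i : E d →L[ℝ] ℝ)) x := by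
  induction q using MvPolynomial.induction_on with
  | C c =>
    have : (evalPoly (C c) : E d → ℝ) = fun _ => c := funext fun y => evalPoly_C c y
    rw [this]
    refine (hasFDerivAt_const c x).congr_fderiv ?_
    simp [evalPoly_zero]
  | add q r hq hr =>
    have : (evalPoly (q + r) : E d → ℝ) = evalPoly q + evalPoly r :=
      funext fun y => evalPoly_add q r y
    rw [this]
    refine (hq.add hr).congr_fderiv ?_
    simp only [map_add, evalPoly_add, add_smul, Finset.sum_add_distrib]
  | mul_X q j hq =>
    have : (evalPoly (q * X j) : E d → ℝ) = fun y => evalPoly q y * y j :=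
      funext fun y => by rw [evalPoly_mul, evalPoly_X]
    rw [this]
    have hj : HasFDerivAt (fun y : E d => y j) (EuclideanSpace.proj j : E d →L[ℝ] ℝ) x :=
      (EuclideanSpace.proj j : E d →L[ℝ] ℝ).hasFDerivAt
    refine (hq.mul hj).congr_fderiv ?_
    have hp : ∀ i, evalPoly (pderiv i (q * X j)) x =
        evalPoly (pderiv i q) x * x j + evalPoly q x * (if i = j then 1 else 0) := by
      intro i
      rw [pderiv_mul, evalPoly_add, evalPoly_mul, evalPoly_mul, pderiv_X, evalPoly_X]
      by_cases h : i = j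
      · subst h; simp [evalPoly_one]
      · simp [evalPoly_zero, h]
    simp only [hp, add_smul, Finset.sum_add_distrib, mul_ite, mul_one, mul_zero, ite_smul,
      zero_smul, Finset.sum_ite_eq', Finset.mem_univ, if_true, Finset.smul_sum, smul_smul]
    rw [add_comm]
    simp only [mul_comm]

theorem continuous_evalPoly (q : MvPolynomial (Fin d) ℝ) : Continuous (evalPoly q : E d → ℝ) :=
  continuous_iff_continuousAt.2 fun x => (hasFDerivAt_evalPoly q x).continuousAt

theorem fderiv_evalPoly (q : MvPolynomial (Fin d) ℝ) (x : E d) (i : Fin d) :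
    fderiv ℝ (evalPoly q) x (EuclideanSpace.single i 1) = evalPoly (pderiv i q) x := by
  rw [(hasFDerivAt_evalPoly q x).fderiv]
  simp

theorem totalDegree_aeval_le_of_le_one {σ τ : Type*} {f : σ → MvPolynomial τ ℝ}
    (hf : ∀ i, (f i).totalDegree ≤ 1) (q : MvPolynomial σ ℝ) :
    (aeval f q).totalDegree ≤ q.totalDegree := by
  rw [aeval_def, eval₂_eq]
  refine totalDegree_finsetSum_le fun s hs => ?_
  refine (totalDegree_mul _ _).trans ?_
  rw [algebraMap_eq, totalDegree_C, zero_add]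
  refine (totalDegree_finsetProd _ _).trans (le_trans ?_ (le_totalDegree hs))
  rw [Finsupp.sum]
  refine Finset.sum_le_sum fun i _ => (totalDegree_pow _ _).trans ?_
  simpa using Nat.mul_le_mul_left (s i) (hf i)

/-- Polynomials of bounded degree are stable under affine substitutions. -/
theorem exists_evalPoly_eq_comp {k : ℕ} {q : MvPolynomial (Fin d) ℝ}
    (hq : q ∈ restrictTotalDegree (Fin d) ℝ k) (c : E d) (B : E d →L[ℝ] E d) :
    ∃ r ∈ restrictTotalDegree (Fin d) ℝ k, ∀ x, evalPoly r x = evalPoly q (c + B x) := by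
  let f : Fin d → MvPolynomial (Fin d) ℝ := fun i =>
    C (c i) + ∑ j, C (B (EuclideanSpace.single j 1) i) * X j
  have hf : ∀ i, (f i).totalDegree ≤ 1 := by
    intro i
    refine (totalDegree_add _ _).trans (max_le (by simp) ?_)
    refine totalDegree_finsetSum_le fun j _ => ?_
    refine (totalDegree_mul _ _).trans ?_
    simp
  refine ⟨aeval f q, ?_, fun x => ?_⟩
  · rw [mem_restrictTotalDegree] at hq ⊢
    exact (totalDegree_aeval_le_of_le_one hf q).trans hq
  · have hx : ∀ i, eval (fun j => x j) (f i) = (c + B x) i := by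
      intro i
      have h1 : x = ∑ j, x j • EuclideanSpace.single j (1 : ℝ) := by
        ext j
        simp [Finset.sum_apply, Pi.single_apply]
      conv_rhs => rw [h1]
      simp [f, map_sum, mul_comm]
    unfold evalPoly
    rw [← coe_aeval_eq_eval, ← coe_aeval_eq_eval]
    have : ((aeval fun i => x i : MvPolynomial (Fin d) ℝ →ₐ[ℝ] ℝ).comp (aeval f)) =
        aeval fun i => (c + B x) i := by
      ext i
      simp only [AlgHom.comp_apply, aeval_X]
      rw [← hx i, ← coe_aeval_eq_eval]
      rfl
    exact DFunLike.congr_fun this q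

/-- The ball contains a product of infinite sets, which is a uniqueness set for polynomials. -/
theorem eq_zero_of_evalPoly_eq_zero_on_ball {q : MvPolynomial (Fin d) ℝ} {R : ℝ} (hR : 0 < R)
    (h : ∀ x ∈ Metric.ball (0 : E d) R, evalPoly q x = 0) : q = 0 := by
  have hopen : IsOpen ((WithLp.toLp 2 : (Fin d → ℝ) → E d) ⁻¹' Metric.ball 0 R) :=
    Metric.isOpen_ball.preimage (PiLp.continuous_toLp 2 _)
  obtain ⟨ε, hε, hsub⟩ := Metric.isOpen_iff.1 hopen 0 (by simpa using hR)
  refine funext_set (fun _ => Ioo (-ε) ε) (fun _ => Ioo_infinite (by linarith)) fun x hx => ?_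
  rw [map_zero]
  refine h (WithLp.toLp 2 x) (hsub ?_)
  rw [mem_ball_zero_iff, pi_norm_lt_iff hε]
  exact fun i => abs_lt.2 (hx i (mem_univ i))

theorem memLp_evalPoly (q : MvPolynomial (Fin d) ℝ) {K : Set (E d)} (hK : IsCompact K) :
    MemLp (evalPoly q) 2 (volume.restrict K) := by
  have : IsFiniteMeasure (volume.restrict K) := isFiniteMeasure_restrict.2 hK.measure_lt_top.ne
  obtain ⟨C, hC⟩ := hK.exists_bound_of_continuousOn (continuous_evalPoly q).continuousOn
  exact MemLp.of_bound (continuous_evalPoly q).aestronglyMeasurable C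
    (ae_restrict_of_forall_mem hK.measurableSet hC)

theorem integrableOn_evalPoly_sq (q : MvPolynomial (Fin d) ℝ) {K : Set (E d)} (hK : IsCompact K) :
    IntegrableOn (fun x => evalPoly q x ^ 2) K volume :=
  ((continuous_evalPoly q).pow 2).continuousOn.integrableOn_compact hK

theorem norm_sq_toLp_eq_integral {α : Type*} [MeasurableSpace α] {μ : Measure α} {f : α → ℝ}
    (hf : MemLp f 2 μ) : ‖hf.toLp f‖ ^ 2 = ∫ x, f x ^ 2 ∂μ := by
  rw [← real_inner_self_eq_norm_sq, L2.inner_def]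
  refine integral_congr_ae ?_
  filter_upwards [hf.coeFn_toLp] with x hx
  simp [hx, sq]

/-- Polynomials as elements of `L²(K)`. -/
def polyL2 {K : Set (E d)} (hK : IsCompact K) :
    MvPolynomial (Fin d) ℝ →ₗ[ℝ] Lp ℝ 2 (volume.restrict K) where
  toFun q := (memLp_evalPoly q hK).toLp _
  map_add' q r := by
    rw [← MemLp.toLp_add]
    exact MemLp.toLp_congr _ _ (ae_of_all _ fun x => evalPoly_add q r x)
  map_smul' c q := by
    rw [RingHom.id_apply, ← MemLp.toLp_const_smul]
    exact MemLp.toLp_congr _ _ (ae_of_all _ fun x => evalPoly_smul c q x)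

theorem norm_sq_polyL2 {K : Set (E d)} (hK : IsCompact K) (q : MvPolynomial (Fin d) ℝ) :
    ‖polyL2 hK q‖ ^ 2 = ∫ x in K, evalPoly q x ^ 2 :=
  norm_sq_toLp_eq_integral (memLp_evalPoly q hK)

/-- A linear map on a finite-dimensional space is bounded for the norm induced by any injective map.
-/
theorem exists_norm_le_mul_norm {V X Y : Type*} [AddCommGroup V] [Module ℝ V]
    [FiniteDimensional ℝ V] [NormedAddCommGroup X] [NormedSpace ℝ X] [NormedAddCommGroup Y]
    [NormedSpace ℝ Y] (F : V →ₗ[ℝ] X) (G : V →ₗ[ℝ] Y) (hG : Function.Injective G) :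
    ∃ C, 0 ≤ C ∧ ∀ v, ‖F v‖ ≤ C * ‖G v‖ := by
  let e := LinearEquiv.ofInjective G hG
  have : FiniteDimensional ℝ (LinearMap.range G) := e.finiteDimensional
  let L := LinearMap.toContinuousLinearMap (F ∘ₗ e.symm.toLinearMap)
  refine ⟨‖L‖, norm_nonneg L, fun v => ?_⟩
  have := L.le_opNorm (e v)
  simpa [L, e] using this

/-- On polynomials of bounded degree, the gradient on a large ball is controlled by the values on
the unit ball. -/
theorem exists_integral_gradient_le (d k : ℕ) (R : ℝ) :
    ∃ C, 0 ≤ C ∧ ∀ q ∈ restrictTotalDegree (Fin d) ℝ k,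
      ∫ x in Metric.closedBall (0 : E d) R, ∑ i, evalPoly (pderiv i q) x ^ 2 ≤
        C * ∫ x in Metric.closedBall (0 : E d) 1, evalPoly q x ^ 2 := by
  have hR := isCompact_closedBall (0 : E d) R
  have h1 := isCompact_closedBall (0 : E d) 1
  let V := restrictTotalDegree (Fin d) ℝ k
  have hinj : Function.Injective (polyL2 h1 ∘ₗ V.subtype) := by
    rw [← LinearMap.ker_eq_bot, LinearMap.ker_eq_bot']
    intro q hq
    have h2 := norm_sq_polyL2 h1 (q : MvPolynomial (Fin d) ℝ)
    have h3 : polyL2 h1 (q : MvPolynomial (Fin d) ℝ) = 0 := hq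
    rw [h3, norm_zero, zero_pow two_ne_zero, eq_comm,
      integral_eq_zero_iff_of_nonneg (fun x => sq_nonneg _)
        (integrableOn_evalPoly_sq _ h1)] at h2
    have h4 := Measure.eqOn_open_of_ae_eq
      (ae_restrict_of_ae_restrict_of_subset Metric.ball_subset_closedBall h2) Metric.isOpen_ball
      ((continuous_evalPoly _).pow 2).continuousOn continuousOn_const
    refine Subtype.ext (eq_zero_of_evalPoly_eq_zero_on_ball one_pos fun x hx => ?_)
    exact pow_eq_zero_iff two_ne_zero |>.1 (h4 hx)
  choose C hC0 hC using fun i : Fin d => exists_norm_le_mul_norm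
    (polyL2 hR ∘ₗ (pderiv i : Derivation ℝ _ _).toLinearMap ∘ₗ V.subtype)
    (polyL2 h1 ∘ₗ V.subtype) hinj
  refine ⟨∑ i, C i ^ 2, by positivity, fun q hq => ?_⟩
  rw [integral_finsetSum _ fun i _ => integrableOn_evalPoly_sq _ hR, Finset.sum_mul]
  refine Finset.sum_le_sum fun i _ => ?_
  rw [← norm_sq_polyL2 hR, ← norm_sq_polyL2 h1, ← mul_pow]
  exact pow_le_pow_left₀ (norm_nonneg _) (hC i ⟨q, hq⟩) 2

theorem setIntegral_closedBall_eq (f : E d → ℝ) (c : E d) {r : ℝ} (hr : 0 < r) (R : ℝ) :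
    ∫ x in Metric.closedBall c (r * R), f x =
      r ^ d * ∫ x in Metric.closedBall (0 : E d) R, f (c + r • x) := by
  have h1 := (measurePreserving_add_left volume c).setIntegral_preimage_emb
    (measurableEmbedding_addLeft c) f (Metric.closedBall c (r * R))
  have h2 : (fun x => c + x) ⁻¹' Metric.closedBall c (r * R) =
      Metric.closedBall (0 : E d) (r * R) := by
    ext x
    simp
  rw [h2] at h1
  have h3 := Measure.setIntegral_comp_smul_of_pos (volume : Measure (E d)) (fun x => f (c + x))
    (Metric.closedBall (0 : E d) R) hr
  rw [smul_closedBall' hr.ne', smul_zero, Real.norm_of_nonneg hr.le, finrank_euclideanSpace,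
    Fintype.card_fin] at h3
  rw [h3, ← h1, smul_eq_mul, ← mul_assoc, mul_inv_cancel₀ (by positivity), one_mul]

end Polynomials

/-! ## The local inverse inequality -/

section Simplices

variable {d : ℕ}

theorem convex_body (σ : Affine.Simplex ℝ (E d) d) : Convex ℝ (body σ) := convex_convexHull ℝ _

theorem isCompact_body (σ : Affine.Simplex ℝ (E d) d) : IsCompact (body σ) :=
  (finite_range _).isCompact_convexHull ℝ

theorem interior_body_nonempty (σ : Affine.Simplex ℝ (E d) d) : (interior (body σ)).Nonempty := by
  rw [body, interior_convexHull_nonempty_iff_affineSpan_eq_top,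
    σ.independent.affineSpan_eq_top_iff_card_eq_finrank_add_one]
  simp

theorem two_mul_le_elemDiam (hd : 1 ≤ d) {σ : Affine.Simplex ℝ (E d) d} {c : E d} {r : ℝ}
    (hr : 0 ≤ r) (h : Metric.closedBall c r ⊆ body σ) : 2 * r ≤ elemDiam σ := by
  let v : E d := EuclideanSpace.single ⟨0, hd⟩ r
  have hv : ‖v‖ = r := by simp [v, abs_of_nonneg hr]
  have h1 : c + v ∈ body σ := h (by simp [hv])
  have h2 : c - v ∈ body σ := h (by simp [hv])
  have h3 := Metric.dist_le_diam_of_mem (isCompact_body σ).isBounded h1 h2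
  rw [dist_eq_norm, show c + v - (c - v) = (2 : ℝ) • v by module, norm_smul, hv] at h3
  simpa [elemDiam] using h3

/-- Any radius above a quarter of the inscribed diameter will do; the factor 4 leaves room to avoid
showing that the supremum is attained. -/
theorem exists_closedBall_subset_body (hd : 1 ≤ d) (σ : Affine.Simplex ℝ (E d) d) :
    ∃ c r, 0 < r ∧ Metric.closedBall c r ⊆ body σ ∧ inDiam σ < 4 * r := by
  set s := {t : ℝ | ∃ (c : E d) (r : ℝ), 0 ≤ r ∧ Metric.closedBall c r ⊆ body σ ∧ t = 2 * r}
  have hbdd : BddAbove s := ⟨elemDiam σ, by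
    rintro _ ⟨c, r, hr, h, rfl⟩
    exact two_mul_le_elemDiam hd hr h⟩
  obtain ⟨c, hc⟩ := interior_body_nonempty σ
  obtain ⟨ε, hε, hsub⟩ := Metric.isOpen_iff.1 isOpen_interior c hc
  have hmem : 2 * (ε / 2) ∈ s := ⟨c, ε / 2, by positivity,
    (Metric.closedBall_subset_ball (by linarith)).trans (hsub.trans interior_subset), rfl⟩
  have hpos : 0 < inDiam σ := lt_of_lt_of_le (by positivity) (le_csSup hbdd hmem)
  obtain ⟨_, ⟨c', r, _, h, rfl⟩, hlt⟩ :=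
    exists_lt_of_lt_csSup ⟨_, hmem⟩ (show inDiam σ / 2 < sSup s from half_lt_self hpos)
  exact ⟨c', r, by linarith, h, by linarith⟩

theorem elemDiam_pos (hd : 1 ≤ d) (σ : Affine.Simplex ℝ (E d) d) : 0 < elemDiam σ := by
  obtain ⟨c, r, hr, h, -⟩ := exists_closedBall_subset_body hd σ
  linarith [two_mul_le_elemDiam hd hr.le h]

theorem inDiam_pos (hd : 1 ≤ d) (σ : Affine.Simplex ℝ (E d) d) : 0 < inDiam σ := by
  obtain ⟨c, r, hr, h, -⟩ := exists_closedBall_subset_body hd σ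
  refine lt_of_lt_of_le (by positivity : 0 < 2 * r) (le_csSup ⟨elemDiam σ, ?_⟩ ⟨c, r, hr.le, h, rfl⟩)
  rintro _ ⟨c, r, hr, h, rfl⟩
  exact two_mul_le_elemDiam hd hr h

open MvPolynomial in
-- Shape regularity places the simplex between concentric balls of radii r and 4|γ|r. After
-- rescaling, the estimate is the equivalence of norms on polynomials over two fixed balls, so no
-- reference simplex is involved.
theorem exists_local_inverse_inequality (hd : 1 ≤ d) (γ : ℝ) (k : ℕ) :
    ∃ c : ℝ, 0 ≤ c ∧ ∀ σ : Affine.Simplex ℝ (E d) d, elemDiam σ / inDiam σ ≤ γ →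
      ∀ q ∈ restrictTotalDegree (Fin d) ℝ k,
        ∫ x in body σ, ∑ i : Fin d, evalPoly (pderiv i q) x ^ 2
          ≤ (c / elemDiam σ) ^ 2 * ∫ x in body σ, evalPoly q x ^ 2 := by
  obtain ⟨C, hC0, hC⟩ := exists_integral_gradient_le d k (4 * |γ|)
  refine ⟨Real.sqrt C * (4 * |γ|), by positivity, fun σ hσ q hq => ?_⟩
  obtain ⟨c, r, hr, hsub, hlt⟩ := exists_closedBall_subset_body hd σ
  have hh := elemDiam_pos hd σ
  have hhr : elemDiam σ ≤ r * (4 * |γ|) := by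
    rw [div_le_iff₀ (inDiam_pos hd σ)] at hσ
    have h1 : γ * inDiam σ ≤ |γ| * (4 * r) :=
      (mul_le_mul_of_nonneg_right (le_abs_self γ) (inDiam_pos hd σ).le).trans
        (mul_le_mul_of_nonneg_left hlt.le (abs_nonneg γ))
    linarith
  have hsup : body σ ⊆ Metric.closedBall c (r * (4 * |γ|)) := by
    intro x hx
    rw [Metric.mem_closedBall]
    exact (Metric.dist_le_diam_of_mem (isCompact_body σ).isBounded hx
      (hsub (Metric.mem_closedBall_self hr.le))).trans hhr
  obtain ⟨s, hs, hsq⟩ := exists_evalPoly_eq_comp hq c (r • ContinuousLinearMap.id ℝ (E d))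
  have hsq' : ∀ x, evalPoly s x = evalPoly q (c + r • x) := fun x => by simpa using hsq x
  have hds : ∀ i x, evalPoly (pderiv i s) x = r * evalPoly (pderiv i q) (c + r • x) := by
    intro i x
    rw [← fderiv_evalPoly, ← fderiv_evalPoly, show evalPoly s = fun x => evalPoly q (c + r • x)
      from funext hsq']
    have h1 : HasFDerivAt (fun x : E d => c + r • x) (r • ContinuousLinearMap.id ℝ (E d)) x :=
      ((hasFDerivAt_id x).const_smul r).const_add c
    have h2 := ((hasFDerivAt_evalPoly q (c + r • x)).differentiableAt.hasFDerivAt).comp x h1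
    have h3 := h2.fderiv
    simp only [Function.comp_def] at h3
    rw [h3]
    simp
  have hint : IntegrableOn (fun x => ∑ i : Fin d, evalPoly (pderiv i q) x ^ 2)
      (Metric.closedBall c (r * (4 * |γ|))) volume :=
    integrable_finsetSum _ fun i _ => integrableOn_evalPoly_sq _ (isCompact_closedBall _ _)
  have step1 : ∫ x in body σ, ∑ i : Fin d, evalPoly (pderiv i q) x ^ 2 ≤
      ∫ x in Metric.closedBall c (r * (4 * |γ|)), ∑ i : Fin d, evalPoly (pderiv i q) x ^ 2 :=
    setIntegral_mono_set hint (ae_of_all _ fun x => Finset.sum_nonneg fun i _ => sq_nonneg _)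
      (LE.le.eventuallyLE hsup)
  have step2 : ∫ x in Metric.closedBall c r, evalPoly q x ^ 2 ≤ ∫ x in body σ, evalPoly q x ^ 2 :=
    setIntegral_mono_set (integrableOn_evalPoly_sq _ (isCompact_body σ))
      (ae_of_all _ fun x => sq_nonneg _) (LE.le.eventuallyLE hsub)
  have e1 := setIntegral_closedBall_eq (fun x => ∑ i : Fin d, evalPoly (pderiv i q) x ^ 2) c hr
    (4 * |γ|)
  have e2 := setIntegral_closedBall_eq (fun x => evalPoly q x ^ 2) c hr 1
  rw [mul_one] at e2
  have hmain := hC s hs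
  simp only [hds, hsq', mul_pow, ← Finset.mul_sum] at hmain
  rw [integral_const_mul] at hmain
  set I1 := ∫ x in Metric.closedBall (0 : E d) (4 * |γ|),
    ∑ i : Fin d, evalPoly (pderiv i q) (c + r • x) ^ 2
  set I2 := ∫ x in Metric.closedBall (0 : E d) 1, evalPoly q (c + r • x) ^ 2
  have hI2 : 0 ≤ ∫ x in body σ, evalPoly q x ^ 2 := integral_nonneg fun x => sq_nonneg _
  have hrd : 0 < r ^ d := by positivity
  have step3 : r ^ 2 * ∫ x in body σ, ∑ i : Fin d, evalPoly (pderiv i q) x ^ 2 ≤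
      C * ∫ x in body σ, evalPoly q x ^ 2 := by
    calc r ^ 2 * ∫ x in body σ, ∑ i : Fin d, evalPoly (pderiv i q) x ^ 2
        ≤ r ^ 2 * (r ^ d * I1) := by
          rw [← e1]; exact mul_le_mul_of_nonneg_left step1 (by positivity)
      _ = r ^ d * (r ^ 2 * I1) := by ring
      _ ≤ r ^ d * (C * I2) := mul_le_mul_of_nonneg_left hmain hrd.le
      _ = C * (r ^ d * I2) := by ring
      _ ≤ _ := by rw [← e2]; exact mul_le_mul_of_nonneg_left step2 hC0
  have hfac : C ≤ r ^ 2 * (Real.sqrt C * (4 * |γ|) / elemDiam σ) ^ 2 := by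
    have h1 : 1 ≤ (r * (4 * |γ|) / elemDiam σ) ^ 2 := by
      rw [one_le_sq_iff₀ (by positivity), le_div_iff₀ hh, one_mul]
      exact hhr
    have h2 : r ^ 2 * (Real.sqrt C * (4 * |γ|) / elemDiam σ) ^ 2 =
        C * (r * (4 * |γ|) / elemDiam σ) ^ 2 := by
      rw [div_pow, div_pow, mul_pow (Real.sqrt C), Real.sq_sqrt hC0]
      ring
    rw [h2]
    nlinarith
  have hr2 : 0 < r ^ 2 := by positivity
  refine le_of_mul_le_mul_left ?_ hr2
  refine step3.trans ((mul_le_mul_of_nonneg_right hfac hI2).trans (le_of_eq ?_))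
  ring

/-- The infimum is attained, since the admissible constants form a nonempty closed set bounded
below. -/
theorem invConst_mem (hd : 1 ≤ d) (γ : ℝ) (k : ℕ) :
    0 ≤ invConst d γ k ∧ ∀ σ : Affine.Simplex ℝ (E d) d, elemDiam σ / inDiam σ ≤ γ →
      ∀ q ∈ MvPolynomial.restrictTotalDegree (Fin d) ℝ k,
        ∫ x in body σ, ∑ i : Fin d, evalPoly (MvPolynomial.pderiv i q) x ^ 2
          ≤ (invConst d γ k / elemDiam σ) ^ 2 * ∫ x in body σ, evalPoly q x ^ 2 := by
  set s := {c : ℝ | 0 ≤ c ∧ ∀ σ : Affine.Simplex ℝ (E d) d, elemDiam σ / inDiam σ ≤ γ →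
    ∀ q ∈ MvPolynomial.restrictTotalDegree (Fin d) ℝ k,
      ∫ x in body σ, ∑ i : Fin d, evalPoly (MvPolynomial.pderiv i q) x ^ 2
        ≤ (c / elemDiam σ) ^ 2 * ∫ x in body σ, evalPoly q x ^ 2} with hs
  have hclosed : IsClosed s := by
    have : s = {c | 0 ≤ c} ∩ ⋂ (σ : Affine.Simplex ℝ (E d) d) (_ : elemDiam σ / inDiam σ ≤ γ)
        (q : MvPolynomial (Fin d) ℝ) (_ : q ∈ MvPolynomial.restrictTotalDegree (Fin d) ℝ k),
        {c | ∫ x in body σ, ∑ i : Fin d, evalPoly (MvPolynomial.pderiv i q) x ^ 2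
          ≤ (c / elemDiam σ) ^ 2 * ∫ x in body σ, evalPoly q x ^ 2} := by
      ext c
      simp [hs]
    rw [this]
    refine (isClosed_le continuous_const continuous_id).inter ?_
    refine isClosed_iInter fun σ => isClosed_iInter fun _ => isClosed_iInter fun q =>
      isClosed_iInter fun _ => isClosed_le continuous_const ?_
    fun_prop
  exact hclosed.csInf_mem (exists_local_inverse_inequality hd γ k) ⟨0, fun c hc => hc.1⟩

end Simplices

/-! ## Geometry of Lipschitz domains and simplicial meshes -/

section Geometry

variable {d : ℕ} {Ω : Set (E d)}

/-- The domain lies on one side of its boundary: moving from a boundary point against e enters the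
open region below the graph, which misses Ω. The mesh covers only the closure, so this is what
places open elements inside Ω. -/
theorem interior_closure_subset (hΩ : IsLipschitzDomain Ω) : interior (closure Ω) ⊆ Ω := by
  obtain ⟨hopen, -, -, hloc⟩ := hΩ
  intro x hx
  by_contra hxΩ
  have hfr : x ∈ frontier Ω := by
    rw [hopen.frontier_eq]
    exact ⟨interior_subset hx, hxΩ⟩
  obtain ⟨e, he, r, hr, K, g, hg, hiff⟩ := hloc x hfr
  have hxg : inner ℝ e x ≤ g (x - inner ℝ e x • e) :=
    not_lt.1 fun h => hxΩ ((hiff x (Metric.mem_ball_self hr)).2 h)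
  have hee : inner ℝ e e = (1 : ℝ) := by rw [real_inner_self_eq_norm_sq, he, one_pow]
  have hcont : Continuous fun y : E d => inner ℝ e y := by fun_prop
  obtain ⟨ε, hε, hsub⟩ := Metric.isOpen_iff.1 isOpen_interior x hx
  set t := min ε r / 2 with ht
  have ht0 : 0 < t := by have := lt_min hε hr; positivity
  have htε : t < ε := by have := min_le_left ε r; rw [ht]; linarith [lt_min hε hr]
  have htr : t < r := by have := min_le_right ε r; rw [ht]; linarith [lt_min hε hr]
  have hnorm : dist (x - t • e) x = t := by
    rw [dist_eq_norm, sub_sub_cancel_left, norm_neg, norm_smul, he, mul_one,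
      Real.norm_of_nonneg ht0.le]
  have hycl : x - t • e ∈ closure Ω := interior_subset (hsub (by
    rw [Metric.mem_ball, hnorm]; exact htε))
  set O := Metric.ball x r ∩ {y | inner ℝ e y < g (y - inner ℝ e y • e)} with hO
  have hOopen : IsOpen O := by
    refine Metric.isOpen_ball.inter (isOpen_lt hcont (hg.continuous.comp ?_))
    fun_prop
  have hyO : x - t • e ∈ O := by
    refine ⟨by rw [Metric.mem_ball, hnorm]; exact htr, ?_⟩
    have h1 : inner ℝ e (x - t • e) = inner ℝ e x - t := by
      rw [inner_sub_right, real_inner_smul_right, hee, mul_one]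
    have h2 : x - t • e - (inner ℝ e x - t) • e = x - inner ℝ e x • e := by module
    rw [mem_ofPred_eq, h1, h2]
    linarith
  obtain ⟨y, hy, hyΩ⟩ := mem_closure_iff.1 hycl O hOopen hyO
  exact lt_asymm hy.2 ((hiff y hy.1).1 hyΩ)

namespace SimplicialMesh

theorem interior_body_subset (M : SimplicialMesh Ω) (hΩ : IsLipschitzDomain Ω) (i : Fin M.N) :
    interior (body (M.simplex i)) ⊆ Ω := by
  refine (interior_mono ?_).trans (interior_closure_subset hΩ)
  rw [← M.cover]
  exact subset_iUnion (fun i => body (M.simplex i)) i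

end SimplicialMesh

/-- The common vertices omit a vertex of σ, which by affine independence is outside their affine
span; the span is therefore proper. -/
theorem interior_convexHull_inter_eq_empty {σ σ' : Affine.Simplex ℝ (E d) d}
    (h : ¬ range σ.points ⊆ range σ'.points) :
    interior (convexHull ℝ (range σ.points ∩ range σ'.points)) = ∅ := by
  rw [← not_nonempty_iff_eq_empty, interior_convexHull_nonempty_iff_affineSpan_eq_top]
  intro htop
  obtain ⟨_, ⟨k, rfl⟩, hk⟩ := not_subset.1 h
  have h1 := σ.independent.notMem_affineSpan_sdiff k univ
  refine h1 ?_
  have h2 : range σ.points ∩ range σ'.points ⊆ σ.points '' (univ \ {k}) := by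
    rintro _ ⟨⟨l, rfl⟩, hl⟩
    refine ⟨l, ⟨mem_univ l, ?_⟩, rfl⟩
    rintro rfl
    exact hk hl
  have h3 := affineSpan_mono ℝ h2
  rw [htop, top_le_iff] at h3
  rw [h3]
  exact AffineSubspace.mem_top ℝ (E d) _

namespace SimplicialMesh

theorem disjoint_interior_body (M : SimplicialMesh Ω) {i j : Fin M.N} (hij : i ≠ j) :
    Disjoint (interior (body (M.simplex i))) (interior (body (M.simplex j))) := by
  rw [disjoint_iff_inter_eq_empty, ← interior_inter, M.conforming]
  by_cases h : range (M.simplex i).points ⊆ range (M.simplex j).points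
  · rw [inter_comm]
    refine interior_convexHull_inter_eq_empty fun h' => hij (M.distinct ?_)
    exact h.antisymm h'
  · exact interior_convexHull_inter_eq_empty h

theorem closure_interior_body (σ : Affine.Simplex ℝ (E d) d) :
    closure (interior (body σ)) = body σ := by
  rw [(convex_body σ).closure_interior_eq_closure_of_nonempty_interior (interior_body_nonempty σ),
    (isCompact_body σ).isClosed.closure_eq]

theorem disjoint_interior_body_body (M : SimplicialMesh Ω) {i j : Fin M.N} (hij : i ≠ j) :
    Disjoint (interior (body (M.simplex i))) (body (M.simplex j)) := by
  rw [← closure_interior_body (M.simplex j)]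
  exact (M.disjoint_interior_body hij).closure_right isOpen_interior

/-- A closed simplex is the closure of its interior, so every fine element lies in the closure of
the fine region. -/
theorem mem_coarse_of_notMem_closure_fineRegion (M : SimplicialMesh Ω) {coarse : Finset (Fin M.N)}
    {z : E d} (hz : z ∉ closure (M.fineRegion coarse)) {i : Fin M.N}
    (hi : z ∈ body (M.simplex i)) : i ∈ coarse := by
  by_contra hc
  refine hz ?_
  rw [← closure_interior_body] at hi
  refine closure_mono (interior_mono ?_) hi
  exact subset_biUnion_of_mem (u := fun i => body (M.simplex i)) (Finset.mem_compl.2 hc)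

theorem elemDiam_le_h (M : SimplicialMesh Ω) (i : Fin M.N) : elemDiam (M.simplex i) ≤ M.h :=
  le_ciSup (f := fun i => elemDiam (M.simplex i)) (finite_range _).bddAbove i

theorem ratio_le_shape (M : SimplicialMesh Ω) (i : Fin M.N) :
    elemDiam (M.simplex i) / inDiam (M.simplex i) ≤ M.shape :=
  le_ciSup (f := fun i => elemDiam (M.simplex i) / inDiam (M.simplex i))
    (finite_range _).bddAbove i

theorem h_div_elemDiam_le (hd : 1 ≤ d) (M : SimplicialMesh Ω) {coarse : Finset (Fin M.N)}
    {i : Fin M.N} (hi : i ∈ coarse) : M.h / elemDiam (M.simplex i) ≤ M.quasiUnif coarse := by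
  have : Nonempty coarse := ⟨⟨i, hi⟩⟩
  have hpos : 0 < ⨅ i : coarse, elemDiam (M.simplex i) := by
    obtain ⟨j, hj⟩ := exists_eq_ciInf_of_finite (f := fun i : coarse => elemDiam (M.simplex i))
    rw [← hj]
    exact elemDiam_pos hd _
  refine div_le_div_of_nonneg_left ?_ hpos
    (ciInf_le (f := fun i : coarse => elemDiam (M.simplex i)) (finite_range _).bddBelow ⟨i, hi⟩)
  exact (elemDiam_pos hd _).le.trans (M.elemDiam_le_h i)

/-- What the open elements miss lies on boundaries of convex sets, which are null. -/
theorem ae_eq_iUnion_interior (M : SimplicialMesh Ω) (hΩ : IsLipschitzDomain Ω) :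
    Ω =ᵐ[volume] ⋃ i, interior (body (M.simplex i)) := by
  refine Filter.EventuallyLE.antisymm ?_ ?_
  · rw [ae_le_set]
    refine measure_mono_null (t := ⋃ i, frontier (body (M.simplex i))) ?_
      (measure_iUnion_null fun i => (convex_body _).addHaar_frontier volume)
    rintro x ⟨hx, hx'⟩
    have h1 := subset_closure hx
    rw [← M.cover] at h1
    obtain ⟨i, hi⟩ := mem_iUnion.1 h1
    refine mem_iUnion.2 ⟨i, subset_closure hi, fun h => hx' (mem_iUnion.2 ⟨i, h⟩)⟩
  · exact LE.le.eventuallyLE (iUnion_subset fun i => M.interior_body_subset hΩ i)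

end SimplicialMesh

/-- The linear part of the affine map onto the simplex. -/
def edgeMap (σ : Affine.Simplex ℝ (E d) d) : E d →ₗ[ℝ] E d :=
  ∑ i : Fin d, (EuclideanSpace.proj i : E d →L[ℝ] ℝ).toLinearMap.smulRight
    (σ.points i.succ - σ.points 0)

theorem refMap_eq (σ : Affine.Simplex ℝ (E d) d) (y : E d) :
    refMap σ y = σ.points 0 + edgeMap σ y := by
  simp [refMap, edgeMap]

theorem edgeMap_injective (σ : Affine.Simplex ℝ (E d) d) : Function.Injective (edgeMap σ) := by
  rw [← LinearMap.ker_eq_bot, LinearMap.ker_eq_bot']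
  intro y hy
  have h1 := (affineIndependent_iff_linearIndependent_vsub ℝ σ.points 0).1 σ.independent
  have h2 := h1.comp (fun i : Fin d => (⟨i.succ, Fin.succ_ne_zero i⟩ : {x : Fin (d + 1) // x ≠ 0}))
    (fun i j h => Fin.succ_injective _ (Subtype.ext_iff.1 h))
  rw [Fintype.linearIndependent_iff] at h2
  ext i
  refine h2 (fun i => y i) ?_ i
  simpa [edgeMap] using hy

theorem body_subset_image_refMap (σ : Affine.Simplex ℝ (E d) d) :
    body σ ⊆ refMap σ '' refSimplex d := by
  classical
  refine convexHull_min ?_ ?_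
  · rintro _ ⟨k, rfl⟩
    rcases Fin.eq_zero_or_eq_succ k with rfl | ⟨j, rfl⟩
    · refine ⟨0, ⟨fun i => by simp, by simp⟩, ?_⟩
      simp [refMap]
    · refine ⟨EuclideanSpace.single j 1, ⟨fun i => ?_, ?_⟩, ?_⟩
      · by_cases h : i = j <;> simp [h]
      · simp
      · rw [refMap, Finset.sum_eq_single j]
        · simp
        · intro i _ hij
          simp [hij]
        · simp
  · have hconv : Convex ℝ (refSimplex d) := by
      intro x hx y hy a b ha hb hab
      refine ⟨fun i => ?_, ?_⟩
      · have := mul_nonneg ha (hx.1 i)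
        have := mul_nonneg hb (hy.1 i)
        simp only [PiLp.add_apply, PiLp.smul_apply, smul_eq_mul]
        positivity
      · simp only [PiLp.add_apply, PiLp.smul_apply, smul_eq_mul, Finset.sum_add_distrib,
          ← Finset.mul_sum]
        have := mul_le_mul_of_nonneg_left hx.2 ha
        have := mul_le_mul_of_nonneg_left hy.2 hb
        linarith
    have : refMap σ '' refSimplex d =
        (fun x => σ.points 0 + x) '' (edgeMap σ '' refSimplex d) := by
      rw [image_image]
      exact image_congr fun y _ => refMap_eq σ y
    rw [this]
    exact (hconv.linear_image (edgeMap σ)).translate _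

end Geometry

/-! ## Finite element functions -/

section FiniteElements

variable {d : ℕ} {Ω : Set (E d)}

open MvPolynomial in
/-- A finite element function is a polynomial on each element. -/
theorem exists_polynomial_of_mem_feSpace {V : Submodule ℝ (L2pair Ω)} {M : SimplicialMesh Ω}
    {P : Submodule ℝ (MvPolynomial (Fin d) ℝ)} {k : ℕ}
    (hP : P ≤ restrictTotalDegree (Fin d) ℝ k) (u : feSpace V M P) (i : Fin M.N) :
    ∃ r ∈ restrictTotalDegree (Fin d) ℝ k, ∀ᵐ x ∂(volume.restrict Ω),
      x ∈ body (M.simplex i) → toL2 _ u x = evalPoly r x := by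
  obtain ⟨q, hq, hqx⟩ := u.2 i
  set σ := M.simplex i
  let e := LinearEquiv.ofInjectiveEndo (edgeMap σ) (edgeMap_injective σ)
  let B : E d →L[ℝ] E d := LinearMap.toContinuousLinearMap e.symm.toLinearMap
  obtain ⟨r, hr, hrx⟩ := exists_evalPoly_eq_comp (hP hq) (-B (σ.points 0)) B
  refine ⟨r, hr, ?_⟩
  filter_upwards [hqx] with x hx hxb
  obtain ⟨y, hy, rfl⟩ := body_subset_image_refMap σ hxb
  have h1 : -B (σ.points 0) + B (refMap σ y) = y := by
    rw [refMap_eq, map_add, neg_add_cancel_left]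
    exact e.symm_apply_apply y
  rw [hrx, h1]
  exact hx y hy rfl

theorem norm_sq_eq_integral_of_lp {F : Type*} [NormedAddCommGroup F] [InnerProductSpace ℝ F]
    {α : Type*} [MeasurableSpace α] {μ : Measure α} (f : Lp F 2 μ) :
    ‖f‖ ^ 2 = ∫ x, ‖f x‖ ^ 2 ∂μ := by
  rw [← real_inner_self_eq_norm_sq, L2.inner_def]
  simp only [real_inner_self_eq_norm_sq]

/-- On an open set where the function is a polynomial, its weak gradient is the gradient of the
polynomial. -/
theorem weakGradient_eq_of_polynomial (hΩ : MeasurableSet Ω) {u : L2 Ω} {G : L2vec Ω} (h : HasWeakGradient Ω u G)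
    {O : Set (E d)} (hO : IsOpen O) (hOΩ : O ⊆ Ω) (hOb : Bornology.IsBounded O)
    {r : MvPolynomial (Fin d) ℝ}
    (hr : ∀ᵐ x ∂(volume.restrict O), u x = evalPoly r x) (k : Fin d) :
    ∀ᵐ x ∂(volume.restrict O), G x k = evalPoly (MvPolynomial.pderiv k r) x := by
  have hfin : IsFiniteMeasure (volume.restrict O) :=
    isFiniteMeasure_restrict.2 hOb.measure_lt_top.ne
  have hG : IntegrableOn (fun x => G x k) O volume :=
    ((memLp_coord G k).mono_measure (Measure.restrict_mono hOΩ le_rfl)).integrable one_le_two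
  have hcl : IsCompact (closure O) := hOb.isCompact_closure
  have hpoly : ∀ q : MvPolynomial (Fin d) ℝ, IntegrableOn (evalPoly q) O volume := fun q =>
    ((continuous_evalPoly q).continuousOn.integrableOn_compact hcl).mono_set subset_closure
  have hz := hO.ae_eq_zero_of_integral_contDiff_smul_eq_zero (μ := volume)
    (f := fun x => G x k - evalPoly (MvPolynomial.pderiv k r) x)
    (hG.sub (hpoly _)).locallyIntegrableOn (fun φ hφ hc hs => by
      have hout : ∀ x, x ∉ O → φ x = 0 := fun x hx =>
        image_eq_zero_of_notMem_tsupport fun hx' => hx (hs hx')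
      have hout' : ∀ x, x ∉ O → fderiv ℝ φ x (EuclideanSpace.single k 1) = 0 := fun x hx => by
        have : fderiv ℝ φ x = 0 := image_eq_zero_of_notMem_tsupport (f := fderiv ℝ φ)
          fun hx' => hx (hs (tsupport_fderiv_subset ℝ hx'))
        rw [this, zero_apply]
      have hweak := h φ ⟨hφ, hc, hs.trans hOΩ⟩ k
      have cφ := hφ.continuous
      have cφ' : Continuous fun x => fderiv ℝ φ x (EuclideanSpace.single k 1) :=
        (hφ.continuous_fderiv (by simp)).clm_apply continuous_const
      have hcφ' : HasCompactSupport fun x => fderiv ℝ φ x (EuclideanSpace.single k 1) :=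
        hc.fderiv_apply (𝕜 := ℝ) _
      have e1 : ∫ x in Ω, u x * fderiv ℝ φ x (EuclideanSpace.single k 1) =
          ∫ x, evalPoly r x * fderiv ℝ φ x (EuclideanSpace.single k 1) := by
        refine ((setIntegral_eq_of_subset_of_forall_sdiff_eq_zero hΩ hOΩ
          (fun x hx => by rw [hout' x hx.2, mul_zero])).trans (integral_congr_ae ?_)).trans
          (setIntegral_eq_integral_of_forall_compl_eq_zero (s := O)
            (fun x hx => by rw [hout' x hx, mul_zero]))
        filter_upwards [hr] with x hx
        rw [hx]
      have e2 : ∫ x in Ω, G x k * φ x = ∫ x in O, G x k * φ x :=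
        setIntegral_eq_of_subset_of_forall_sdiff_eq_zero hΩ hOΩ
          (fun x hx => by rw [hout x hx.2, mul_zero])
      -- Integration by parts on the whole space; the test function is supported in O, so no
      -- boundary term arises.
      have e3 : ∫ x, evalPoly r x * fderiv ℝ φ x (EuclideanSpace.single k 1) =
          -∫ x, evalPoly (MvPolynomial.pderiv k r) x * φ x := by
        have := integral_mul_fderiv_eq_neg_fderiv_mul_of_integrable (μ := volume)
          (f := evalPoly r) (g := φ) (v := EuclideanSpace.single k (1 : ℝ))
          (((continuous_evalPoly (MvPolynomial.pderiv k r)).mul cφ).integrable_of_hasCompactSupport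
            hc.mul_left |>.congr (ae_of_all _ fun x => by simp only [fderiv_evalPoly]; rfl))
          (((continuous_evalPoly r).mul cφ').integrable_of_hasCompactSupport hcφ'.mul_left)
          (((continuous_evalPoly r).mul cφ).integrable_of_hasCompactSupport hc.mul_left)
          (fun x _ => (hasFDerivAt_evalPoly r x).differentiableAt)
          (fun x _ => hφ.differentiable (by simp) x)
        simpa only [fderiv_evalPoly] using this
      have e4 : ∫ x, evalPoly (MvPolynomial.pderiv k r) x * φ x =
          ∫ x in O, evalPoly (MvPolynomial.pderiv k r) x * φ x :=
        (setIntegral_eq_integral_of_forall_compl_eq_zero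
          (fun x hx => by rw [hout x hx, mul_zero])).symm
      rw [e1, e2, e3, e4, neg_inj] at hweak
      obtain ⟨C, hC⟩ := hc.exists_bound_of_continuous cφ
      have j1 : IntegrableOn (fun x => G x k * φ x) O volume :=
        hG.mul_bdd cφ.aestronglyMeasurable (ae_of_all _ hC)
      have j2 : IntegrableOn (fun x => evalPoly (MvPolynomial.pderiv k r) x * φ x) O volume :=
        (hpoly _).mul_bdd cφ.aestronglyMeasurable (ae_of_all _ hC)
      rw [← setIntegral_eq_integral_of_forall_compl_eq_zero (s := O) (f := fun x =>
          φ x • (G x k - evalPoly (MvPolynomial.pderiv k r) x))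
        (fun x hx => by rw [hout x hx, zero_smul])]
      simp only [smul_eq_mul, mul_comm (φ _), sub_mul]
      rw [integral_sub j1 j2, hweak, sub_self])
  rw [ae_restrict_iff' hO.measurableSet]
  filter_upwards [hz] with x hx hxO
  exact sub_eq_zero.1 (hx hxO)

/-- The local inverse inequality summed over the elements. Elements where u vanishes contribute
nothing, so K need not dominate their inverse diameters; this is how coarse functions escape the
factor p. -/
theorem norm_snd_le_mul_norm_fst (hd : 1 ≤ d) (hΩ : IsLipschitzDomain Ω) (M : SimplicialMesh Ω)
    {k : ℕ} {u : L2pair Ω} (hu : u ∈ H1 Ω)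
    (hpoly : ∀ i, ∃ r ∈ MvPolynomial.restrictTotalDegree (Fin d) ℝ k,
      ∀ᵐ x ∂(volume.restrict Ω), x ∈ body (M.simplex i) → u.fst x = evalPoly r x)
    {K : ℝ} (hK : ∀ i, (∀ᵐ x ∂(volume.restrict Ω),
      x ∈ interior (body (M.simplex i)) → u.fst x = 0) ∨
        invConst d M.shape k / elemDiam (M.simplex i) ≤ K) :
    ‖u.snd‖ ^ 2 ≤ K ^ 2 * ‖u.fst‖ ^ 2 := by
  set O : Fin M.N → Set (E d) := fun i => interior (body (M.simplex i)) with hO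
  have hOΩ : ∀ i, O i ⊆ Ω := M.interior_body_subset hΩ
  have hOm : ∀ i, MeasurableSet (O i) := fun i => isOpen_interior.measurableSet
  have hOd : Pairwise (Function.onFun Disjoint O) := fun i j hij => M.disjoint_interior_body hij
  have hinv := invConst_mem hd M.shape k
  have i1 : Integrable (fun x => ‖u.fst x‖ ^ 2) (volume.restrict Ω) :=
    (Lp.memLp u.fst).integrable_norm_pow two_ne_zero
  have i2 : Integrable (fun x => ‖u.snd x‖ ^ 2) (volume.restrict Ω) :=
    (Lp.memLp u.snd).integrable_norm_pow two_ne_zero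
  rw [norm_sq_eq_integral_of_lp, norm_sq_eq_integral_of_lp,
    setIntegral_congr_set (M.ae_eq_iUnion_interior hΩ),
    setIntegral_congr_set (M.ae_eq_iUnion_interior hΩ),
    integral_iUnion_fintype hOm hOd
      fun i => IntegrableOn.mono_set (t := Ω) i2 (hOΩ i),
    integral_iUnion_fintype hOm hOd
      fun i => IntegrableOn.mono_set (t := Ω) i1 (hOΩ i), Finset.mul_sum]
  refine Finset.sum_le_sum fun i _ => ?_
  obtain ⟨r, hr, hrx⟩ := hpoly i
  have hrO : ∀ᵐ x ∂(volume.restrict (O i)), u.fst x = evalPoly r x := by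
    filter_upwards [ae_restrict_of_ae_restrict_of_subset (hOΩ i) hrx, ae_restrict_mem (hOm i)]
      with x h1 h2 using h1 (interior_subset h2)
  have hgrad : ∀ᵐ x ∂(volume.restrict (O i)), ∀ j,
      u.snd x j = evalPoly (MvPolynomial.pderiv j r) x :=
    ae_all_iff.2 fun j => weakGradient_eq_of_polynomial hΩ.1.measurableSet hu isOpen_interior (hOΩ i)
      ((isCompact_body _).isBounded.subset interior_subset) hrO j
  have hOb : O i =ᵐ[volume] body (M.simplex i) :=
    interior_ae_eq_of_null_frontier ((convex_body _).addHaar_frontier volume)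
  have e1 : ∫ x in O i, ‖u.snd x‖ ^ 2 =
      ∫ x in body (M.simplex i), ∑ j, evalPoly (MvPolynomial.pderiv j r) x ^ 2 := by
    rw [← setIntegral_congr_set hOb]
    refine integral_congr_ae ?_
    filter_upwards [hgrad] with x hx
    rw [EuclideanSpace.real_norm_sq_eq]
    exact Finset.sum_congr rfl fun j _ => by rw [hx j]
  have e2 : ∫ x in O i, ‖u.fst x‖ ^ 2 = ∫ x in body (M.simplex i), evalPoly r x ^ 2 := by
    rw [← setIntegral_congr_set hOb]
    refine integral_congr_ae ?_
    filter_upwards [hrO] with x hx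
    rw [hx, Real.norm_eq_abs, sq_abs]
  have hloc := hinv.2 (M.simplex i) (M.ratio_le_shape i) r hr
  rw [e1, e2]
  have hnonneg : 0 ≤ ∫ x in body (M.simplex i), evalPoly r x ^ 2 :=
    integral_nonneg fun x => sq_nonneg _
  rcases hK i with h0 | hle
  · have : ∫ x in body (M.simplex i), evalPoly r x ^ 2 = 0 := by
      rw [← e2]
      refine integral_eq_zero_of_ae ?_
      filter_upwards [ae_restrict_of_ae_restrict_of_subset (hOΩ i) h0, ae_restrict_mem (hOm i)]
        with x h1 h2
      simp [h1 h2]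
    rw [this, mul_zero] at hloc ⊢
    exact hloc
  · refine hloc.trans (mul_le_mul_of_nonneg_right (pow_le_pow_left₀ ?_ hle 2) hnonneg)
    exact div_nonneg hinv.1 (elemDiam_pos hd _).le

/-- The functions in `L²(Ω)` which vanish almost everywhere in `O`. -/
def vanishingOn (Ω O : Set (E d)) : Submodule ℝ (L2 Ω) where
  carrier := {v | ∀ᵐ x ∂(volume.restrict Ω), x ∈ O → v x = 0}
  zero_mem' := by
    filter_upwards [Lp.coeFn_zero ℝ 2 (volume.restrict Ω)] with x hx _
    exact hx
  add_mem' := by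
    intro v w hv hw
    change ∀ᵐ x ∂(volume.restrict Ω), x ∈ O → (v + w : L2 Ω) x = 0
    filter_upwards [Lp.coeFn_add v w, hv, hw] with x hx h1 h2 hO
    rw [hx, Pi.add_apply, h1 hO, h2 hO, add_zero]
  smul_mem' := by
    intro c v hv
    change ∀ᵐ x ∂(volume.restrict Ω), x ∈ O → (c • v : L2 Ω) x = 0
    filter_upwards [Lp.coeFn_smul c v, hv] with x hx h1 hO
    rw [hx, Pi.smul_apply, h1 hO, smul_zero]

/-- A finite element function without fine degrees of freedom vanishes on the fine elements. -/
theorem vanish_of_repr_eq_zero {V : Submodule ℝ (L2pair Ω)} {M : SimplicialMesh Ω}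
    {P : Submodule ℝ (MvPolynomial (Fin d) ℝ)} {nodes : Finset (E d)}
    (b : Module.Basis nodes ℝ (feSpace V M P))
    (hb : ∀ z : nodes, ∀ᵐ x ∂(volume.restrict Ω),
      (∀ i, (z : E d) ∈ body (M.simplex i) → x ∉ body (M.simplex i)) → toL2 _ (b z) x = 0)
    {coarse : Finset (Fin M.N)} {u : feSpace V M P}
    (hu : ∀ z ∈ {z : nodes | (z : E d) ∈ closure (M.fineRegion coarse)}, b.repr u z = 0)
    {i : Fin M.N} (hi : i ∉ coarse) :
    toL2 _ u ∈ vanishingOn Ω (interior (body (M.simplex i))) := by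
  rw [← b.sum_repr u, map_sum]
  refine Submodule.sum_mem _ fun z _ => ?_
  rw [map_smul]
  by_cases hz : (z : E d) ∈ closure (M.fineRegion coarse)
  · rw [hu z hz, zero_smul]
    exact Submodule.zero_mem _
  · refine Submodule.smul_mem _ _ ?_
    change ∀ᵐ x ∂(volume.restrict Ω), _
    filter_upwards [hb z] with x hx hxi
    -- A node outside the closed fine region belongs to coarse elements only, and these do not meet
    -- the interior of a fine element.
    refine hx fun j hj hxj => ?_
    have hjc := M.mem_coarse_of_notMem_closure_fineRegion hz hj
    have hij : i ≠ j := fun h => hi (h ▸ hjc)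
    exact (disjoint_left.1 (M.disjoint_interior_body_body hij)) hxi hxj

end FiniteElements

/-! ## Inverse inequalities for the bilinear form -/

section InverseInequality

variable {d : ℕ} {Ω : Set (E d)} {V : Submodule ℝ (L2pair Ω)} {M : SimplicialMesh Ω}
  {P : Submodule ℝ (MvPolynomial (Fin d) ℝ)} {nodes : Finset (E d)}

theorem norm_toL2_sq_le (u : feSpace V M P) : ‖toL2 _ u‖ ^ 2 ≤ ‖(u : V)‖ ^ 2 := by
  have h : ‖(u : V)‖ ^ 2 = ‖toL2 _ u‖ ^ 2 + ‖((u : V) : L2pair Ω).snd‖ ^ 2 :=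
    WithLp.prod_norm_sq_eq_of_L2 ((u : V) : L2pair Ω)
  rw [h]
  exact le_add_of_nonneg_right (sq_nonneg _)

theorem lumpedNorm_sq {ι S : Type*} [Fintype ι] [AddCommGroup S] [Module ℝ S]
    (b : Module.Basis ι ℝ S) {D : ι → ℝ} (hD : ∀ z, 0 < D z) (u : S) :
    lumpedNorm b D u ^ 2 = lumped b D u u :=
  Real.sq_sqrt (lumped_self_nonneg b hD u)

theorem lumped_le_form {a : LinearMap.BilinForm ℝ V} {ccoer : ℝ} (hccoer : 0 < ccoer)
    (hcoer : ∀ u, ccoer * ‖u‖ ^ 2 ≤ a u u) {b : Module.Basis nodes ℝ (feSpace V M P)}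
    {D : nodes → ℝ} (hD : ∀ z, 0 < D z) {Ceq : ℝ} (hCeq : 0 < Ceq)
    {u : feSpace V M P} (heq : Ceq⁻¹ * lumpedNorm b D u ≤ ‖toL2 _ u‖) :
    ccoer / Ceq ^ 2 * lumped b D u u ≤ a u u := by
  have h0 : 0 ≤ Ceq⁻¹ * lumpedNorm b D u := mul_nonneg (inv_nonneg.2 hCeq.le) (Real.sqrt_nonneg _)
  have h1 := pow_le_pow_left₀ h0 heq 2
  rw [mul_pow, lumpedNorm_sq b hD] at h1
  have h2 := mul_le_mul_of_nonneg_left (h1.trans (norm_toL2_sq_le u)) hccoer.le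
  calc ccoer / Ceq ^ 2 * lumped b D u u = ccoer * (Ceq⁻¹ ^ 2 * lumped b D u u) := by
        rw [inv_pow, div_eq_mul_inv, mul_assoc]
    _ ≤ ccoer * ‖(u : V)‖ ^ 2 := h2
    _ ≤ a u u := hcoer u

theorem form_le_lumped (hd : 1 ≤ d) (hΩ : IsLipschitzDomain Ω) (hV : V ≤ H1 Ω) {k : ℕ}
    (hP : P ≤ MvPolynomial.restrictTotalDegree (Fin d) ℝ k) {a : LinearMap.BilinForm ℝ V}
    {Ccont : ℝ} (hCcont : 0 ≤ Ccont) (hcont : ∀ u v, |a u v| ≤ Ccont * ‖u‖ * ‖v‖)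
    {b : Module.Basis nodes ℝ (feSpace V M P)} {D : nodes → ℝ} (hD : ∀ z, 0 < D z)
    {Ceq : ℝ} {u : feSpace V M P} (heq : ‖toL2 _ u‖ ≤ Ceq * lumpedNorm b D u)
    {K : ℝ} (hK : ∀ i, toL2 _ u ∈ vanishingOn Ω (interior (body (M.simplex i))) ∨
      invConst d M.shape k / elemDiam (M.simplex i) ≤ K) :
    a u u ≤ Ccont * ((1 + K ^ 2) * Ceq ^ 2) * lumped b D u u := by
  have h1 : ‖(u : V)‖ ^ 2 = ‖toL2 _ u‖ ^ 2 + ‖((u : V) : L2pair Ω).snd‖ ^ 2 :=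
    WithLp.prod_norm_sq_eq_of_L2 ((u : V) : L2pair Ω)
  have h2 : ‖((u : V) : L2pair Ω).snd‖ ^ 2 ≤ K ^ 2 * ‖toL2 _ u‖ ^ 2 :=
    norm_snd_le_mul_norm_fst hd hΩ M (hV (u : V).2) (exists_polynomial_of_mem_feSpace hP u) hK
  have h3 := pow_le_pow_left₀ (norm_nonneg _) heq 2
  rw [mul_pow, lumpedNorm_sq b hD] at h3
  have h4 : a u u ≤ Ccont * ‖(u : V)‖ ^ 2 := by
    refine (le_abs_self _).trans ((hcont u u).trans_eq ?_)
    ring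
  have h5 : ‖(u : V)‖ ^ 2 ≤ (1 + K ^ 2) * (Ceq ^ 2 * lumped b D u u) := by
    refine le_trans ?_ (mul_le_mul_of_nonneg_left h3 (by positivity))
    rw [h1]
    linarith
  calc a u u ≤ Ccont * ((1 + K ^ 2) * (Ceq ^ 2 * lumped b D u u)) :=
        h4.trans (mul_le_mul_of_nonneg_left h5 hCcont)
    _ = _ := by ring

/-- The summand 1, from the L² part of the H¹ norm, is absorbed into h₀²/h²; this is why h₀ appears
in C_inv. -/
theorem one_add_inverse_sq_le {h h₀ c C p : ℝ} (hh : 0 < h) (hh₀ : h ≤ h₀) (hp : 1 ≤ p) :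
    1 + (C * (c * p) / h) ^ 2 ≤ (h₀ ^ 2 + c ^ 2 * C ^ 2) / h ^ 2 * p ^ 2 := by
  have h1 : 1 ≤ h₀ ^ 2 / h ^ 2 * p ^ 2 := by
    have : 1 ≤ h₀ ^ 2 / h ^ 2 := by
      rw [one_le_div (by positivity)]
      exact pow_le_pow_left₀ hh.le hh₀ 2
    exact one_le_mul_of_one_le_of_one_le this (one_le_pow₀ hp)
  calc 1 + (C * (c * p) / h) ^ 2 ≤ h₀ ^ 2 / h ^ 2 * p ^ 2 + (C * (c * p) / h) ^ 2 := by gcongr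
    _ = _ := by ring

end InverseInequality

end LTS

end

/-! ### The error estimate for the finite element method. -/

theorem theorem3p8
    -- dimension and polynomial degrees
    (d : ℕ) (hd1 : 1 ≤ d) (hd3 : d ≤ 3) (m m' : ℕ) (hm : 1 ≤ m)
    -- stabilization parameter and the constants of the hypotheses
    (ν : ℝ) (hν0 : 0 ≤ ν) (hν : ν ≤ 1 / 2) (h₀ : ℝ) (hh₀ : 0 < h₀)
    (ccoer Ccont Ceq : ℝ) (hccoer : 0 < ccoer) (hCcont : ccoer ≤ Ccont) (hCeq : 0 < Ceq) :
    ∃ C : ℝ,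
    ∀ (Ω : Set (LTS.E d)), LTS.IsLipschitzDomain Ω →
    -- the closed subspace of `H¹(Ω)` and the symmetric, continuous, coercive bilinear form
    ∀ (V : Submodule ℝ (LTS.L2pair Ω)), V ≤ LTS.H1 Ω → IsClosed (V : Set (LTS.L2pair Ω)) →
    ∀ (a : LinearMap.BilinForm ℝ V), (∀ u v, a u v = a v u) →
      (∀ u v, |a u v| ≤ Ccont * ‖u‖ * ‖v‖) → (∀ u, ccoer * ‖u‖ ^ 2 ≤ a u u) →
    -- the mesh and its coarse part
    ∀ (M : LTS.SimplicialMesh Ω), M.h ≤ h₀ →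
    ∀ (coarse : Finset (Fin M.N)), coarse.Nonempty →
    -- the local polynomial space
    ∀ (P : Submodule ℝ (MvPolynomial (Fin d) ℝ)),
      MvPolynomial.restrictTotalDegree (Fin d) ℝ m ≤ P →
      P ≤ MvPolynomial.restrictTotalDegree (Fin d) ℝ m' →
    -- the local basis of the finite element space, indexed by the nodal points
    ∀ (nodes : Finset (LTS.E d)), (nodes : Set (LTS.E d)) ⊆ closure Ω →
    ∀ (b : Module.Basis nodes ℝ (LTS.feSpace V M P)),
      (∀ z : nodes, ∀ᵐ x ∂(MeasureTheory.volume.restrict Ω),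
        (∀ i, (z : LTS.E d) ∈ LTS.body (M.simplex i) → x ∉ LTS.body (M.simplex i)) →
          LTS.toL2 _ (b z) x = 0) →
    -- mass-lumping
    ∀ (D : nodes → ℝ), (∀ z, 0 < D z) →
      (∀ u, Ceq⁻¹ * LTS.lumpedNorm b D u ≤ ‖LTS.toL2 _ u‖ ∧
        ‖LTS.toL2 _ u‖ ≤ Ceq * LTS.lumpedNorm b D u) →
    -- the ratio of coarse to fine time steps
    ∀ (p : ℕ), 1 ≤ p →
      (∀ i, M.h / LTS.elemDiam (M.simplex i) ≤ M.quasiUnif coarse * p) →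
    -- final time, number of time steps, time step, CFL condition
    ∀ (T : ℝ), 0 < T → ∀ (N : ℕ), 1 ≤ N → ∀ (Δt : ℝ), Δt = T / N →
      (3 + Ccont / ccoer) * Ccont * LTS.globalInvConst M coarse m' Ceq h₀ ^ 2 * (Δt / M.h) ^ 2
        ≤ ν / (ν + 1) →
    -- the initial data and their transfer to the finite element space
    ∀ (rS : LTS.L2 Ω → LTS.feSpace V M P) (u₀ v₀ : LTS.L2 Ω),
    -- the semi-discrete solution
    ∀ (uS : ℝ → LTS.feSpace V M P),
      LTS.IsSemidiscreteSolution (LTS.toL2 (LTS.feSpace V M P)) b D (a.restrict (LTS.feSpace V M P)) T (rS u₀) (rS v₀) uS →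
      LTS.MemTimeSobolev T 5 (fun t => LTS.toL2 _ (uS t)) →
    -- the fully discrete solution
    ∀ (U : ℕ → LTS.feSpace V M P),
      LTS.IsLTSSolution b D {z | (z : LTS.E d) ∈ closure (M.fineRegion coarse)}
        (a.restrict (LTS.feSpace V M P)) p ν Δt (rS u₀) (rS v₀) U →
    ∀ n : ℕ, n + 1 ≤ N →
      ‖LTS.toL2 _ (uS (((n + 1 : ℕ) : ℝ) * Δt) - U (n + 1))‖ ≤
        C * Δt ^ 2 * (1 + T) *
          (Finset.Icc 2 5).sup' (Finset.nonempty_Icc.2 (by norm_num))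
            (fun l => LTS.timeDerivNorm T l (fun t => LTS.toL2 _ (uS t))) := by
  have hCpos : 0 < Ccont := hccoer.trans_le hCcont
  -- The third argument bounds Δt: the CFL condition gives 4ΛΔt² ≤ 1, and Λ ≥ C_cont C_eq² because h
  -- ≤ h₀.
  refine ⟨LTS.errorConst ν (ccoer / Ceq ^ 2) (Real.sqrt (1 / (4 * (Ccont * Ceq ^ 2)))) Ceq, ?_⟩
  intro Ω hΩ V hV _ a ha hcont hcoer M hMh coarse ⟨i₀, hi₀⟩ P _ hP nodes _ b hb D hD heq p hp hfine
    T hT N hN Δt hΔt hcfl rS u₀ v₀ uS huS _ U hU n hn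
  have hp' : (1 : ℝ) ≤ p := by exact_mod_cast hp
  have hN' : (0 : ℝ) < N := by exact_mod_cast hN
  have hh : 0 < M.h := (LTS.elemDiam_pos hd1 _).trans_le (M.elemDiam_le_h i₀)
  have hτ : 0 < Δt := hΔt ▸ div_pos hT hN'
  set I := LTS.invConst d M.shape m' with hI
  have hI0 : 0 ≤ I := (LTS.invConst_mem hd1 M.shape m').1
  set q := M.quasiUnif coarse with hq
  set Λ := Ccont * ((h₀ ^ 2 + q ^ 2 * I ^ 2) / M.h ^ 2 * Ceq ^ 2) with hΛ
  have hglob : LTS.globalInvConst M coarse m' Ceq h₀ ^ 2 = Ceq ^ 2 * (h₀ ^ 2 + q ^ 2 * I ^ 2) := by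
    rw [LTS.globalInvConst, mul_pow, Real.sq_sqrt (by positivity)]
  have hΛpos : 0 < Λ := by positivity
  have hcfl4 : 4 * Λ * Δt ^ 2 ≤ ν / (1 + ν) := by
    have h4 : 4 ≤ 3 + Ccont / ccoer := by
      linarith [(one_le_div hccoer).2 hCcont]
    rw [add_comm 1 ν]
    refine le_trans (le_of_eq ?_) ((mul_le_mul_of_nonneg_right h4
      (by positivity : 0 ≤ Λ * Δt ^ 2)).trans ((le_of_eq ?_).trans hcfl))
    · ring
    · rw [hglob, hΛ]
      ring
  -- For ν = 0 the CFL condition would bound a positive number by 0.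
  have hνpos : 0 < ν := by
    refine hν0.lt_of_ne fun h => ?_
    rw [← h, zero_div] at hcfl4
    exact absurd hcfl4 (not_le.2 (by positivity))
  have hτm : Δt ≤ Real.sqrt (1 / (4 * (Ccont * Ceq ^ 2))) := by
    refine Real.le_sqrt_of_sq_le ?_
    rw [le_div_iff₀ (by positivity)]
    have h1 : Ccont * Ceq ^ 2 ≤ Λ := by
      refine mul_le_mul_of_nonneg_left (le_mul_of_one_le_left (by positivity) ?_) hCpos.le
      rw [one_le_div (by positivity)]
      have := pow_le_pow_left₀ hh.le hMh 2
      have : 0 ≤ q ^ 2 * I ^ 2 := by positivity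
      linarith
    have h2 : ν / (1 + ν) ≤ 1 := (div_le_one (by positivity)).2 (by linarith)
    have h3 := mul_le_mul_of_nonneg_right h1 (sq_nonneg Δt)
    linarith
  -- Used with s = p for all functions and with s = 1 for those without fine degrees of freedom.
  have key : ∀ (s : ℝ), 1 ≤ s → ∀ u : LTS.feSpace V M P,
      (∀ i, LTS.toL2 _ u ∈ LTS.vanishingOn Ω (interior (LTS.body (M.simplex i))) ∨
        M.h / LTS.elemDiam (M.simplex i) ≤ q * s) →
      a u u ≤ Λ * s ^ 2 * LTS.lumped b D u u := by
    intro s hs u hu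
    have h1 := LTS.form_le_lumped hd1 hΩ hV hP hCpos.le hcont hD (heq u).2
      (K := I * (q * s) / M.h) (fun i => (hu i).imp_right fun h => by
        rw [le_div_iff₀ hh]
        calc I / LTS.elemDiam (M.simplex i) * M.h = I * (M.h / LTS.elemDiam (M.simplex i)) := by ring
          _ ≤ I * (q * s) := mul_le_mul_of_nonneg_left h hI0)
    refine h1.trans (mul_le_mul_of_nonneg_right ?_ (LTS.lumped_self_nonneg b hD u))
    calc Ccont * ((1 + (I * (q * s) / M.h) ^ 2) * Ceq ^ 2)
        ≤ Ccont * ((h₀ ^ 2 + q ^ 2 * I ^ 2) / M.h ^ 2 * s ^ 2 * Ceq ^ 2) := by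
          gcongr
          exact LTS.one_add_inverse_sq_le hh hMh hs
      _ = Λ * s ^ 2 := by rw [hΛ]; ring
  refine LTS.lts_error_le (J := LTS.toL2 (LTS.feSpace V M P)) hD (fun u v => ha u v) hCeq heq hp
    hνpos hν hτ hτm (by positivity) hΛpos (fun u => LTS.lumped_le_form hccoer hcoer hD hCeq (heq u).1)
    (fun u hu => ?_) (fun u => key p hp' u fun i => Or.inr (hfine i)) hcfl4 hT
    (by rw [hΔt]; field_simp) huS (fun l hl => Finset.le_sup' (f := fun l =>
      LTS.timeDerivNorm T l (fun t => LTS.toL2 _ (uS t))) hl) hU n hn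
  have := key 1 le_rfl u fun i => by
    by_cases hi : i ∈ coarse
    · exact Or.inr (by rw [mul_one]; exact M.h_div_elemDiam_le hd1 hi)
    · exact Or.inl (LTS.vanish_of_repr_eq_zero b hb hu hi)
  simpa using this
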